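/- All graphs are finite and simple. A graph is quintic if it is $5$-regular. It is perfectly hamiltonian if its edge set can be partitioned into perfect matchings any two of which together form a hamiltonian cycle. A rotational symmetry of a connected planar graph is a non-identity automorphism which, for some embedding of the graph in the plane, preserves the embedding and its orientation and maps some face (which may be taken to be the outer face) to itself. A $5$-edge-cut is a set $M$ of exactly five edges that consists of all edges between some vertex set and its complement; it is non-trivial if the graph minus $M$ has no component $K_1$. A suitable fragment is a plane graph $F$ with four distinct vertices $a,b,c,d$ that occur in this order in the facial walk of one face, such that $bc$ is the only edge of $F[\{a,b,c,d\}]$, the vertices $a,b,c$ have degree $3$, $d$ has degree $2$, and all other vertices have degree $5$, together with a proper edge-colouring $\chi$ with colours $1,\dots,5$ such that $\chi(bc)=1$ and the following paths exist, where the edges of each path have only the two colours stated before it: (1,2) a hamiltonian $cd$-path using $bc$; (1,3) a hamiltonian $bd$-path using $bc$; (1,4) a hamiltonian $ac$-path of $F-d$ using $bc$; (1,5) a hamiltonian $ab$-path of $F-d$ using $bc$; (2,3) a hamiltonian $bc$-path; (2,4) a hamiltonian $ad$-path of $F-c$; (2,5) an $ad$-path and a $bc$-path whose vertex sets partition $V(F)$;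 (3,4) an $ab$-path and a $cd$-path whose vertex sets partition $V(F)$; (3,5) a hamiltonian $ad$-path of $F-b$; (4,5) a hamiltonian $bc$-path of $F-a-d$. The divorce $G(F)$ is obtained from $F$ and a disjoint copy $F'$ of $F$ (where $v'$ denotes the copy of $v$) by identifying $a$ with $d'$, $d$ with $a'$, and the edge $bc$ with the edge $c'b'$ (so $b=c'$ and $c=b'$). Theorem. (1) For every suitable fragment $F$, the graph $G(F)$ is planar, quintic and perfectly hamiltonian. More precisely, let every edge of $F$ keep its colour $\chi(e)$ and let the copy in $F'$ of an edge $e$ receive the colour $\pi(\chi(e))$, where $\pi$ fixes $1$ and exchanges $2$ with $4$ and $3$ with $5$; this is a well-defined edge-colouring of $G(F)$ whose colour classes are perfect matchings any two of which together form a hamiltonian cycle. The map exchanging $v$ and $v'$ for all $v\in V(F)$ is an automorphism of $G(F)$ and a rotational symmetry. No new non-trivial $5$-edge-cuts are introduced: every non-trivial $5$-edge-cut of $G(F)$ is a non-trivial $5$-edge-cut of $F$ or of the copy $F'$, consisting of all edges between some set of vertices of that copy and the remaining vertices of that copy, where the set contains none of the four distinguished vertices of that copy. (2) There are infinitely many suitable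 fragments whose divorces are pairwise non-isomorphic. In particular, there are infinitely many planar quintic perfectly hamiltonian graphs whose automorphism group contains a rotational symmetry. -/

import Mathlib

namespace PerfHam

open SimpleGraph

/-! ### Perfect 1-factorisations -/

section Factorisation

variable {V : Type*} [DecidableEq V]

/-- The union of the two subgraphs `M` and `N` is (the edge set of) a hamiltonian cycle of `G`. -/
def IsPerfectPair (G : SimpleGraph V) (M N : G.Subgraph) : Prop :=
  ∃ (u : V) (p : G.Walk u u), p.IsHamiltonianCycle ∧ p.edgeSet = M.edgeSet ∪ N.edgeSet

/-- `P` is a partition of the edge set of `G` into 1-factors any two of which form a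
hamiltonian cycle. -/
structure IsPerfectOneFactorisation (G : SimpleGraph V) {k : ℕ} (P : Fin k → G.Subgraph) :
    Prop where
  isPerfectMatching : ∀ i, (P i).IsPerfectMatching
  existsUnique_mem : ∀ e ∈ G.edgeSet, ∃! i, e ∈ (P i).edgeSet
  isPerfectPair : ∀ i j, i ≠ j → IsPerfectPair G (P i) (P j)

/-- `G` admits a perfect 1-factorisation. -/
def IsPerfectlyHamiltonian (G : SimpleGraph V) : Prop :=
  ∃ (k : ℕ) (P : Fin k → G.Subgraph), IsPerfectOneFactorisation G P

/-- The spanning subgraph of `G` formed by the edges of colour `i`. (An edge-colouring is a function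
on all unordered pairs; its values on non-edges are irrelevant.) -/
def colourClass (G : SimpleGraph V) {k : ℕ} (col : Sym2 V → Fin k) (i : Fin k) : G.Subgraph where
  verts := Set.univ
  Adj u v := G.Adj u v ∧ col s(u, v) = i
  adj_sub h := h.1
  edge_vert _ := Set.mem_univ _
  symm := ⟨fun u v h => ⟨h.1.symm, by rw [Sym2.eq_swap]; exact h.2⟩⟩

/-- Distinct incident edges of `G` receive different colours. -/
def IsProperEdgeColouring (G : SimpleGraph V) {k : ℕ} (col : Sym2 V → Fin k) : Prop :=
  ∀ u v w, G.Adj u v → G.Adj u w → v ≠ w → col s(u, v) ≠ col s(u, w)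

end Factorisation

open Classical in
/-- Every vertex of `G` has degree `5`. -/
def IsQuintic {V : Type*} [Fintype V] (G : SimpleGraph V) : Prop :=
  G.IsRegularOfDegree 5

/-! ### Plane graphs, as rotation systems of genus `0` -/

/-- A rotation system: at every vertex, a cyclic order of the darts (oriented edges)
leaving that vertex. -/
structure RotationSystem {V : Type*} (G : SimpleGraph V) where
  next : Equiv.Perm G.Dart
  next_fst : ∀ x, (next x).fst = x.fst
  sameCycle_next : ∀ x y, x.fst = y.fst → next.SameCycle x y

namespace RotationSystem

variable {V : Type*} {G : SimpleGraph V}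

/-- Reversal of darts. -/
def revPerm (G : SimpleGraph V) : Equiv.Perm G.Dart where
  toFun := Dart.symm
  invFun := Dart.symm
  left_inv := Dart.symm_symm
  right_inv := Dart.symm_symm

/-- Face tracing: run along a dart, then leave its head through the next dart there.
The orbits of this permutation are the facial walks. -/
def facePerm (R : RotationSystem G) : Equiv.Perm G.Dart :=
  R.next * revPerm G

/-- The facial walks: orbits of darts under face tracing. -/
def Face (R : RotationSystem G) : Type _ :=
  Quotient (Equiv.Perm.SameCycle.setoid R.facePerm)

/-- The rotation system of a finite graph describes an embedding in the plane: every component has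
genus `0`. As the genus of each component is non-negative, this is Euler's formula summed over the
components, where a component consisting of an isolated vertex has one facial walk,
not counted in `Face` because it contains no dart. -/
def IsPlane (R : RotationSystem G) : Prop :=
  Nat.card V + (Nat.card R.Face + Nat.card {v : V // ∀ w, ¬ G.Adj v w}) =
    Nat.card G.edgeSet + 2 * Nat.card G.ConnectedComponent

end RotationSystem

/-- `G` has an embedding in the plane. -/
def IsPlanar {V : Type*} (G : SimpleGraph V) : Prop :=
  ∃ R : RotationSystem G, R.IsPlane

/-- `ρ` is a rotational symmetry of the connected graph `G`: it is not the identity, and for some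
embedding of `G` in the plane it preserves the embedding together with its orientation
(the cyclic orders of the darts) and maps some face, which may be taken as the outer
face, to itself. -/
def IsRotationalSymmetry {V : Type*} (G : SimpleGraph V) (ρ : G ≃g G) : Prop :=
  G.Connected ∧ (∃ v, ρ v ≠ v) ∧
    ∃ R : RotationSystem G, R.IsPlane ∧
      (∀ x : G.Dart, R.next (ρ.toHom.mapDart x) = ρ.toHom.mapDart (R.next x)) ∧
      ∃ x : G.Dart, R.facePerm.SameCycle x (ρ.toHom.mapDart x)

/-! ### Edge-cuts -/

/-- The edges of `G` with exactly one end in `X`. -/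
def edgeCut {V : Type*} (G : SimpleGraph V) (X : Set V) : Set (Sym2 V) :=
  {e | e ∈ G.edgeSet ∧ ∃ u ∈ X, ∃ v ∉ X, e = s(u, v)}

/-- `M` is an edge-cut of `G` with exactly five edges, and `G - M` has no component `K₁`. -/
def IsNontrivialFiveEdgeCut {V : Type*} (G : SimpleGraph V) (M : Set (Sym2 V)) : Prop :=
  (∃ X : Set V, M = edgeCut G X) ∧ M.ncard = 5 ∧ ∀ v, ∃ w, (G.deleteEdges M).Adj v w

/-! ### Suitable fragments and their divorce -/

/-- A finite plane graph with four distinguished vertices and an edge-colouring.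
The colours `1, 2, 3, 4, 5` are the five elements of `Fin 5` (so `5` is the same as `0`). -/
structure Fragment where
  V : Type
  [fintype : Fintype V]
  [decEq : DecidableEq V]
  graph : SimpleGraph V
  rot : RotationSystem graph
  isPlane : rot.IsPlane
  a : V
  b : V
  c : V
  d : V
  nodup : [a, b, c, d].Nodup
  col : Sym2 V → Fin 5

namespace Fragment

attribute [instance] Fragment.fintype Fragment.decEq

variable (F : Fragment)

/-- The set of the four distinguished vertices. -/
def ends : Finset F.V := {F.a, F.b, F.c, F.d}

/-- `p` is a path all of whose edges have colour `i` or `j`. -/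
def IsBiPath {F : Fragment} (i j : Fin 5) {u v : F.V} (p : F.graph.Walk u v) : Prop :=
  p.IsPath ∧ ∀ e ∈ p.edges, F.col e = i ∨ F.col e = j

open Classical in
/-- Suitable fragments. -/
structure IsSuitable : Prop where
  /-- `a, b, c, d` occur in this order in one facial walk -/
  facial : ∃ (x : F.graph.Dart) (i j k : ℕ),
    0 < i ∧ i < j ∧ j < k ∧ k < Function.minimalPeriod F.rot.facePerm x ∧
    x.fst = F.a ∧ ((F.rot.facePerm ^ i) x).fst = F.b ∧
    ((F.rot.facePerm ^ j) x).fst = F.c ∧ ((F.rot.facePerm ^ k) x).fst = F.d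
  /-- `bc` is the only edge between the distinguished vertices -/
  adj_ends : ∀ u ∈ F.ends, ∀ v ∈ F.ends, F.graph.Adj u v ↔ s(u, v) = s(F.b, F.c)
  degree_of_notMem : ∀ v ∉ F.ends, F.graph.degree v = 5
  degree_a : F.graph.degree F.a = 3
  degree_b : F.graph.degree F.b = 3
  degree_c : F.graph.degree F.c = 3
  degree_d : F.graph.degree F.d = 2
  proper : IsProperEdgeColouring F.graph F.col
  col_bc : F.col s(F.b, F.c) = 1
  path12 : ∃ p : F.graph.Walk F.c F.d, IsBiPath 1 2 p ∧ (∀ v, v ∈ p.support) ∧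
    s(F.b, F.c) ∈ p.edges
  path13 : ∃ p : F.graph.Walk F.b F.d, IsBiPath 1 3 p ∧ (∀ v, v ∈ p.support) ∧
    s(F.b, F.c) ∈ p.edges
  path14 : ∃ p : F.graph.Walk F.a F.c, IsBiPath 1 4 p ∧ (∀ v, v ∈ p.support ↔ v ≠ F.d) ∧
    s(F.b, F.c) ∈ p.edges
  path15 : ∃ p : F.graph.Walk F.a F.b, IsBiPath 1 5 p ∧ (∀ v, v ∈ p.support ↔ v ≠ F.d) ∧
    s(F.b, F.c) ∈ p.edges
  path23 : ∃ p : F.graph.Walk F.b F.c, IsBiPath 2 3 p ∧ (∀ v, v ∈ p.support)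
  path24 : ∃ p : F.graph.Walk F.a F.d, IsBiPath 2 4 p ∧ (∀ v, v ∈ p.support ↔ v ≠ F.c)
  path25 : ∃ (p : F.graph.Walk F.a F.d) (q : F.graph.Walk F.b F.c), IsBiPath 2 5 p ∧
    IsBiPath 2 5 q ∧ ∀ v, Xor (v ∈ p.support) (v ∈ q.support)
  path34 : ∃ (p : F.graph.Walk F.a F.b) (q : F.graph.Walk F.c F.d), IsBiPath 3 4 p ∧
    IsBiPath 3 4 q ∧ ∀ v, Xor (v ∈ p.support) (v ∈ q.support)
  path35 : ∃ p : F.graph.Walk F.a F.d, IsBiPath 3 5 p ∧ (∀ v, v ∈ p.support ↔ v ≠ F.b)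
  path45 : ∃ p : F.graph.Walk F.b F.c, IsBiPath 4 5 p ∧
    (∀ v, v ∈ p.support ↔ v ≠ F.a ∧ v ≠ F.d)

/-- The vertices of the divorce of `F`: those of `F`, and a second copy `v'` of every
vertex `v` of `F` other than `a, b, c, d`. -/
abbrev DivorceV : Type := F.V ⊕ {v : F.V // v ∉ F.ends}

/-- The first copy of `F` in the divorce. -/
def left (v : F.V) : F.DivorceV := Sum.inl v

/-- The second copy `F'` of `F` in the divorce, where `a' = d`, `b' = c`, `c' = b`, `d' = a`. -/
def right (v : F.V) : F.DivorceV :=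
  if v = F.a then Sum.inl F.d
  else if v = F.b then Sum.inl F.c
  else if v = F.c then Sum.inl F.b
  else if v = F.d then Sum.inl F.a
  else if h : v ∉ F.ends then Sum.inr ⟨v, h⟩
  else Sum.inl v -- impossible case

/-- The divorce of `F`: two copies of `F` with `a` identified with `d'`, `d` with `a'`,
and the edge `bc` with the edge `c'b'`. -/
def divorce : SimpleGraph F.DivorceV :=
  F.graph.map F.left ⊔ F.graph.map F.right

/-- The colour permutation fixing `1` and exchanging `2` with `4` and `3` with `5`. -/
def colPerm : Equiv.Perm (Fin 5) := Equiv.swap 2 4 * Equiv.swap 3 5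

end Fragment

end PerfHam

/-! Colours. The prescribed paths force the colours present at the distinguished vertices: 1, 2, 3
at `a`; 1, 2, 4 at `b`; 1, 3, 5 at `c`; 2, 3 at `d`; all five elsewhere (`IsSuitable.hasCol`). Since
π fixes 1 and exchanges 2 with 4 and 3 with 5, the colours at `a` and `d'` are complementary, and
those at `b` and `c'` share only the colour 1 of the common edge `bc`. So every vertex of the
divorce sees each colour exactly once, which gives regularity and perfect matchings. For two colours
i, j, the (i,j)-paths of `F` and the (π i, π j)-paths of `F'` have matching ends and close up to one
hamiltonian cycle, for example c…d in colours 1, 2 with d = a'…b' = c in colours 1, 4. Six pairs of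
colours are treated directly; exchanging the copies yields the other four.

Cuts. Every two-coloured hamiltonian cycle crosses an edge-cut at least twice, so a 5-edge-cut has
exactly one edge of each colour (`IsSuitable.eq_of_mem_cut`). A path whose ends are on the same side
is not crossed exactly once; a two-coloured path of one copy with such ends is therefore uncrossed
unless both its colours cross in that copy (`CutSet.uniform_of_not_crosses`). Applied to the
prescribed paths, this puts `a`, `b`, `c`, `d` on one side, unless a single vertex is cut off, and
leaves one of the two copies unseparated. The cut then lives in the other copy.

Embedding. Two copies of the plane map are glued at the corners of `a`, `b`, `c`, `d` in their
common face. A new edge `bc`, reversed by the exchange, is inserted between the copies, and the two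
old edges `bc` are deleted, so the construction commutes with the exchange. Planarity needs no
direct count of facial walks: non-negativity of the genus, proved by linear algebra on functions on
darts (`finrank_invariantFunctions_add_le`), bounds the number of faces above by |E| + 2 - |V|.
Hence it suffices to exhibit labels constant on facial walks that take this many values
(`RotationSystem.isPlane_of_label`). Equality shows moreover that equal labels mean equal faces, and
the label of the region between `d` and `a`, shared by both copies, yields the face preserved by the
exchange.

Infinitely many fragments. A fragment with 15 vertices is given by tables. Let v be a vertex of
degree 5 off the outer face, and take a perfectly hamiltonian planar quintic graph with 20 vertices,
one of them removed. Replacing v by this gadget keeps the fragment suitable, because every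
two-coloured path through v can be rerouted along a hamiltonian path of the gadget (`Site.spans`).
The new vertices are again off the outer face, so the replacement can be iterated, and the numbers
of vertices separate the divorces. -/

namespace PerfHam

open SimpleGraph

/-! ### Paths and the sets they cover -/

/-- There is a path of `H` from `x` to `y` whose vertex set is `S`. -/
inductive Spans {V : Type*} (H : SimpleGraph V) : V → V → Set V → Prop
  | single (x : V) : Spans H x x {x}
  | cons {x y z : V} {S : Set V} : H.Adj x y → x ∉ S → Spans H y z S → Spans H x z (insert x S)

namespace Spans

variable {V W : Type*} {H K : SimpleGraph V} {x y z : V} {S T : Set V}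

lemma left_mem (h : Spans H x y S) : x ∈ S := by
  cases h <;> simp

lemma right_mem (h : Spans H x y S) : y ∈ S := by
  induction h with
  | single => simp
  | cons _ _ _ ih => exact Set.mem_insert_of_mem _ ih

lemma cast (h : Spans H x y S) (hST : S = T) : Spans H x y T := hST ▸ h

lemma append {y' : V} (h : Spans H x y S) (hy : H.Adj y y') (h' : Spans H y' z T)
    (hd : Disjoint S T) : Spans H x z (S ∪ T) := by
  induction h with
  | single x =>
    rw [Set.singleton_union]
    exact .cons hy (by simpa using hd) h'
  | cons hxy hx _ ih =>
    rw [Set.disjoint_insert_left] at hd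
    rw [Set.insert_union]
    exact .cons hxy (by simp [hx, hd.1]) (ih hy hd.2)

lemma symm (h : Spans H x y S) : Spans H y x S := by
  induction h with
  | single x => exact .single x
  | cons hxy hx _ ih =>
    exact (ih.append hxy.symm (.single _) (by simpa using hx)).cast (by simp)

/-- Only the edges inside the vertex set of a path matter. -/
lemma map {L : SimpleGraph W} (f : V → W) (h : Spans H x y S)
    (hadj : ∀ u ∈ S, ∀ v ∈ S, H.Adj u v → L.Adj (f u) (f v)) (hinj : Set.InjOn f S) :
    Spans L (f x) (f y) (f '' S) := by
  induction h with
  | single x => exact (Spans.single _).cast (by simp)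
  | @cons x y z S hxy hx h ih =>
    rw [Set.image_insert_eq]
    refine .cons (hadj _ (by simp) _ (by simp [h.left_mem]) hxy) ?_
      (ih (fun u hu v hv => hadj u (by simp [hu]) v (by simp [hv]))
        (hinj.mono (Set.subset_insert _ _)))
    rintro ⟨u, hu, hux⟩
    exact hx (hinj (by simp [hu]) (by simp) hux ▸ hu)

lemma mono (h : Spans H x y S) (hadj : ∀ u ∈ S, ∀ v ∈ S, H.Adj u v → K.Adj u v) :
    Spans K x y S := by
  simpa using h.map id hadj (Set.injOn_id _)

lemma eq_singleton (h : Spans H x x S) : S = {x} := by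
  cases h with
  | single => rfl
  | cons _ hx h => exact absurd h.right_mem hx

/-- A path with distinct ends, split off its first vertex. -/
lemma exists_tail (h : Spans H x y S) (hxy : x ≠ y) :
    ∃ u, H.Adj x u ∧ Spans H u y (S \ {x}) := by
  cases h with
  | single => exact absurd rfl hxy
  | cons hxu hx h => exact ⟨_, hxu, h.cast (by simp [hx])⟩

/-- This is the form in which a path is opened at an interior vertex, both to read off the two
colours there and to insert the gadget in its place. -/
lemma split (h : Spans H x y S) {v : V} (hv : v ∈ S) (hx : v ≠ x) (hy : v ≠ y) :
    ∃ u w S₁ S₂, Spans H x u S₁ ∧ H.Adj u v ∧ H.Adj v w ∧ Spans H w y S₂ ∧ v ∉ S₁ ∧ v ∉ S₂ ∧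
      Disjoint S₁ S₂ ∧ S = S₁ ∪ insert v S₂ := by
  induction h with
  | single x => exact absurd hv (by simpa using hx)
  | @cons x x' y S hxx' hxS h ih =>
    have hvS : v ∈ S := by simpa [hx] using hv
    by_cases hvx' : v = x'
    · subst hvx'
      obtain ⟨w, hw, hw'⟩ := h.exists_tail hy
      refine ⟨x, w, {x}, S \ {v}, .single x, hxx', hw, hw', by simpa using hx, by simp,
        by simp [hxS], ?_⟩
      rw [Set.insert_sdiff_singleton, Set.insert_eq_of_mem hvS, Set.singleton_union]
    · obtain ⟨u, w, S₁, S₂, h₁, h₂, h₃, h₄, h₅, h₆, h₇, h₈⟩ := ih hvS hvx' hy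
      refine ⟨u, w, insert x S₁, S₂, .cons hxx' (fun hx' => hxS (by simp [h₈, hx'])) h₁, h₂, h₃,
        h₄, by simp [hx, h₅], h₆, ?_, by rw [h₈, Set.insert_union]⟩
      rw [Set.disjoint_insert_left]
      exact ⟨fun hx' => hxS (by simp [h₈, hx']), h₇⟩

/-- If at most one edge along a path leaves `X` and both or no ends are in `X`,
then all vertices are on the same side. -/
lemma uniform (h : Spans H x y S) (X : Set V)
    (hX : ∀ u ∈ S, ∀ v ∈ S, ∀ u' ∈ S, ∀ v' ∈ S, H.Adj u v → H.Adj u' v' → u ∈ X → v ∉ X →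
      u' ∈ X → v' ∉ X → s(u, v) = s(u', v'))
    (hxy : x ∈ X ↔ y ∈ X) : ∀ u ∈ S, u ∈ X ↔ x ∈ X := by
  -- The case of a path without edges leaving `X`; it is applied below to the part after the first
  -- crossing.
  have none : ∀ {x y S}, Spans H x y S →
      (∀ u ∈ S, ∀ v ∈ S, H.Adj u v → u ∈ X → v ∈ X) → ∀ u ∈ S, u ∈ X ↔ x ∈ X := by
    intro x y S h
    induction h with
    | single x => simp
    | @cons x x' y S hxx' hx h ih =>
      intro h' u hu
      have hx'm := h.left_mem
      have h1 := ih fun u hu v hv => h' u (by simp [hu]) v (by simp [hv])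
      have h2 : x ∈ X ↔ x' ∈ X := ⟨h' x (by simp) x' (by simp [hx'm]) hxx',
        h' x' (by simp [hx'm]) x (by simp) hxx'.symm⟩
      rcases hu with rfl | hu
      · rfl
      · rw [h1 u hu, h2]
  induction h with
  | single x => simp
  | @cons x x' y S hxx' hx h ih =>
    have hx'm := h.left_mem
    by_cases h2 : x ∈ X ↔ x' ∈ X
    · have := ih (fun u hu v hv u' hu' v' hv' => hX u (by simp [hu]) v (by simp [hv]) u'
        (by simp [hu']) v' (by simp [hv'])) (h2.symm.trans hxy)
      rintro u (rfl | hu)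
      · rfl
      · rw [this u hu, h2]
    -- The first edge is the only crossing, so the rest of the path stays on the side of `x'`, and
    -- `y` is not on the side of `x`.
    · exfalso
      have key := none h (fun u hu v hv huv huX => by
        by_contra hvX
        have hxm : x ∈ insert x S := by simp
        have hx'm : x' ∈ insert x S := by simp [hx'm]
        have hum : u ∈ insert x S := by simp [hu]
        have hvm : v ∈ insert x S := by simp [hv]
        have : s(u, v) = s(x, x') := by
          by_cases hxX : x ∈ X
          · exact hX u hum v hvm x hxm x' hx'm huv hxx' huX hvX hxX (by tauto)
          · rw [@Sym2.eq_swap _ x x']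
            exact hX u hum v hvm x' hx'm x hxm huv hxx'.symm huX hvX (by tauto) hxX
        have hx' : x ∈ s(u, v) := by simp [this]
        rcases Sym2.mem_iff.1 hx' with rfl | rfl
        · exact hx hu
        · exact hx hv) y h.right_mem
      tauto

lemma exists_walk (h : Spans H x y S) {G : SimpleGraph V} (hHG : H ≤ G) :
    ∃ p : G.Walk x y, p.IsPath ∧ (∀ v, v ∈ p.support ↔ v ∈ S) ∧ ∀ e ∈ p.edges, e ∈ H.edgeSet := by
  induction h with
  | single x => exact ⟨.nil, by simp⟩
  | @cons x x' y S hxx' hx h ih =>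
    obtain ⟨p, h1, h2, h3⟩ := ih
    refine ⟨.cons (hHG hxx') p, ?_, by simp [h2], by simpa using ⟨hxx', h3⟩⟩
    rw [Walk.cons_isPath_iff]
    exact ⟨h1, by simpa [h2] using hx⟩

lemma of_walk (p : H.Walk x y) (hp : p.IsPath) : Spans H x y {v | v ∈ p.support} := by
  induction p with
  | nil => exact (Spans.single _).cast (by ext; simp)
  | cons h p ih =>
    rw [Walk.cons_isPath_iff] at hp
    exact (Spans.cons h hp.2 (ih hp.1)).cast (by ext; simp)

end Spans

/-- There is a path of `H` from `x` to `y` whose vertices other than `y` form the set `S`, or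
a cycle if `x = y`. -/
def Arc {V : Type*} (H : SimpleGraph V) (x y : V) (S : Set V) : Prop :=
  ∃ u, Spans H x u S ∧ H.Adj u y

namespace Arc

variable {V : Type*} {H : SimpleGraph V} {x y z : V} {S T : Set V}

lemma of_spans (h : Spans H x y S) (hxy : x ≠ y) : Arc H x y (S \ {y}) :=
  let ⟨u, hu, hu'⟩ := h.symm.exists_tail hxy.symm
  ⟨u, hu'.symm, hu.symm⟩

lemma of_adj (h : H.Adj x y) : Arc H x y {x} := ⟨x, .single x, h⟩

lemma append (h : Arc H x y S) (h' : Arc H y z T) (hd : Disjoint S T) : Arc H x z (S ∪ T) :=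
  let ⟨_, hu, hu'⟩ := h
  let ⟨w, hw, hw'⟩ := h'
  ⟨w, hu.append hu' hw hd, hw'⟩

/-- A third vertex is needed: otherwise the arc could run along a single edge and return through the
same edge, which is not a cycle. -/
lemma isHamiltonian [Fintype V] [DecidableEq V] (h : Arc H x x S) (hS : ∀ v, v ∈ S)
    (hV : ∀ y : V, ∃ z, z ≠ x ∧ z ≠ y) : H.IsHamiltonian := by
  intro _
  obtain ⟨y, h, hyx⟩ := h
  obtain ⟨z, hzx, hzy⟩ := hV y
  -- The path avoids the closing edge. Only its first edge contains `x`, and if that edge ended in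
  -- `y` the path would stop there and miss `z`.
  have key : Spans (H \ fromEdgeSet {s(x, y)}) x y S := by
    cases h with
    | single => exact absurd hyx (H.irrefl)
    | @cons _ x' _ S hxx' hx h =>
      refine .cons ?_ hx (h.mono fun u hu v hv huv => ?_)
      · rw [sdiff_adj]
        refine ⟨hxx', ?_⟩
        simp only [fromEdgeSet_adj, Set.mem_singleton_iff, Sym2.eq_iff, not_and, not_not]
        rintro (⟨-, rfl⟩ | ⟨rfl, rfl⟩)
        · have hzS : z ∈ S := by simpa [hzx] using hS z
          rw [h.eq_singleton] at hzS
          exact absurd hzS hzy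
        · rfl
      · rw [sdiff_adj]
        refine ⟨huv, ?_⟩
        simp only [fromEdgeSet_adj, Set.mem_singleton_iff, Sym2.eq_iff, not_and, not_not]
        rintro (⟨rfl, -⟩ | ⟨-, rfl⟩)
        · exact absurd hu hx
        · exact absurd hv hx
  obtain ⟨p, hp, hpS, hpe⟩ := key.exists_walk (G := H) sdiff_le
  refine ⟨y, .cons hyx p, ?_⟩
  rw [Walk.isHamiltonianCycle_isCycle_and_isHamiltonian_tail]
  refine ⟨(Walk.cons_isCycle_iff p hyx).2 ⟨hp, fun he => ?_⟩, ?_⟩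
  · have := hpe _ he
    rw [mem_edgeSet, sdiff_adj] at this
    exact this.2 ((fromEdgeSet_adj _).2 ⟨by simp [Sym2.eq_swap], hyx.ne⟩)
  · rw [Walk.IsPath.isHamiltonian_iff]
    · intro v
      simp only [Walk.tail_cons]
      simpa using (hpS v).2 (hS v)
    · simpa using hp

end Arc

/-! ### Two-coloured subgraphs -/

/-- The spanning subgraph formed by the edges of colour `i` or `j`. -/
def biGraph {V : Type*} (G : SimpleGraph V) {k : ℕ} (col : Sym2 V → Fin k) (i j : Fin k) :
    SimpleGraph V where
  Adj u v := G.Adj u v ∧ (col s(u, v) = i ∨ col s(u, v) = j)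
  symm := ⟨fun u v h => ⟨h.1.symm, by rw [Sym2.eq_swap]; exact h.2⟩⟩
  loopless := ⟨fun u h => G.irrefl h.1⟩

section BiGraph

variable {V : Type*} {G : SimpleGraph V} {k : ℕ} {col : Sym2 V → Fin k} {i j : Fin k}

lemma biGraph_adj {u v : V} :
    (biGraph G col i j).Adj u v ↔ G.Adj u v ∧ (col s(u, v) = i ∨ col s(u, v) = j) := Iff.rfl

lemma biGraph_le : biGraph G col i j ≤ G := fun _ _ h => h.1

lemma biGraph_comm : biGraph G col i j = biGraph G col j i := by
  ext u v
  simp only [biGraph_adj]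
  tauto

lemma mem_edgeSet_biGraph {e : Sym2 V} :
    e ∈ (biGraph G col i j).edgeSet ↔ e ∈ G.edgeSet ∧ (col e = i ∨ col e = j) := by
  induction e with | _ u v => rfl

/-- There is an edge of colour `i` at `v`. -/
def HasCol (G : SimpleGraph V) (col : Sym2 V → Fin k) (v : V) (i : Fin k) : Prop :=
  ∃ w, G.Adj v w ∧ col s(v, w) = i

lemma IsProperEdgeColouring.eq_of_col_eq (h : IsProperEdgeColouring G col) {u v w : V}
    (hv : G.Adj u v) (hw : G.Adj u w) (he : col s(u, v) = col s(u, w)) : v = w :=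
  by_contra fun hne => h u v w hv hw hne he

/-- Two edges of a two-coloured subgraph at a vertex use both colours. -/
lemma IsProperEdgeColouring.col_of_adj (h : IsProperEdgeColouring G col) {u v w : V}
    (hu : (biGraph G col i j).Adj v u) (hw : (biGraph G col i j).Adj v w) (huw : u ≠ w) :
    (col s(v, u) = i ∧ col s(v, w) = j) ∨ (col s(v, u) = j ∧ col s(v, w) = i) := by
  have := h v u w hu.1 hw.1 huw
  rcases hu.2 with h1 | h1 <;> rcases hw.2 with h2 | h2 <;> rw [h1, h2] at this <;> tauto

lemma Spans.hasCol_of_ne (hp : IsProperEdgeColouring G col) {x y v : V} {S : Set V}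
    (h : Spans (biGraph G col i j) x y S) (hv : v ∈ S) (hx : v ≠ x) (hy : v ≠ y) :
    HasCol G col v i ∧ HasCol G col v j := by
  obtain ⟨u, w, S₁, S₂, h₁, h₂, h₃, h₄, -, -, hd, -⟩ := h.split hv hx hy
  have huw : u ≠ w := fun e => Set.disjoint_left.1 hd h₁.right_mem (e ▸ h₄.left_mem)
  rcases hp.col_of_adj h₂.symm h₃ huw with ⟨a, b⟩ | ⟨a, b⟩
  · exact ⟨⟨u, h₂.symm.1, a⟩, ⟨w, h₃.1, b⟩⟩
  · exact ⟨⟨w, h₃.1, b⟩, ⟨u, h₂.symm.1, a⟩⟩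

end BiGraph

/-! ### The genus is non-negative -/

section Genus

variable {D : Type*}

/-- The functions that are constant on the orbits of a permutation. -/
def invariantFunctions (σ : Equiv.Perm D) : Submodule ℚ (D → ℚ) where
  carrier := {f | ∀ x, f (σ x) = f x}
  add_mem' hf hg x := by simp [hf x, hg x]
  zero_mem' _ := rfl
  smul_mem' c f hf x := by simp [hf x]

variable [Fintype D]

/-- Pulling back along `π` embeds the functions on labels into the invariant functions. This one
inequality serves for vertices, edges and faces, so orbits never have to be counted exactly. -/
lemma card_le_finrank_invariantFunctions {ι : Type*} [Finite ι] (σ : Equiv.Perm D) (π : D → ι)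
    (hπ : Function.Surjective π) (hσ : ∀ x, π (σ x) = π x) :
    Nat.card ι ≤ Module.finrank ℚ (invariantFunctions σ) := by
  have := Fintype.ofFinite ι
  let L : (ι → ℚ) →ₗ[ℚ] invariantFunctions σ :=
    { toFun := fun f => ⟨f ∘ π, fun x => by simp [hσ]⟩
      map_add' := fun _ _ => rfl
      map_smul' := fun _ _ => rfl }
  have hL : Function.Injective L := fun f g h =>
    hπ.injective_comp_right (congrArg Subtype.val h)
  simpa using LinearMap.finrank_le_finrank_of_injective hL

/-- If two permutations generate a transitive group, then the numbers of orbits of both of them and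
of their product sum to at most `|D| + 2`. -/
lemma finrank_invariantFunctions_add_le (σ α : Equiv.Perm D)
    (hc : ∀ f : D → ℚ, (∀ x, f (σ x) = f x) → (∀ x, f (α x) = f x) → ∀ x y, f x = f y) :
    Module.finrank ℚ (invariantFunctions σ) + Module.finrank ℚ (invariantFunctions α) +
      Module.finrank ℚ (invariantFunctions (σ * α)) ≤ Fintype.card D + 2 := by
  classical
  set A := invariantFunctions σ
  set B := invariantFunctions α
  set C := invariantFunctions (σ * α)
  have one : ∀ N : Submodule ℚ (D → ℚ), (∀ f ∈ N, ∀ x y, f x = f y) →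
      Module.finrank ℚ N ≤ 1 := by
    intro N hN
    rcases isEmpty_or_nonempty D with hD | ⟨⟨d⟩⟩
    · rw [Module.finrank_zero_of_subsingleton]
      exact zero_le_one
    · have : N ≤ Submodule.span ℚ {(fun _ => 1 : D → ℚ)} := fun f hf =>
        Submodule.mem_span_singleton.2 ⟨f d, by ext x; simp [hN f hf x d]⟩
      exact (Submodule.finrank_mono this).trans (finrank_span_le_card _)
  have hAB : Module.finrank ℚ ↥(A ⊓ B) ≤ 1 := one _ fun f hf => hc f hf.1 hf.2
  have h1 := Submodule.finrank_sup_add_finrank_inf_eq A B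
  -- The pairing sends g to the functional given by g - g ∘ α⁻¹. It vanishes on `A` and `B`, and its
  -- kernel consists of constants; hence dim C ≤ 1 + |D| - dim (A + B), while dim (A ∩ B) ≤ 1.
  let T : C →ₗ[ℚ] Module.Dual ℚ (D → ℚ) :=
    (LinearMap.mk₂ ℚ (fun (g : C) (f : D → ℚ) => ∑ x, (g.1 x - g.1 (α.symm x)) * f x)
      (fun g g' f => by simp only [← Finset.sum_add_distrib]; congr; ext; simp; ring)
      (fun c g f => by simp only [smul_eq_mul, Finset.mul_sum]; congr; ext; simp; ring)
      (fun g f f' => by simp only [← Finset.sum_add_distrib]; congr; ext; simp; ring)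
      (fun c g f => by simp only [smul_eq_mul, Finset.mul_sum]; congr; ext; simp; ring))
  have hT : ∀ (g : C) f, T g f = ∑ x, (g.1 x - g.1 (α.symm x)) * f x := fun _ _ => rfl
  have hker : Module.finrank ℚ (LinearMap.ker T) ≤ 1 := by
    have hk : ∀ g : C, g ∈ LinearMap.ker T → ∀ x y, g.1 x = g.1 y := by
      intro g hg
      have h2 : ∀ x, g.1 (α.symm x) = g.1 x := by
        intro x
        have h3 := LinearMap.congr_fun (LinearMap.mem_ker.1 hg) (Pi.single x 1)
        rw [hT] at h3
        simp [Pi.single_apply] at h3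
        linarith
      have h3 : ∀ x, g.1 (α x) = g.1 x := fun x => by rw [← h2 (α x), Equiv.symm_apply_apply]
      refine hc g.1 (fun x => ?_) h3
      have h4 := g.2 (α.symm x)
      simp only [Equiv.Perm.mul_apply, Equiv.apply_symm_apply] at h4
      rw [h4, h2]
    rw [LinearEquiv.finrank_eq
      (Submodule.equivMapOfInjective C.subtype C.subtype_injective (LinearMap.ker T))]
    refine one _ ?_
    rintro _ ⟨g, hg, rfl⟩
    exact hk g hg
  -- Both cases are a change of variables in the sum: by α for `B`, and by σ for `A`, where
  -- invariance of g under σα turns g ∘ α⁻¹ into g ∘ σ.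
  have hrange : LinearMap.range T ≤ (A ⊔ B).dualAnnihilator := by
    rintro _ ⟨g, rfl⟩
    rw [Submodule.mem_dualAnnihilator]
    have hB : ∀ f ∈ B, T g f = 0 := by
      intro f hf
      rw [hT]
      simp only [sub_mul, Finset.sum_sub_distrib]
      rw [sub_eq_zero, ← Equiv.sum_comp α fun x => g.1 (α.symm x) * f x]
      exact Finset.sum_congr rfl fun x _ => by rw [hf x, Equiv.symm_apply_apply]
    have hA : ∀ f ∈ A, T g f = 0 := by
      intro f hf
      rw [hT]
      simp only [sub_mul, Finset.sum_sub_distrib]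
      rw [sub_eq_zero, ← Equiv.sum_comp σ fun x => g.1 x * f x]
      refine Finset.sum_congr rfl fun x _ => ?_
      have h4 := g.2 (α.symm x)
      simp only [Equiv.Perm.mul_apply, Equiv.apply_symm_apply] at h4
      rw [h4, hf x]
    intro f hf
    obtain ⟨u, hu, v, hv, rfl⟩ := Submodule.mem_sup.1 hf
    rw [map_add, hA u hu, hB v hv, add_zero]
  have h2 := T.finrank_range_add_finrank_ker
  have h3 := Submodule.finrank_mono hrange
  have h4 := Subspace.finrank_add_finrank_dualAnnihilator_eq (A ⊔ B)
  rw [Module.finrank_fintype_fun_eq_card] at h4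
  omega

end Genus

/-! ### Recognising plane rotation systems -/

namespace RotationSystem

variable {V : Type*} {G : SimpleGraph V}

lemma exists_dart_fst (hG : G.Connected) [Nontrivial V] (v : V) : ∃ x : G.Dart, x.fst = v := by
  obtain ⟨w, hw⟩ := hG.preconnected.exists_adj_of_nontrivial v
  exact ⟨⟨(v, w), hw⟩, rfl⟩

lemma card_isolated (hG : G.Connected) [Nontrivial V] :
    Nat.card {v : V // ∀ w, ¬ G.Adj v w} = 0 := by
  have : IsEmpty {v : V // ∀ w, ¬ G.Adj v w} :=
    ⟨fun v => by
      obtain ⟨w, hw⟩ := hG.preconnected.exists_adj_of_nontrivial v.1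
      exact v.2 w hw⟩
  exact Nat.card_of_isEmpty

lemma card_connectedComponent (hG : G.Connected) : Nat.card G.ConnectedComponent = 1 := by
  have := hG.nonempty
  have := hG.preconnected.subsingleton_connectedComponent
  exact Nat.card_unique

lemma isPlane_iff_of_connected (hG : G.Connected) [Nontrivial V] (R : RotationSystem G) :
    R.IsPlane ↔ Nat.card V + Nat.card R.Face = Nat.card G.edgeSet + 2 := by
  rw [IsPlane, card_isolated hG, card_connectedComponent hG, add_zero, mul_one]

variable [Finite V]

lemma card_dart : Nat.card G.Dart = 2 * Nat.card G.edgeSet := by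
  classical
  have := Fintype.ofFinite V
  rw [Nat.card_eq_fintype_card, dart_card_eq_twice_card_edges, Nat.card_eq_fintype_card,
    edgeFinset_card]

/-- The rotation and the reversal act transitively on the darts of a connected graph, so the orbit
inequality reads |V| + |E| + |F| ≤ 2|E| + 2. -/
lemma card_face_le (hG : G.Connected) [Nontrivial V] (R : RotationSystem G) :
    Nat.card V + Nat.card R.Face ≤ Nat.card G.edgeSet + 2 := by
  classical
  have := Fintype.ofFinite V
  have h1 := finrank_invariantFunctions_add_le R.next (revPerm G) fun f h1 h2 => by
    have h3 : ∀ x y : G.Dart, x.fst = y.fst → f x = f y := by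
      intro x y hxy
      obtain ⟨n, rfl⟩ := (R.sameCycle_next x y hxy).exists_nat_pow_eq
      clear hxy
      induction n with
      | zero => rfl
      | succ n ih => rw [pow_succ', Equiv.Perm.mul_apply, h1, ih]
    have h4 : ∀ u v : V, G.Reachable u v → ∀ x y : G.Dart, x.fst = u → y.fst = v → f x = f y := by
      rintro u v ⟨p⟩
      induction p with
      | nil => exact fun x y hx hy => h3 x y (hx.trans hy.symm)
      | @cons u v w h p ih =>
        intro x y hx hy
        rw [h3 x ⟨(u, v), h⟩ hx, ← h2]
        exact ih _ _ rfl hy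
    exact fun x y => h4 _ _ (hG.preconnected x.fst y.fst) x y rfl rfl
  have h2 := card_le_finrank_invariantFunctions R.next (fun x : G.Dart => x.fst)
    (exists_dart_fst hG) R.next_fst
  have h3 : Nat.card G.edgeSet ≤ _ := card_le_finrank_invariantFunctions (revPerm G)
    (fun x : G.Dart => (⟨x.edge, x.edge_mem⟩ : G.edgeSet))
    (by
      rintro ⟨e, he⟩
      induction e with | _ u v
      exact ⟨⟨(u, v), he⟩, rfl⟩)
    (fun x => Subtype.ext x.edge_symm)
  have : Finite R.Face := Quotient.finite _
  have h4 : Nat.card R.Face ≤ _ := card_le_finrank_invariantFunctions R.facePerm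
    (fun x : G.Dart => (Quotient.mk _ x : R.Face)) Quotient.mk_surjective
    (fun x => Quotient.sound (Equiv.Perm.sameCycle_apply_left.2 (Equiv.Perm.SameCycle.refl _ _)))
  have h5 := card_dart (G := G)
  rw [Nat.card_eq_fintype_card] at h5
  change _ + _ + Module.finrank ℚ (invariantFunctions R.facePerm) ≤ _ at h1
  omega

instance finite_dart : Finite G.Dart := .of_injective _ Dart.toProd_injective

instance (R : RotationSystem G) : Finite R.Face := Quotient.finite _

/-- Many labels that are constant on facial walks show that a rotation system is plane. -/
lemma isPlane_of_label (hG : G.Connected) [Nontrivial V] (R : RotationSystem G) {Λ : Type*}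
    [Finite Λ] (L : G.Dart → Λ) (hL : ∀ x, L (R.facePerm x) = L x) (hs : Function.Surjective L)
    (hcard : Nat.card G.edgeSet + 2 ≤ Nat.card V + Nat.card Λ) :
    R.IsPlane ∧ ∀ x y, L x = L y → R.facePerm.SameCycle x y := by
  have hcyc : ∀ x y, R.facePerm.SameCycle x y → L x = L y := by
    intro x y hxy
    obtain ⟨n, rfl⟩ := hxy.exists_nat_pow_eq
    clear hxy
    induction n with
    | zero => rfl
    | succ n ih => rw [pow_succ', Equiv.Perm.mul_apply, hL, ih]
  let f : R.Face → Λ := Quotient.lift L hcyc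
  have hf : Function.Surjective f := fun l => by
    obtain ⟨x, rfl⟩ := hs l
    exact ⟨Quotient.mk _ x, rfl⟩
  have h1 := Nat.card_le_card_of_surjective f hf
  have h2 := R.card_face_le hG
  refine ⟨(R.isPlane_iff_of_connected hG).2 (by omega), fun x y hxy => ?_⟩
  -- The labels bound the number of faces from below and the genus bounds it from above by the same
  -- number, so a surjection from faces to labels is injective.
  have h3 : Function.Bijective f := (Nat.bijective_iff_surjective_and_card f).2 ⟨hf, by omega⟩
  exact Quotient.exact (@h3.1 (Quotient.mk _ x) (Quotient.mk _ y) hxy)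

end RotationSystem

/-! ### Rotation systems from permutations -/

/-- A description of the darts of `G` by the elements of `T`, with permutations `σ` (rotation at a
vertex) and `α` (reversal). -/
structure CombMap {V : Type*} (G : SimpleGraph V) (T : Type*) where
  vert : T → V
  σ : Equiv.Perm T
  α : T → T
  α_α : ∀ t, α (α t) = t
  adj : ∀ t, G.Adj (vert t) (vert (α t))
  inj : ∀ t t', vert t = vert t' → vert (α t) = vert (α t') → t = t'
  surj : ∀ u v, G.Adj u v → ∃ t, vert t = u ∧ vert (α t) = v
  vert_σ : ∀ t, vert (σ t) = vert t
  sameCycle_σ : ∀ t t', vert t = vert t' → σ.SameCycle t t'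

namespace CombMap

variable {V T : Type*} {G : SimpleGraph V} (C : CombMap G T)

/-- The elements of `T` as darts. -/
noncomputable def dart : T ≃ G.Dart :=
  Equiv.ofBijective (fun t => ⟨(C.vert t, C.vert (C.α t)), C.adj t⟩)
    ⟨fun t t' h => C.inj t t' (congrArg (fun x : G.Dart => x.fst) h)
      (congrArg (fun x : G.Dart => x.snd) h), fun x => by
        obtain ⟨t, h1, h2⟩ := C.surj _ _ x.adj
        exact ⟨t, Dart.ext _ _ (Prod.ext h1 h2)⟩⟩

@[simp] lemma dart_fst (t : T) : (C.dart t).fst = C.vert t := rfl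

lemma dart_symm (t : T) : (C.dart t).symm = C.dart (C.α t) :=
  Dart.ext _ _ (Prod.ext rfl (congrArg C.vert (C.α_α t).symm))

/-- The rotation system described by `C`. -/
noncomputable def rot : RotationSystem G where
  next := C.dart.permCongr C.σ
  next_fst x := by
    obtain ⟨t, rfl⟩ := C.dart.surjective x
    simp [Equiv.permCongr_apply, C.vert_σ]
  sameCycle_next x y h := by
    obtain ⟨t, rfl⟩ := C.dart.surjective x
    obtain ⟨t', rfl⟩ := C.dart.surjective y
    obtain ⟨n, hn⟩ := C.sameCycle_σ t t' h
    refine ⟨n, ?_⟩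
    have : C.dart.permCongr C.σ ^ n = C.dart.permCongr (C.σ ^ n) :=
      (map_zpow C.dart.permCongrHom C.σ n).symm
    rw [this]
    simp [Equiv.permCongr_apply, hn]

lemma rot_next (t : T) : C.rot.next (C.dart t) = C.dart (C.σ t) := by
  simp [rot, Equiv.permCongr_apply]

lemma rot_facePerm (t : T) : C.rot.facePerm (C.dart t) = C.dart (C.σ (C.α t)) := by
  rw [← rot_next, ← dart_symm]
  rfl

lemma rot_facePerm_pow (n : ℕ) (t : T) :
    (C.rot.facePerm ^ n) (C.dart t) = C.dart ((fun t => C.σ (C.α t))^[n] t) := by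
  induction n generalizing t with
  | zero => rfl
  | succ n ih => rw [pow_succ, Equiv.Perm.mul_apply, rot_facePerm, ih, Function.iterate_succ_apply]

/-- Since `T` counts darts, that is, edges twice, Euler's formula appears doubled. -/
lemma isPlane_of_label [Finite V] (hG : G.Connected) [Nontrivial V] {Λ : Type*}
    [Finite Λ] (L : T → Λ) (hL : ∀ t, L (C.σ (C.α t)) = L t) (hs : Function.Surjective L)
    (hcard : Nat.card T + 4 ≤ 2 * Nat.card V + 2 * Nat.card Λ) :
    C.rot.IsPlane ∧ ∀ t t', L t = L t' → C.rot.facePerm.SameCycle (C.dart t) (C.dart t') := by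
  have hT : Nat.card T = 2 * Nat.card G.edgeSet := by
    rw [Nat.card_congr C.dart, RotationSystem.card_dart]
  obtain ⟨h1, h2⟩ := C.rot.isPlane_of_label hG (L ∘ C.dart.symm) (fun x => by
    obtain ⟨t, rfl⟩ := C.dart.surjective x
    simp [rot_facePerm, hL]) (hs.comp C.dart.symm.surjective) (by omega)
  exact ⟨h1, fun t t' h => h2 _ _ (by simpa using h)⟩

end CombMap

namespace Fragment

variable {F : Fragment}

/-! ### The paths of a suitable fragment -/

/-- The subgraph of a fragment formed by two colours. -/
abbrev bi (F : Fragment) (i j : Fin 5) : SimpleGraph F.V := biGraph F.graph F.col i j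

lemma spans_of_isBiPath {i j : Fin 5} {x y : F.V} {p : F.graph.Walk x y} (hp : IsBiPath i j p) :
    Spans (F.bi i j) x y {v | v ∈ p.support} := by
  have hq : ∀ e ∈ p.edges, e ∈ (F.bi i j).edgeSet := fun e he =>
    mem_edgeSet_biGraph.2 ⟨p.edges_subset_edgeSet he, hp.2 e he⟩
  have := Spans.of_walk (p.transfer _ hq) (hp.1.transfer hq)
  simpa using this

lemma exists_isBiPath {i j : Fin 5} {x y : F.V} {S : Set F.V} (h : Spans (F.bi i j) x y S) :
    ∃ p : F.graph.Walk x y, IsBiPath i j p ∧ ∀ v, v ∈ p.support ↔ v ∈ S := by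
  obtain ⟨p, h1, h2, h3⟩ := h.exists_walk biGraph_le
  exact ⟨p, ⟨h1, fun e he => (mem_edgeSet_biGraph.1 (h3 e he)).2⟩, h2⟩

lemma exists_isBiPath_cons {i j : Fin 5} {x x' y : F.V} {S : Set F.V}
    (h : Spans (F.bi i j) x' y S) (hadj : F.graph.Adj x x') (hcol : F.col s(x, x') = i)
    (hx : x ∉ S) : ∃ p : F.graph.Walk x y, IsBiPath i j p ∧
      (∀ v, v ∈ p.support ↔ v ∈ insert x S) ∧ s(x, x') ∈ p.edges := by
  obtain ⟨p, ⟨h1, h2⟩, h3⟩ := exists_isBiPath h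
  refine ⟨.cons hadj p, ⟨(Walk.cons_isPath_iff _ _).2 ⟨h1, by rwa [h3]⟩, ?_⟩, ?_, by simp⟩
  · intro e he
    rw [Walk.edges_cons, List.mem_cons] at he
    rcases he with rfl | he
    · exact Or.inl hcol
    · exact h2 e he
  · simp [h3]

lemma IsBiPath.reverse {i j : Fin 5} {x y : F.V} {p : F.graph.Walk x y} (h : IsBiPath i j p) :
    IsBiPath i j p.reverse := ⟨h.1.reverse, by simpa using h.2⟩

/-- A path that starts in an end of one of its edges, split off that edge. -/
lemma spans_of_mem_edges {i j : Fin 5} {x x' y : F.V} {p : F.graph.Walk x y}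
    (hp : IsBiPath i j p) (hx : s(x, x') ∈ p.edges) :
    Spans (F.bi i j) x' y {v | v ∈ p.support ∧ v ≠ x} := by
  obtain ⟨hp1, hp2⟩ := hp
  cases p with
  | nil => simp at hx
  | @cons _ w _ hw q =>
    rw [Walk.cons_isPath_iff] at hp1
    have hw' : x' = w := by
      rw [Walk.edges_cons, List.mem_cons] at hx
      rcases hx with hx | hx
      · rcases Sym2.eq_iff.1 hx with ⟨-, h⟩ | ⟨h, -⟩
        · exact h
        · exact absurd h hw.ne
      · exact absurd (Walk.fst_mem_support_of_mem_edges _ hx) hp1.2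
    subst hw'
    refine (spans_of_isBiPath (i := i) (j := j) (p := q)
      ⟨hp1.1, fun e he => hp2 e (by simp [he])⟩).cast ?_
    ext v
    simp only [Set.mem_ofPred_eq, Walk.support_cons, List.mem_cons]
    constructor
    · exact fun hv => ⟨Or.inr hv, fun h => hp1.2 (h ▸ hv)⟩
    · tauto

/-- The two-coloured paths of a suitable fragment, with the edge `bc` removed from those
paths that are required to contain it. -/
structure Paths (F : Fragment) : Prop where
  p12 : Spans (F.bi 1 2) F.b F.d {v | v ≠ F.c}
  p13 : Spans (F.bi 1 3) F.c F.d {v | v ≠ F.b}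
  p14 : Spans (F.bi 1 4) F.a F.b {v | v ≠ F.c ∧ v ≠ F.d}
  p15 : Spans (F.bi 1 5) F.a F.c {v | v ≠ F.b ∧ v ≠ F.d}
  p23 : Spans (F.bi 2 3) F.b F.c Set.univ
  p24 : Spans (F.bi 2 4) F.a F.d {v | v ≠ F.c}
  p25 : ∃ S, Spans (F.bi 2 5) F.a F.d S ∧ Spans (F.bi 2 5) F.b F.c Sᶜ
  p34 : ∃ S, Spans (F.bi 3 4) F.a F.b S ∧ Spans (F.bi 3 4) F.c F.d Sᶜ
  p35 : Spans (F.bi 3 5) F.a F.d {v | v ≠ F.b}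
  p45 : Spans (F.bi 4 5) F.b F.c {v | v ≠ F.a ∧ v ≠ F.d}

lemma distinct (F : Fragment) : F.a ≠ F.b ∧ F.a ≠ F.c ∧ F.a ≠ F.d ∧ F.b ≠ F.c ∧ F.b ≠ F.d ∧
    F.c ≠ F.d := by
  have := F.nodup
  simp only [List.nodup_cons, List.mem_cons, List.not_mem_nil, or_false, not_or] at this
  tauto

lemma mem_ends {v : F.V} : v ∈ F.ends ↔ v = F.a ∨ v = F.b ∨ v = F.c ∨ v = F.d := by
  simp [ends]

lemma IsSuitable.paths (h : F.IsSuitable) : F.Paths := by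
  have hne := F.distinct
  constructor
  · obtain ⟨p, h1, h2, h3⟩ := h.path12
    exact (spans_of_mem_edges h1 (by rwa [Sym2.eq_swap])).cast (by ext; simp [h2])
  · obtain ⟨p, h1, h2, h3⟩ := h.path13
    exact (spans_of_mem_edges h1 h3).cast (by ext; simp [h2])
  · obtain ⟨p, h1, h2, h3⟩ := h.path14
    have h1' : IsBiPath 1 4 p.reverse := ⟨h1.1.reverse, by simpa using h1.2⟩
    exact (spans_of_mem_edges (x' := F.b) h1' (by
      rw [Sym2.eq_swap]; simpa using h3)).symm.cast (by ext; simp [h2]; tauto)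
  · obtain ⟨p, h1, h2, h3⟩ := h.path15
    have h1' : IsBiPath 1 5 p.reverse := ⟨h1.1.reverse, by simpa using h1.2⟩
    exact (spans_of_mem_edges (x' := F.c) h1' (by simpa using h3)).symm.cast
      (by ext; simp [h2]; tauto)
  · obtain ⟨p, h1, h2⟩ := h.path23
    exact (spans_of_isBiPath h1).cast (by ext; simp [h2])
  · obtain ⟨p, h1, h2⟩ := h.path24
    exact (spans_of_isBiPath h1).cast (by ext; simp [h2])
  · obtain ⟨p, q, h1, h2, h3⟩ := h.path25
    refine ⟨_, spans_of_isBiPath h1, (spans_of_isBiPath h2).cast ?_⟩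
    ext v
    have := h3 v
    simp only [Xor, Set.mem_ofPred_eq, Set.mem_compl_iff] at *
    tauto
  · obtain ⟨p, q, h1, h2, h3⟩ := h.path34
    refine ⟨_, spans_of_isBiPath h1, (spans_of_isBiPath h2).cast ?_⟩
    ext v
    have := h3 v
    simp only [Xor, Set.mem_ofPred_eq, Set.mem_compl_iff] at *
    tauto
  · obtain ⟨p, h1, h2⟩ := h.path35
    exact (spans_of_isBiPath h1).cast (by ext; simp [h2])
  · obtain ⟨p, h1, h2⟩ := h.path45
    exact (spans_of_isBiPath h1).cast (by ext; simp [h2])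

/-- The purely local conditions on a suitable fragment. -/
structure Local (F : Fragment) : Prop where
  proper : IsProperEdgeColouring F.graph F.col
  adj_bc : F.graph.Adj F.b F.c
  adj_ends : ∀ u ∈ F.ends, ∀ v ∈ F.ends, F.graph.Adj u v → s(u, v) = s(F.b, F.c)
  col_bc : F.col s(F.b, F.c) = 1

lemma IsSuitable.local (h : F.IsSuitable) : F.Local :=
  ⟨h.proper, (h.adj_ends F.b (by simp [ends]) F.c (by simp [ends])).2 rfl,
    fun u hu v hv huv => (h.adj_ends u hu v hv).1 huv, h.col_bc⟩

/-- The two-coloured paths determine the suitability of a fragment. -/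
lemma IsSuitable.of_paths (hp : F.Paths) (hl : F.Local)
    (facial : ∃ (x : F.graph.Dart) (i j k : ℕ),
      0 < i ∧ i < j ∧ j < k ∧ k < Function.minimalPeriod F.rot.facePerm x ∧
      x.fst = F.a ∧ ((F.rot.facePerm ^ i) x).fst = F.b ∧
      ((F.rot.facePerm ^ j) x).fst = F.c ∧ ((F.rot.facePerm ^ k) x).fst = F.d)
    (hdeg : ∀ v, Nat.card (F.graph.neighborSet v) =
      if v = F.d then 2 else if v ∈ F.ends then 3 else 5) : F.IsSuitable := by
  classical
  have hne := F.distinct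
  have hdeg' : ∀ v [Fintype (F.graph.neighborSet v)], F.graph.degree v =
      if v = F.d then 2 else if v ∈ F.ends then 3 else 5 := fun v _ => by
    rw [← hdeg v, Nat.card_eq_fintype_card, card_neighborSet_eq_degree]
  have hcb : F.col s(F.c, F.b) = 1 := by rw [Sym2.eq_swap]; exact hl.col_bc
  refine
    { facial := facial
      adj_ends := fun u hu v hv => ⟨hl.adj_ends u hu v hv, fun huv => ?_⟩
      degree_of_notMem := fun v hv => ?_
      degree_a := ?_
      degree_b := ?_
      degree_c := ?_
      degree_d := ?_
      proper := hl.proper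
      col_bc := hl.col_bc
      path12 := ?_
      path13 := ?_
      path14 := ?_
      path15 := ?_
      path23 := ?_
      path24 := ?_
      path25 := ?_
      path34 := ?_
      path35 := ?_
      path45 := ?_ }
  · rw [← mem_edgeSet, huv]
    exact hl.adj_bc
  · rw [hdeg', if_neg (fun h => hv (by simp [h, ends])), if_neg hv]
  · rw [hdeg', if_neg hne.2.2.1, if_pos (by simp [ends])]
  · rw [hdeg', if_neg hne.2.2.2.2.1, if_pos (by simp [ends])]
  · rw [hdeg', if_neg hne.2.2.2.2.2, if_pos (by simp [ends])]
  · rw [hdeg', if_pos rfl]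
  · obtain ⟨p, h1, h2, h3⟩ := exists_isBiPath_cons hp.p12 hl.adj_bc.symm hcb (by simp)
    exact ⟨p, h1, fun v => by rw [h2]; simp; tauto, by rwa [Sym2.eq_swap]⟩
  · obtain ⟨p, h1, h2, h3⟩ := exists_isBiPath_cons hp.p13 hl.adj_bc hl.col_bc (by simp)
    exact ⟨p, h1, fun v => by rw [h2]; simp; tauto, h3⟩
  · obtain ⟨p, h1, h2, h3⟩ := exists_isBiPath_cons hp.p14.symm hl.adj_bc.symm hcb (by simp)
    refine ⟨p.reverse, h1.reverse, fun v => ?_, by rw [Sym2.eq_swap]; simpa using h3⟩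
    rw [Walk.support_reverse, List.mem_reverse, h2, Set.mem_insert_iff, Set.mem_ofPred_eq]
    by_cases hv : v = F.c
    · simp [hv, hne]
    · simp [hv]
  · obtain ⟨p, h1, h2, h3⟩ := exists_isBiPath_cons hp.p15.symm hl.adj_bc hl.col_bc (by simp)
    refine ⟨p.reverse, h1.reverse, fun v => ?_, by simpa using h3⟩
    rw [Walk.support_reverse, List.mem_reverse, h2, Set.mem_insert_iff, Set.mem_ofPred_eq]
    by_cases hv : v = F.b
    · simp [hv, hne]
    · simp [hv]
  · obtain ⟨p, h1, h2⟩ := exists_isBiPath hp.p23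
    exact ⟨p, h1, fun v => by simp [h2]⟩
  · obtain ⟨p, h1, h2⟩ := exists_isBiPath hp.p24
    exact ⟨p, h1, fun v => by simp [h2]⟩
  · obtain ⟨S, hS, hT⟩ := hp.p25
    obtain ⟨p, h1, h2⟩ := exists_isBiPath hS
    obtain ⟨q, h3, h4⟩ := exists_isBiPath hT
    exact ⟨p, q, h1, h3, fun v => by rw [h2, h4]; simp only [Xor, Set.mem_compl_iff]; tauto⟩
  · obtain ⟨S, hS, hT⟩ := hp.p34
    obtain ⟨p, h1, h2⟩ := exists_isBiPath hS
    obtain ⟨q, h3, h4⟩ := exists_isBiPath hT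
    exact ⟨p, q, h1, h3, fun v => by rw [h2, h4]; simp only [Xor, Set.mem_compl_iff]; tauto⟩
  · obtain ⟨p, h1, h2⟩ := exists_isBiPath hp.p35
    exact ⟨p, h1, fun v => by simp [h2]⟩
  · obtain ⟨p, h1, h2⟩ := exists_isBiPath hp.p45
    exact ⟨p, h1, fun v => by simp [h2]⟩

lemma _root_.PerfHam.Spans.hasCol_left {V : Type*} {G : SimpleGraph V} {col : Sym2 V → Fin 5}
    {i j : Fin 5} {x y : V} {S : Set V} (h : Spans (biGraph G col i j) x y S) (hxy : x ≠ y) :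
    ∃ u ∈ S, G.Adj x u ∧ (col s(x, u) = i ∨ col s(x, u) = j) := by
  obtain ⟨u, h1, h2⟩ := h.exists_tail hxy
  exact ⟨u, h2.left_mem.1, h1⟩

-- The edges at `v` show at most `G.degree v` colours, and `T` already accounts for that many.
open Classical in
lemma mem_of_hasCol {V : Type*} [Fintype V] {G : SimpleGraph V} {col : Sym2 V → Fin 5} {v : V}
    {T : Finset (Fin 5)} (hT : ∀ k ∈ T, HasCol G col v k) (hdeg : G.degree v = T.card) {k : Fin 5}
    (hk : HasCol G col v k) : k ∈ T := by
  have hsub : T ⊆ (G.neighborFinset v).image fun w => col s(v, w) := by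
    intro k hk
    obtain ⟨w, hw, hw'⟩ := hT k hk
    exact Finset.mem_image.2 ⟨w, by simpa using hw, hw'⟩
  rw [Finset.eq_of_subset_of_card_le hsub (Finset.card_image_le.trans hdeg.le)]
  obtain ⟨w, hw, hw'⟩ := hk
  exact Finset.mem_image.2 ⟨w, by simpa using hw, hw'⟩

/-- An interior vertex of a two-coloured path sees both colours, and the edge next to an end of a
path with `bc` removed cannot have colour 1 again. The colours found exhaust the degree, so there
are no others. -/
lemma IsSuitable.hasCol (h : F.IsSuitable) :
    (∀ k, HasCol F.graph F.col F.a k ↔ k = 1 ∨ k = 2 ∨ k = 3) ∧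
    (∀ k, HasCol F.graph F.col F.b k ↔ k = 1 ∨ k = 2 ∨ k = 4) ∧
    (∀ k, HasCol F.graph F.col F.c k ↔ k = 1 ∨ k = 3 ∨ k = 5) ∧
    (∀ k, HasCol F.graph F.col F.d k ↔ k = 2 ∨ k = 3) ∧
    ∀ v ∉ F.ends, ∀ k, HasCol F.graph F.col v k := by
  classical
  obtain ⟨hab, hac, had, hbc, hbd, hcd⟩ := F.distinct
  have hl := h.local
  have hp := h.paths
  have hcb : F.col s(F.c, F.b) = 1 := by rw [Sym2.eq_swap]; exact hl.col_bc
  have key : ∀ v (T : Finset (Fin 5)), (∀ k ∈ T, HasCol F.graph F.col v k) →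
      F.graph.degree v = T.card → ∀ k, HasCol F.graph F.col v k ↔ k ∈ T :=
    fun v T h1 h2 k => ⟨mem_of_hasCol h1 h2, h1 k⟩
  refine ⟨fun k => ?_, fun k => ?_, fun k => ?_, fun k => ?_, fun v hv k => ?_⟩
  · have h1 := hp.p12.hasCol_of_ne hl.proper (v := F.a) hac hab had
    have h2 := hp.p23.hasCol_of_ne hl.proper (v := F.a) trivial hab hac
    rw [key F.a {1, 2, 3} (by simp [h1, h2]) h.degree_a]
    simp
  · have h1 : HasCol F.graph F.col F.b 1 := ⟨F.c, hl.adj_bc, hl.col_bc⟩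
    have h2 : HasCol F.graph F.col F.b 2 := by
      obtain ⟨u, hu, h3, h4⟩ := hp.p12.hasCol_left hbd
      refine ⟨u, h3, h4.resolve_left fun h5 => hu ?_⟩
      exact hl.proper.eq_of_col_eq h3 hl.adj_bc (h5.trans hl.col_bc.symm)
    have h3 : HasCol F.graph F.col F.b 4 := by
      obtain ⟨u, hu, h3, h4⟩ := hp.p14.symm.hasCol_left hab.symm
      refine ⟨u, h3, h4.resolve_left fun h5 => hu.1 ?_⟩
      exact hl.proper.eq_of_col_eq h3 hl.adj_bc (h5.trans hl.col_bc.symm)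
    rw [key F.b {1, 2, 4} (by simp [h1, h2, h3]) h.degree_b]
    simp
  · have h1 : HasCol F.graph F.col F.c 1 := ⟨F.b, hl.adj_bc.symm, hcb⟩
    have h2 : HasCol F.graph F.col F.c 3 := by
      obtain ⟨u, hu, h3, h4⟩ := hp.p13.hasCol_left hcd
      refine ⟨u, h3, h4.resolve_left fun h5 => hu ?_⟩
      exact hl.proper.eq_of_col_eq h3 hl.adj_bc.symm (h5.trans hcb.symm)
    have h3 : HasCol F.graph F.col F.c 5 := by
      obtain ⟨u, hu, h3, h4⟩ := hp.p15.symm.hasCol_left hac.symm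
      refine ⟨u, h3, h4.resolve_left fun h5 => hu.1 ?_⟩
      exact hl.proper.eq_of_col_eq h3 hl.adj_bc.symm (h5.trans hcb.symm)
    rw [key F.c {1, 3, 5} (by
      simp only [Finset.forall_mem_insert]
      simp [h1, h2]
      exact h3) h.degree_c]
    simp
  · have h2 := hp.p23.hasCol_of_ne hl.proper (v := F.d) trivial hbd.symm hcd.symm
    rw [key F.d {2, 3} (by simp [h2]) h.degree_d]
    simp
  · simp only [mem_ends, not_or] at hv
    have h1 := hp.p12.hasCol_of_ne hl.proper (v := v) hv.2.2.1 hv.2.1 hv.2.2.2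
    have h2 := hp.p23.hasCol_of_ne hl.proper (v := v) trivial hv.2.1 hv.2.2.1
    have h3 := hp.p45.hasCol_of_ne hl.proper (v := v) ⟨hv.1, hv.2.2.2⟩ hv.2.1 hv.2.2.1
    have h4 : k = 0 ∨ k = 1 ∨ k = 2 ∨ k = 3 ∨ k = 4 := by omega
    rcases h4 with rfl | rfl | rfl | rfl | rfl
    exacts [h3.2, h1.1, h1.2, h2.2, h3.1]

end Fragment

namespace Fragment

variable (F : Fragment)

/-! ### The two copies of a fragment in its divorce -/

/-- The two copies of `F` in the divorce. -/
def side (s : Bool) : F.V → F.DivorceV := bif s then F.right else F.left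

/-- The involution `a ↔ d`, `b ↔ c` of the distinguished vertices. -/
def sw (v : F.V) : F.V :=
  if v = F.a then F.d else if v = F.b then F.c else if v = F.c then F.b
  else if v = F.d then F.a else v

variable {F}

@[simp] lemma sw_a : F.sw F.a = F.d := by simp [sw]
@[simp] lemma sw_b : F.sw F.b = F.c := by
  have := F.distinct
  simp [sw, this.1.symm]
@[simp] lemma sw_c : F.sw F.c = F.b := by
  have := F.distinct
  simp [sw, this.2.1.symm, this.2.2.2.1.symm]
@[simp] lemma sw_d : F.sw F.d = F.a := by
  have := F.distinct
  simp [sw, this.2.2.1.symm, this.2.2.2.2.1.symm, this.2.2.2.2.2.symm]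

lemma sw_of_notMem {v : F.V} (h : v ∉ F.ends) : F.sw v = v := by
  simp only [mem_ends, not_or] at h
  simp [sw, h]

@[simp] lemma sw_sw (v : F.V) : F.sw (F.sw v) = v := by
  by_cases h : v ∈ F.ends
  · rcases mem_ends.1 h with rfl | rfl | rfl | rfl <;> simp
  · rw [sw_of_notMem h, sw_of_notMem h]

@[simp] lemma sw_mem {v : F.V} : F.sw v ∈ F.ends ↔ v ∈ F.ends := by
  by_cases h : v ∈ F.ends
  · rcases mem_ends.1 h with rfl | rfl | rfl | rfl <;> simp [mem_ends]
  · rw [sw_of_notMem h]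

lemma right_of_mem {v : F.V} (h : v ∈ F.ends) : F.right v = Sum.inl (F.sw v) := by
  have hne := F.distinct
  rcases mem_ends.1 h with rfl | rfl | rfl | rfl
  · simp [right]
  · simp [right, hne.1.symm]
  · simp [right, hne.2.1.symm, hne.2.2.2.1.symm]
  · simp [right, hne.2.2.1.symm, hne.2.2.2.2.1.symm, hne.2.2.2.2.2.symm]

lemma right_of_notMem {v : F.V} (h : v ∉ F.ends) : F.right v = Sum.inr ⟨v, h⟩ := by
  have h' := h
  simp only [mem_ends, not_or] at h'
  simp [right, h', h]

lemma right_injective : Function.Injective F.right := by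
  intro u v h
  by_cases hu : u ∈ F.ends <;> by_cases hv : v ∈ F.ends
  · rw [right_of_mem hu, right_of_mem hv] at h
    rw [← sw_sw u, Sum.inl_injective h, sw_sw]
  · rw [right_of_mem hu, right_of_notMem hv] at h
    cases h
  · rw [right_of_notMem hu, right_of_mem hv] at h
    cases h
  · rw [right_of_notMem hu, right_of_notMem hv] at h
    exact congrArg Subtype.val (Sum.inr_injective h)

lemma side_injective (s : Bool) : Function.Injective (F.side s) := by
  cases s
  · exact Sum.inl_injective
  · exact right_injective

@[simp] lemma side_inj {s : Bool} {u v : F.V} : F.side s u = F.side s v ↔ u = v :=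
  (side_injective s).eq_iff

lemma left_eq_right_iff {u v : F.V} : F.left u = F.right v ↔ v ∈ F.ends ∧ u = F.sw v := by
  by_cases hv : v ∈ F.ends
  · rw [right_of_mem hv, left]
    simp [hv]
  · rw [right_of_notMem hv, left]
    simp [hv]

lemma side_eq_side_not_iff {s : Bool} {u v : F.V} :
    F.side s u = F.side (!s) v ↔ u ∈ F.ends ∧ v = F.sw u := by
  cases s
  · change F.left u = F.right v ↔ _
    rw [left_eq_right_iff]
    constructor <;> (rintro ⟨h, rfl⟩; simpa using h)
  · change F.right u = F.left v ↔ _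
    rw [eq_comm, left_eq_right_iff]

lemma side_sw {s : Bool} {u : F.V} (hu : u ∈ F.ends) : F.side (!s) (F.sw u) = F.side s u :=
  (side_eq_side_not_iff.2 ⟨hu, rfl⟩).symm

lemma side_a (s : Bool) : F.side (!s) F.a = F.side s F.d := by
  simpa using side_sw (s := s) (u := F.d) (by simp [mem_ends])
lemma side_b (s : Bool) : F.side (!s) F.b = F.side s F.c := by
  simpa using side_sw (s := s) (u := F.c) (by simp [mem_ends])
lemma side_c (s : Bool) : F.side (!s) F.c = F.side s F.b := by
  simpa using side_sw (s := s) (u := F.b) (by simp [mem_ends])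
lemma side_d (s : Bool) : F.side (!s) F.d = F.side s F.a := by
  simpa using side_sw (s := s) (u := F.a) (by simp [mem_ends])

lemma exists_side (p : F.DivorceV) : ∃ s v, p = F.side s v := by
  rcases p with v | ⟨v, hv⟩
  · exact ⟨false, v, rfl⟩
  · exact ⟨true, v, (right_of_notMem hv).symm⟩

/-- Every vertex of the divorce lies in the copy `s`, or is a vertex of the other copy that is not
distinguished. -/
lemma exists_side' (s : Bool) (p : F.DivorceV) :
    (∃ v, p = F.side s v) ∨ ∃ v ∉ F.ends, p = F.side (!s) v := by
  obtain ⟨t, v, rfl⟩ := exists_side p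
  by_cases hts : t = s
  · exact Or.inl ⟨v, by rw [hts]⟩
  · have hts : t = !s := by cases s <;> cases t <;> simp_all
    subst hts
    by_cases hv : v ∈ F.ends
    · exact Or.inl ⟨F.sw v, by rw [← side_sw (s := !s) hv, Bool.not_not]⟩
    · exact Or.inr ⟨v, hv, rfl⟩

lemma divorce_adj {p q : F.DivorceV} :
    F.divorce.Adj p q ↔ ∃ s u v, F.graph.Adj u v ∧ F.side s u = p ∧ F.side s v = q := by
  rw [divorce, sup_adj]
  constructor
  · rintro (h | h)
    · obtain ⟨-, u, v, h⟩ := (map_adj' _ _ _ _).1 h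
      exact ⟨false, u, v, h⟩
    · obtain ⟨-, u, v, h⟩ := (map_adj' _ _ _ _).1 h
      exact ⟨true, u, v, h⟩
  · rintro ⟨s | s, u, v, h, rfl, rfl⟩
    · exact Or.inl ((map_adj' _ _ _ _).2 ⟨(side_injective false).ne h.ne, u, v, h, rfl, rfl⟩)
    · exact Or.inr ((map_adj' _ _ _ _).2 ⟨(side_injective true).ne h.ne, u, v, h, rfl, rfl⟩)

lemma side_adj_of_adj {s : Bool} {u v : F.V} (h : F.graph.Adj u v) :
    F.divorce.Adj (F.side s u) (F.side s v) := divorce_adj.2 ⟨s, u, v, h, rfl, rfl⟩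

/-! ### The exchange of the two copies -/

/-- The map exchanging the two copies. -/
def exch : F.DivorceV → F.DivorceV := Sum.elim F.right fun v => F.left v.1

lemma exch_side (s : Bool) (v : F.V) : F.exch (F.side s v) = F.side (!s) v := by
  cases s
  · rfl
  · change F.exch (F.right v) = F.left v
    by_cases hv : v ∈ F.ends
    · rw [right_of_mem hv]
      change F.right _ = _
      rw [right_of_mem (sw_mem.2 hv), sw_sw, left]
    · rw [right_of_notMem hv]
      rfl

lemma exch_exch (p : F.DivorceV) : F.exch (F.exch p) = p := by
  obtain ⟨s, v, rfl⟩ := exists_side p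
  rw [exch_side, exch_side, Bool.not_not]

/-- The automorphism exchanging the two copies. -/
def exchIso (F : Fragment) : F.divorce ≃g F.divorce where
  toFun := F.exch
  invFun := F.exch
  left_inv := exch_exch
  right_inv := exch_exch
  map_rel_iff' := by
    have : ∀ p q, F.divorce.Adj p q → F.divorce.Adj (F.exch p) (F.exch q) := by
      intro p q h
      obtain ⟨s, u, v, huv, rfl, rfl⟩ := divorce_adj.1 h
      rw [exch_side, exch_side]
      exact side_adj_of_adj huv
    intro p q
    refine ⟨fun h => ?_, this p q⟩
    have := this _ _ h
    simpa [exch_exch] using this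

@[simp] lemma exchIso_side (s : Bool) (v : F.V) : F.exchIso (F.side s v) = F.side (!s) v :=
  exch_side s v

/-! ### The colouring of the divorce -/

/-- The permutation of the colours in the copy `s`. -/
def colSide (s : Bool) : Equiv.Perm (Fin 5) := bif s then colPerm else 1

@[simp] lemma colPerm_colPerm (k : Fin 5) : colPerm (colPerm k) = k := by
  revert k
  decide

@[simp] lemma colSide_colSide (s : Bool) (k : Fin 5) : colSide s (colSide s k) = k := by
  cases s
  · rfl
  · exact colPerm_colPerm k

lemma colSide_not (s : Bool) (k : Fin 5) : colSide (!s) k = colSide s (colPerm k) := by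
  cases s
  · rfl
  · exact (colPerm_colPerm k).symm

open Classical in
/-- The colouring of the divorce. -/
noncomputable def divCol (F : Fragment) (e : Sym2 F.DivorceV) : Fin 5 :=
  if h : ∃ e' ∈ F.graph.edgeSet, e'.map F.left = e then F.col h.choose
  else if h : ∃ e' ∈ F.graph.edgeSet, e'.map F.right = e then colPerm (F.col h.choose)
  else 0

/-- The colouring is well defined because an edge lying in both copies joins distinguished vertices,
hence is `bc`, whose colour 1 is fixed by `colPerm`. -/
lemma Local.divCol_side (h : F.Local) {s : Bool} {u v : F.V} (huv : F.graph.Adj u v) :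
    F.divCol s(F.side s u, F.side s v) = colSide s (F.col s(u, v)) := by
  cases s
  · have h' : ∃ e' ∈ F.graph.edgeSet, e'.map F.left = s(F.left u, F.left v) :=
      ⟨s(u, v), huv, rfl⟩
    change F.divCol s(F.left u, F.left v) = F.col s(u, v)
    rw [divCol, dif_pos h']
    congr 1
    exact Sym2.map.injective (side_injective false)
      (h'.choose_spec.2.trans (Sym2.map_mk _ _ _).symm)
  · change F.divCol s(F.right u, F.right v) = colPerm (F.col s(u, v))
    rw [divCol]
    split_ifs with h1 h2
    · obtain ⟨h3, h4⟩ := h1.choose_spec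
      revert h3 h4
      generalize h1.choose = e
      induction e with | _ u' v'
      intro h3 h4
      have h5 : F.divorce.Adj (F.side true u) (F.side true v) := side_adj_of_adj huv
      rw [Sym2.map_mk] at h4
      have key : ∀ u' v', F.graph.Adj u' v' → F.left u' = F.right u → F.left v' = F.right v →
          F.col s(u', v') = colPerm (F.col s(u, v)) := by
        intro u' v' h3 hu hv
        obtain ⟨hu1, rfl⟩ := left_eq_right_iff.1 hu
        obtain ⟨hv1, rfl⟩ := left_eq_right_iff.1 hv
        rw [h.adj_ends _ hu1 _ hv1 huv, h.adj_ends _ (sw_mem.2 hu1) _ (sw_mem.2 hv1) h3, h.col_bc]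
        decide
      rcases Sym2.eq_iff.1 h4 with ⟨hu, hv⟩ | ⟨hu, hv⟩
      · exact key _ _ h3 hu hv
      · rw [Sym2.eq_swap]
        exact key _ _ h3.symm hv hu
    · congr 2
      exact Sym2.map.injective (side_injective true)
        (h2.choose_spec.2.trans (Sym2.map_mk _ _ _).symm)
    · exact absurd ⟨s(u, v), huv, rfl⟩ h2

lemma Local.hasCol_side (h : F.Local) {s : Bool} {v : F.V} {k : Fin 5}
    (hk : HasCol F.graph F.col v k) : HasCol F.divorce F.divCol (F.side s v) (colSide s k) := by
  obtain ⟨w, hw, rfl⟩ := hk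
  exact ⟨F.side s w, side_adj_of_adj hw, h.divCol_side hw⟩

/-- Every colour occurs at every vertex of the divorce. -/
lemma IsSuitable.hasCol_divorce (h : F.IsSuitable) (p : F.DivorceV) (k : Fin 5) :
    HasCol F.divorce F.divCol p k := by
  obtain ⟨h1, h2, h3, h4, h5⟩ := h.hasCol
  have h0 : ∀ k : Fin 5, k = 1 ∨ k = 2 ∨ k = 3 ∨ k = 4 ∨ k = 5 := by decide
  have key : ∀ s v, (HasCol F.graph F.col v (colSide s k)) →
      HasCol F.divorce F.divCol (F.side s v) k := fun s v hv => by
    simpa using h.local.hasCol_side (s := s) hv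
  obtain ⟨s, v, rfl⟩ := exists_side p
  by_cases hv : v ∈ F.ends
  -- The colour sets of two identified vertices cover all five colours: {1,2,3} with π{2,3} at a =
  -- d', and {1,2,4} with π{1,3,5} at b = c'.
  · have h6 : ∀ k : Fin 5, (k = 1 ∨ k = 2 ∨ k = 3) ∨ (colPerm k = 2 ∨ colPerm k = 3) := by decide
    have h7 : ∀ k : Fin 5, (k = 1 ∨ k = 2 ∨ k = 4) ∨
      (colPerm k = 1 ∨ colPerm k = 3 ∨ colPerm k = 5) := by decide
    have h8 : ∀ k : Fin 5, (k = 2 ∨ k = 3) ∨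
      (colPerm k = 1 ∨ colPerm k = 2 ∨ colPerm k = 3) := by decide
    have h9 : ∀ k : Fin 5, (k = 1 ∨ k = 3 ∨ k = 5) ∨
      (colPerm k = 1 ∨ colPerm k = 2 ∨ colPerm k = 4) := by decide
    have h10 : colPerm (colSide s k) = colSide (!s) k := by
      cases s
      · rfl
      · exact colPerm_colPerm k
    rcases mem_ends.1 hv with rfl | rfl | rfl | rfl
    · rcases h6 (colSide s k) with h | h
      · exact key s F.a ((h1 _).2 h)
      · rw [← side_d]
        exact key (!s) F.d (by rwa [h4, ← h10])
    · rcases h7 (colSide s k) with h | h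
      · exact key s F.b ((h2 _).2 h)
      · rw [← side_c]
        exact key (!s) F.c (by rwa [h3, ← h10])
    · rcases h9 (colSide s k) with h | h
      · exact key s F.c ((h3 _).2 h)
      · rw [← side_b]
        exact key (!s) F.b (by rwa [h2, ← h10])
    · rcases h8 (colSide s k) with h | h
      · exact key s F.d ((h4 _).2 h)
      · rw [← side_a]
        exact key (!s) F.a (by rwa [h1, ← h10])
  · exact key s v (h5 v hv _)

/-- Two edges from different copies can only meet at an identified vertex. There the colour sets of
the copies are disjoint, except for colour 1 at b = c' and c = b', where both edges are the common
edge `bc`. -/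
lemma IsSuitable.proper_divorce (h : F.IsSuitable) :
    IsProperEdgeColouring F.divorce F.divCol := by
  intro p q₁ q₂ h₁ h₂ hne heq
  obtain ⟨s, u, v, huv, rfl, rfl⟩ := divorce_adj.1 h₁
  obtain ⟨t, u', w, huw, hu, rfl⟩ := divorce_adj.1 h₂
  rw [h.local.divCol_side huv, ← hu, h.local.divCol_side huw] at heq
  by_cases hts : t = s
  · subst hts
    obtain rfl := side_inj.1 hu
    exact hne (congrArg _ (h.proper.eq_of_col_eq huv huw ((colSide t).injective heq)))
  · have hts : t = !s := by cases s <;> cases t <;> simp_all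
    subst hts
    obtain ⟨hu1, rfl⟩ := side_eq_side_not_iff.1 hu.symm
    rw [colSide_not] at heq
    have heq := (colSide s).injective heq
    obtain ⟨h1, h2, h3, h4, -⟩ := h.hasCol
    have hc1 : HasCol F.graph F.col u (F.col s(u, v)) := ⟨v, huv, rfl⟩
    have hc2 : HasCol F.graph F.col (F.sw u) (F.col s(F.sw u, w)) := ⟨w, huw, rfl⟩
    have hcb : F.col s(F.c, F.b) = 1 := by rw [Sym2.eq_swap]; exact h.local.col_bc
    have h5 : ∀ k l : Fin 5, k = colPerm l → (k = 1 ∨ k = 2 ∨ k = 3) → (l = 2 ∨ l = 3) →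
      False := by decide
    have h6 : ∀ k l : Fin 5, k = colPerm l → (k = 2 ∨ k = 3) → (l = 1 ∨ l = 2 ∨ l = 3) →
      False := by decide
    have h7 : ∀ k l : Fin 5, k = colPerm l → (k = 1 ∨ k = 2 ∨ k = 4) →
      (l = 1 ∨ l = 3 ∨ l = 5) → k = 1 ∧ l = 1 := by decide
    have h8 : ∀ k l : Fin 5, k = colPerm l → (k = 1 ∨ k = 3 ∨ k = 5) →
      (l = 1 ∨ l = 2 ∨ l = 4) → k = 1 ∧ l = 1 := by decide
    rcases mem_ends.1 hu1 with rfl | rfl | rfl | rfl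
    · rw [sw_a] at hc2 heq
      exact h5 _ _ heq ((h1 _).1 hc1) ((h4 _).1 hc2)
    · rw [sw_b] at hc2 heq huw
      obtain ⟨h9, h10⟩ := h7 _ _ heq ((h2 _).1 hc1) ((h3 _).1 hc2)
      rw [h.proper.eq_of_col_eq huv h.local.adj_bc (h9.trans h.local.col_bc.symm),
        h.proper.eq_of_col_eq huw h.local.adj_bc.symm (h10.trans hcb.symm), side_b] at hne
      exact hne rfl
    · rw [sw_c] at hc2 heq huw
      obtain ⟨h9, h10⟩ := h8 _ _ heq ((h3 _).1 hc1) ((h2 _).1 hc2)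
      rw [h.proper.eq_of_col_eq huv h.local.adj_bc.symm (h9.trans hcb.symm),
        h.proper.eq_of_col_eq huw h.local.adj_bc (h10.trans h.local.col_bc.symm), side_c] at hne
      exact hne rfl
    · rw [sw_d] at hc2 heq
      exact h6 _ _ heq ((h4 _).1 hc1) ((h1 _).1 hc2)

end Fragment

namespace Fragment

variable {F : Fragment}

/-! ### The hamiltonian cycles of the divorce -/

/-- The subgraph of the divorce formed by two colours. -/
noncomputable abbrev divBi (F : Fragment) (i j : Fin 5) : SimpleGraph F.DivorceV :=
  biGraph F.divorce F.divCol i j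

lemma bi_swap {i j : Fin 5} {x y : F.V} {S : Set F.V} (h : Spans (F.bi i j) x y S) :
    Spans (F.bi j i) x y S := by
  rwa [bi, biGraph_comm]

lemma Local.divBi_adj (h : F.Local) (s : Bool) {i j : Fin 5} {u v : F.V}
    (huv : (F.bi i j).Adj u v) :
    (F.divBi (colSide s i) (colSide s j)).Adj (F.side s u) (F.side s v) := by
  refine ⟨side_adj_of_adj huv.1, ?_⟩
  rw [h.divCol_side huv.1]
  exact huv.2.imp (congrArg _) (congrArg _)

lemma Local.arc_side (h : F.Local) (s : Bool) {i j : Fin 5} {x y : F.V} {S : Set F.V}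
    (hA : Arc (F.bi i j) x y S) :
    Arc (F.divBi (colSide s i) (colSide s j)) (F.side s x) (F.side s y) (F.side s '' S) := by
  obtain ⟨u, hu, huy⟩ := hA
  exact ⟨F.side s u, hu.map _ (fun _ _ _ _ huv => h.divBi_adj s huv)
    (side_injective s).injOn, h.divBi_adj s huy⟩

lemma Local.arc_side_not (h : F.Local) (s : Bool) {i j : Fin 5} {x y : F.V} {S : Set F.V}
    (hA : Arc (F.bi (colPerm i) (colPerm j)) x y S) :
    Arc (F.divBi (colSide s i) (colSide s j)) (F.side (!s) x) (F.side (!s) y)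
      (F.side (!s) '' S) := by
  have := h.arc_side (!s) hA
  rwa [colSide_not, colSide_not, colPerm_colPerm, colPerm_colPerm] at this

lemma disjoint_side {s : Bool} {S T : Set F.V} (h : ∀ u ∈ F.ends, u ∈ S → F.sw u ∉ T) :
    Disjoint (F.side s '' S) (F.side (!s) '' T) := by
  rw [Set.disjoint_left]
  rintro _ ⟨u, hu, rfl⟩ ⟨v, hv, hvu⟩
  obtain ⟨h1, rfl⟩ := side_eq_side_not_iff.1 hvu.symm
  exact h u h1 hu hv

lemma cover_side (s : Bool) {S T : Set F.V} (h1 : ∀ v ∉ F.ends, v ∈ S ∧ v ∈ T)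
    (h2 : ∀ v ∈ F.ends, v ∈ S ∨ F.sw v ∈ T) (p : F.DivorceV) :
    p ∈ F.side s '' S ∪ F.side (!s) '' T := by
  rcases exists_side' s p with ⟨v, rfl⟩ | ⟨v, hv, rfl⟩
  · by_cases hv : v ∈ F.ends
    · rcases h2 v hv with h | h
      · exact Or.inl ⟨v, h, rfl⟩
      · exact Or.inr ⟨_, h, side_sw hv⟩
    · exact Or.inl ⟨v, (h1 v hv).1, rfl⟩
  · exact Or.inr ⟨v, (h1 v hv).2, rfl⟩

lemma exists_ne_ne (p q : F.DivorceV) : ∃ z, z ≠ p ∧ z ≠ q := by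
  by_contra! h
  have hne := F.distinct
  have key : ∀ u v : F.V, F.side false u = p → F.side false v = p → u = v :=
    fun u v hu hv => side_injective _ (hu.trans hv.symm)
  have key' : ∀ u v : F.V, F.side false u = q → F.side false v = q → u = v :=
    fun u v hu hv => side_injective _ (hu.trans hv.symm)
  have ha := h (F.side false F.a)
  have hb := h (F.side false F.b)
  have hc := h (F.side false F.c)
  by_cases h1 : F.side false F.a = p
  · have h2 := hb fun h => hne.1 (key _ _ h1 h)
    have h3 := hc fun h => hne.2.1 (key _ _ h1 h)
    exact hne.2.2.2.1 (key' _ _ h2 h3)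
  · have h1 := ha h1
    by_cases h2 : F.side false F.b = p
    · have h3 := hc fun h => hne.2.2.2.1 (key _ _ h2 h)
      exact hne.2.1 (key' _ _ h1 h3)
    · exact hne.1 (key' _ _ h1 (hb h2))

/-- A path of each copy, together a hamiltonian cycle. -/
lemma Local.isHamiltonian_of_arcs (h : F.Local) (s : Bool) {i j : Fin 5} {x y : F.V}
    {S T : Set F.V} (hx : x ∈ F.ends) (hy : y ∈ F.ends) (hS : Arc (F.bi i j) x y S)
    (hT : Arc (F.bi (colPerm i) (colPerm j)) (F.sw y) (F.sw x) T)
    (hd : ∀ u ∈ F.ends, u ∈ S → F.sw u ∉ T) (h1 : ∀ v ∉ F.ends, v ∈ S ∧ v ∈ T)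
    (h2 : ∀ v ∈ F.ends, v ∈ S ∨ F.sw v ∈ T) :
    (F.divBi (colSide s i) (colSide s j)).IsHamiltonian := by
  have hT' := h.arc_side_not s hT
  rw [side_sw hx, side_sw hy] at hT'
  exact ((h.arc_side s hS).append hT' (disjoint_side hd)).isHamiltonian (cover_side s h1 h2)
    (fun _ => exists_ne_ne _ _)

lemma forall_ends {p : F.V → Prop} :
    (∀ v ∈ F.ends, p v) ↔ p F.a ∧ p F.b ∧ p F.c ∧ p F.d := by
  simp [ends]

/-- The cycle is c, b…d in the copy `s`, followed by a'…b' in colours 1, 4, where a' = d and b' = c.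
-/
lemma IsSuitable.isHamiltonian12 (h : F.IsSuitable) (s : Bool) :
    (F.divBi (colSide s 1) (colSide s 2)).IsHamiltonian := by
  have hp := h.paths
  have hl := h.local
  have hne := F.distinct
  have hcb : (F.bi 1 2).Adj F.c F.b :=
    ⟨hl.adj_bc.symm, Or.inl (by rw [Sym2.eq_swap]; exact hl.col_bc)⟩
  refine hl.isHamiltonian_of_arcs s (x := F.c) (y := F.d) (by simp [ends]) (by simp [ends])
    ((Arc.of_adj hcb).append (Arc.of_spans hp.p12 hne.2.2.2.2.1) (by simp))
    (by rw [sw_c, sw_d]; exact Arc.of_spans hp.p14 hne.1) ?_ ?_ ?_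
  · simp [forall_ends, hne, Ne.symm]
  · simp [mem_ends, not_or]; tauto
  · simp [forall_ends, hne, Ne.symm]

/-- The cycle is b, c…d in the copy `s`, followed by a'…c' in colours 1, 5, where a' = d and c' = b.
-/
lemma IsSuitable.isHamiltonian13 (h : F.IsSuitable) (s : Bool) :
    (F.divBi (colSide s 1) (colSide s 3)).IsHamiltonian := by
  have hp := h.paths
  have hl := h.local
  have hne := F.distinct
  have hbc : (F.bi 1 3).Adj F.b F.c := ⟨hl.adj_bc, Or.inl hl.col_bc⟩
  refine hl.isHamiltonian_of_arcs s (x := F.b) (y := F.d) (by simp [ends]) (by simp [ends])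
    ((Arc.of_adj hbc).append (Arc.of_spans hp.p13 hne.2.2.2.2.2) (by simp))
    (by rw [sw_b, sw_d]; exact Arc.of_spans hp.p15 hne.2.1) ?_ ?_ ?_
  · simp [forall_ends, hne, hne.2.2.2.2.1.symm]
  · simp [mem_ends, not_or]; tauto
  · simp [forall_ends, hne, Ne.symm]

/-- The path b…c covers one copy entirely; the path b'…c' in colours 4, 5 returns through the other,
avoiding a' and d', which the first path has covered. -/
lemma IsSuitable.isHamiltonian23 (h : F.IsSuitable) (s : Bool) :
    (F.divBi (colSide s 2) (colSide s 3)).IsHamiltonian := by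
  have hp := h.paths
  have hl := h.local
  have hne := F.distinct
  refine hl.isHamiltonian_of_arcs s (x := F.b) (y := F.c) (by simp [ends]) (by simp [ends])
    (Arc.of_spans hp.p23 hne.2.2.2.1)
    (by rw [sw_b, sw_c]; exact Arc.of_spans hp.p45 hne.2.2.2.1) ?_ ?_ ?_
  · simp [forall_ends]
  · simp [mem_ends, not_or]; tauto
  · simp [forall_ends, hne, Ne.symm]

/-- This pair of colours is invariant under π, so the same path is used twice. The vertex c omitted
in one copy is b', which the other path covers. -/
lemma IsSuitable.isHamiltonian24 (h : F.IsSuitable) (s : Bool) :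
    (F.divBi (colSide s 2) (colSide s 4)).IsHamiltonian := by
  have hp := h.paths
  have hl := h.local
  have hne := F.distinct
  refine hl.isHamiltonian_of_arcs s (x := F.a) (y := F.d) (by simp [ends]) (by simp [ends])
    (Arc.of_spans hp.p24 hne.2.2.1)
    (by rw [sw_a, sw_d]; exact Arc.of_spans (bi_swap hp.p24) hne.2.2.1) ?_ ?_ ?_
  · simp [forall_ends]
  · simp [mem_ends, not_or]
  · simp [forall_ends, hne, Ne.symm]

lemma IsSuitable.isHamiltonian35 (h : F.IsSuitable) (s : Bool) :
    (F.divBi (colSide s 3) (colSide s 5)).IsHamiltonian := by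
  have hp := h.paths
  have hl := h.local
  have hne := F.distinct
  refine hl.isHamiltonian_of_arcs s (x := F.a) (y := F.d) (by simp [ends]) (by simp [ends])
    (Arc.of_spans hp.p35 hne.2.2.1)
    (by rw [sw_a, sw_d]; exact Arc.of_spans (bi_swap hp.p35) hne.2.2.1) ?_ ?_ ?_
  · simp [forall_ends]
  · simp [mem_ends, not_or]; tauto
  · simp [forall_ends, hne, Ne.symm]

/-- The four paths alternate between the copies: a…d, then a'…b' = d…c, then c…b, then c'…d' = b…a.
The middle two partners come from reversing `bc` and from the colours (π 2, π 5) = (4, 3). -/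
lemma IsSuitable.isHamiltonian25 (h : F.IsSuitable) (s : Bool) :
    (F.divBi (colSide s 2) (colSide s 5)).IsHamiltonian := by
  have hl := h.local
  have hne := F.distinct
  obtain ⟨S, h1, h2⟩ := h.paths.p25
  obtain ⟨T, h3, h4⟩ := h.paths.p34
  have a1 := hl.arc_side s (Arc.of_spans h1 hne.2.2.1)
  have a2 := hl.arc_side s (Arc.of_spans h2.symm hne.2.2.2.1.symm)
  have b1 := hl.arc_side_not s (i := 2) (j := 5)
    (Arc.of_spans (bi_swap h3) hne.1)
  have b2 := hl.arc_side_not s (i := 2) (j := 5)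
    (Arc.of_spans (bi_swap h4) hne.2.2.2.2.2)
  rw [side_a, side_b] at b1
  rw [side_c, side_d] at b2
  have haS := h1.left_mem
  have hdS := h1.right_mem
  have hbS := h2.left_mem
  have hcS := h2.right_mem
  have haT := h3.left_mem
  have hbT := h3.right_mem
  have hcT := h4.left_mem
  have hdT := h4.right_mem
  simp only [Set.mem_compl_iff] at hbS hcS hcT hdT
  have d1 : Disjoint (F.side s '' (S \ {F.d})) (F.side (!s) '' (T \ {F.b})) :=
    disjoint_side (by simp [forall_ends, *])
  have d2 : Disjoint (F.side s '' (Sᶜ \ {F.b})) (F.side (!s) '' (Tᶜ \ {F.d})) :=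
    disjoint_side (by simp [forall_ends, *])
  have d3 : Disjoint (F.side s '' (S \ {F.d})) (F.side (!s) '' (Tᶜ \ {F.d})) :=
    disjoint_side (by simp [forall_ends, *])
  have d4 : Disjoint (F.side s '' (Sᶜ \ {F.b})) (F.side (!s) '' (T \ {F.b})) :=
    disjoint_side (by simp [forall_ends, *])
  have d5 : Disjoint (F.side s '' (S \ {F.d})) (F.side s '' (Sᶜ \ {F.b})) := by
    rw [Set.disjoint_image_iff (side_injective s), Set.disjoint_left]
    exact fun v hv hv' => hv'.1 hv.1
  have d6 : Disjoint (F.side (!s) '' (T \ {F.b})) (F.side (!s) '' (Tᶜ \ {F.d})) := by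
    rw [Set.disjoint_image_iff (side_injective _), Set.disjoint_left]
    exact fun v hv hv' => hv'.1 hv.1
  refine (((a1.append b1 d1).append a2 ?_).append b2 ?_).isHamiltonian (fun p => ?_)
    (fun _ => exists_ne_ne _ _)
  · rw [Set.disjoint_union_left]
    exact ⟨d5, d4.symm⟩
  · rw [Set.disjoint_union_left, Set.disjoint_union_left]
    exact ⟨⟨d3, d6⟩, d2⟩
  · have := cover_side (F := F) s (S := (S \ {F.d}) ∪ (Sᶜ \ {F.b}))
      (T := (T \ {F.b}) ∪ (Tᶜ \ {F.d})) (fun v hv => by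
        simp only [mem_ends, not_or] at hv
        simp [hv]
        tauto) (by simp [forall_ends, *, hne.2.2.2.1.symm]) p
    rw [Set.image_union, Set.image_union] at this
    simp only [Set.mem_union] at this ⊢
    tauto

lemma IsSuitable.isHamiltonian_divBi (h : F.IsSuitable) {i j : Fin 5} (hij : i ≠ j) :
    (F.divBi i j).IsHamiltonian := by
  have key : ∀ {i j}, (F.divBi i j).IsHamiltonian → (F.divBi j i).IsHamiltonian :=
    fun h => by rwa [divBi, biGraph_comm]
  -- Reading the cycles from the second copy turns the colours 12, 13, 25, 23 into 14, 15, 43, 45.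
  -- The colour 5 is 0 in `Fin 5`.
  have h12 := h.isHamiltonian12 false
  have h13 := h.isHamiltonian13 false
  have h14 := h.isHamiltonian12 true
  have h15 := h.isHamiltonian13 true
  have h23 := h.isHamiltonian23 false
  have h24 := h.isHamiltonian24 false
  have h25 := h.isHamiltonian25 false
  have h34 := h.isHamiltonian25 true
  have h35 := h.isHamiltonian35 false
  have h45 := h.isHamiltonian23 true
  change (F.divBi 1 2).IsHamiltonian at h12
  change (F.divBi 1 3).IsHamiltonian at h13
  change (F.divBi 1 4).IsHamiltonian at h14
  change (F.divBi 1 0).IsHamiltonian at h15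
  change (F.divBi 2 3).IsHamiltonian at h23
  change (F.divBi 2 4).IsHamiltonian at h24
  change (F.divBi 2 0).IsHamiltonian at h25
  change (F.divBi 4 3).IsHamiltonian at h34
  change (F.divBi 3 0).IsHamiltonian at h35
  change (F.divBi 4 0).IsHamiltonian at h45
  fin_cases i <;> fin_cases j <;>
    first | exact absurd rfl hij | assumption | (apply key; assumption)

/-! ### The perfect 1-factorisation -/

/-- A hamiltonian cycle of the two-coloured graph uses all its edges: a proper colouring allows at
most two edges of these colours at a vertex, and the cycle already has two. -/
lemma IsSuitable.isPerfectPair (h : F.IsSuitable) {i j : Fin 5} (hij : i ≠ j) :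
    IsPerfectPair F.divorce (colourClass F.divorce F.divCol i)
      (colourClass F.divorce F.divCol j) := by
  classical
  have hcard : Fintype.card F.DivorceV ≠ 1 := fun h1 => by
    obtain ⟨z, hz, -⟩ := exists_ne_ne (F.side false F.a) (F.side false F.a)
    have := Fintype.card_le_one_iff_subsingleton.1 h1.le
    exact hz (Subsingleton.elim _ _)
  obtain ⟨u, p, hp⟩ := h.isHamiltonian_divBi hij hcard
  refine ⟨u, p.mapLe biGraph_le, hp.map (f := Hom.ofLE biGraph_le) Function.bijective_id, ?_⟩
  have hsub : ∀ v w, (F.divBi i j).Adj v w → s(v, w) ∈ p.edges := by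
    intro v w hvw
    have h1 := hp.isCycle.ncard_neighborSet_toSubgraph_eq_two (hp.mem_support v)
    have h2 : p.toSubgraph.neighborSet v ⊆ (F.divBi i j).neighborSet v :=
      p.toSubgraph.neighborSet_subset v
    have h3 : ((F.divBi i j).neighborSet v).ncard ≤ 2 := by
      refine (Set.ncard_le_ncard_of_injOn (fun w => F.divCol s(v, w)) (t := {i, j})
        (fun w hw => hw.2) (fun w hw w' hw' heq =>
          h.proper_divorce.eq_of_col_eq hw.1 hw'.1 heq)).trans (Set.ncard_pair hij).le
    have h4 := Set.eq_of_subset_of_ncard_le h2 (by omega)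
    have h5 : w ∈ p.toSubgraph.neighborSet v := h4 ▸ hvw
    exact (Walk.mem_edges_toSubgraph p).1 h5
  ext e
  induction e with | _ v w
  have h1 : s(v, w) ∈ (p.mapLe biGraph_le).edgeSet ↔ s(v, w) ∈ p.edges := by
    rw [Walk.mem_edgeSet, Walk.edges_mapLe_eq_edges]
  rw [h1]
  constructor
  · intro he
    have := (mem_edgeSet_biGraph.1 (p.edges_subset_edgeSet he))
    exact this.2.imp (fun h => ⟨this.1, h⟩) (fun h => ⟨this.1, h⟩)
  · rintro (⟨h2, h3⟩ | ⟨h2, h3⟩)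
    · exact hsub v w ⟨h2, Or.inl h3⟩
    · exact hsub v w ⟨h2, Or.inr h3⟩

lemma IsSuitable.isPerfectOneFactorisation (h : F.IsSuitable) :
    IsPerfectOneFactorisation F.divorce (colourClass F.divorce F.divCol) where
  isPerfectMatching i := by
    rw [Subgraph.isPerfectMatching_iff]
    intro p
    obtain ⟨q, hq, hq'⟩ := h.hasCol_divorce p i
    exact ⟨q, ⟨hq, hq'⟩, fun r hr => h.proper_divorce.eq_of_col_eq hr.1 hq (hr.2.trans hq'.symm)⟩
  existsUnique_mem e he := by
    induction e with | _ u v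
    exact ⟨F.divCol s(u, v), ⟨he, rfl⟩, fun i hi => hi.2.symm⟩
  isPerfectPair _ _ hij := h.isPerfectPair hij

lemma IsSuitable.isQuintic (h : F.IsSuitable) : IsQuintic F.divorce := by
  classical
  intro p
  rw [← card_neighborSet_eq_degree, ← Nat.card_eq_fintype_card]
  have : Function.Bijective fun q : F.divorce.neighborSet p => F.divCol s(p, q.1) := by
    constructor
    · intro q r hqr
      exact Subtype.ext (h.proper_divorce.eq_of_col_eq q.2 r.2 hqr)
    · intro k
      obtain ⟨q, hq, hq'⟩ := h.hasCol_divorce p k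
      exact ⟨⟨q, hq⟩, hq'⟩
  rw [Nat.card_congr (Equiv.ofBijective _ this)]
  simp

lemma IsSuitable.connected_divorce (h : F.IsSuitable) : F.divorce.Connected :=
  (IsHamiltonian.connected (h.isHamiltonian_divBi (i := 1) (j := 2) (by decide))).mono biGraph_le

end Fragment

/-! ### Edge-cuts of the divorce -/

lemma mem_edgeCut {V : Type*} {G : SimpleGraph V} {X : Set V} {u v : V} :
    s(u, v) ∈ edgeCut G X ↔ G.Adj u v ∧ (u ∈ X ↔ v ∉ X) := by
  constructor
  · rintro ⟨h, x, hx, y, hy, hxy⟩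
    refine ⟨h, ?_⟩
    rcases Sym2.eq_iff.1 hxy with ⟨rfl, rfl⟩ | ⟨rfl, rfl⟩ <;> tauto
  · rintro ⟨h, huv⟩
    refine ⟨h, ?_⟩
    by_cases hu : u ∈ X
    · exact ⟨u, hu, v, huv.1 hu, rfl⟩
    · exact ⟨v, by tauto, u, hu, Sym2.eq_swap⟩

lemma edgeCut_compl {V : Type*} (G : SimpleGraph V) (X : Set V) :
    edgeCut G Xᶜ = edgeCut G X := by
  ext e
  induction e with | _ u v
  rw [mem_edgeCut, mem_edgeCut]
  simp only [Set.mem_compl_iff]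
  tauto

lemma exists_adj_of_connected {V : Type*} {K : SimpleGraph V} (hK : K.Connected) {X : Set V}
    {u v : V} (hu : u ∈ X) (hv : v ∉ X) : ∃ p q, K.Adj p q ∧ p ∈ X ∧ q ∉ X := by
  obtain ⟨w⟩ := hK.preconnected u v
  obtain ⟨d, -, h1, h2⟩ := w.exists_boundary_dart X hu hv
  exact ⟨_, _, d.adj, h1, h2⟩

lemma Spans.exists_cross {V : Type*} {H : SimpleGraph V} {x y : V} {S X : Set V}
    (h : Spans H x y S) (hxy : ¬ (x ∈ X ↔ y ∈ X)) :
    ∃ u ∈ S, ∃ v ∈ S, H.Adj u v ∧ (u ∈ X ↔ v ∉ X) := by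
  induction h with
  | single => exact absurd Iff.rfl hxy
  | @cons x x' y S hxx' hx h ih =>
    by_cases h1 : x ∈ X ↔ x' ∈ X
    · obtain ⟨u, hu, v, hv, h2⟩ := ih (fun h => hxy (h1.trans h))
      exact ⟨u, by simp [hu], v, by simp [hv], h2⟩
    · exact ⟨x, by simp, x', by simp [h.left_mem], hxx', by tauto⟩

namespace Fragment

variable {F : Fragment}

/-- Each colour class has exactly one edge in an edge-cut of size `5`. -/
lemma IsSuitable.eq_of_mem_cut (h : F.IsSuitable) {X : Set F.DivorceV}
    (hX : (edgeCut F.divorce X).ncard = 5) {e e' : Sym2 F.DivorceV}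
    (he : e ∈ edgeCut F.divorce X) (he' : e' ∈ edgeCut F.divorce X)
    (hcol : F.divCol e = F.divCol e') : e = e' := by
  classical
  obtain ⟨-, u, hu, v, hv, -⟩ := id he
  set M := edgeCut F.divorce X with hM
  set N : Finset (Sym2 F.DivorceV) := M.toFinite.toFinset with hN
  have hmem : ∀ e, e ∈ N ↔ e ∈ M := fun e => by simp [hN]
  have hcard : N.card = 5 := by rw [← hX, Set.ncard_eq_toFinset_card _ M.toFinite]
  let m : Fin 5 → ℕ := fun k => {e ∈ N | F.divCol e = k}.card
  have hsum : ∑ k, m k = 5 := by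
    exact (Finset.card_eq_sum_card_fiberwise
      (fun e _ => Finset.mem_coe.2 (Finset.mem_univ _))).symm.trans hcard
  -- The hamiltonian two-coloured graph is connected and bridgeless, so after deleting one crossing
  -- edge there is another.
  have two : ∀ i j, i ≠ j → 2 ≤ m i + m j := by
    intro i j hij
    have hH := h.isHamiltonian_divBi hij
    obtain ⟨p, q, hpq, hp, hq⟩ := exists_adj_of_connected hH.connected hu hv
    have hbr : ¬ (F.divBi i j).IsBridge s(p, q) := fun hb => hb.not_isHamiltonian hH
    have hconn : ((F.divBi i j).deleteEdges {s(p, q)}).Connected :=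
      hH.connected.connected_delete_edge_of_not_isBridge hbr
    obtain ⟨p', q', hpq', hp', hq'⟩ := exists_adj_of_connected hconn hu hv
    rw [deleteEdges_adj] at hpq'
    have h1 : ({s(p, q), s(p', q')} : Finset _).card = 2 :=
      Finset.card_pair fun heq => hpq'.2 (by simp [heq])
    rw [← h1, ← Finset.card_union_of_disjoint]
    · refine Finset.card_le_card fun e he => ?_
      have key : ∀ p q, (F.divBi i j).Adj p q → p ∈ X → q ∉ X →
          s(p, q) ∈ {e ∈ N | F.divCol e = i} ∪ {e ∈ N | F.divCol e = j} := by
        intro p q hpq hp hq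
        have : s(p, q) ∈ N := (hmem _).2 (mem_edgeCut.2 ⟨hpq.1, by tauto⟩)
        rw [Finset.mem_union, Finset.mem_filter, Finset.mem_filter]
        exact hpq.2.imp (fun h => ⟨this, h⟩) (fun h => ⟨this, h⟩)
      rw [Finset.mem_insert, Finset.mem_singleton] at he
      rcases he with rfl | rfl
      · exact key p q hpq hp hq
      · exact key p' q' hpq'.1 hp' hq'
    · rw [Finset.disjoint_left]
      intro e he he'
      exact hij ((Finset.mem_filter.1 he).2.symm.trans (Finset.mem_filter.1 he').2)
  -- If some colour had no cut edge, the other four would have at least two each, more than 5 in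
  -- total. So each colour has at least one, and the total forces exactly one.
  have one : ∀ k, m k ≤ 1 := by
    rw [Fin.sum_univ_five] at hsum
    have h01 := two 0 1 (by decide)
    have h02 := two 0 2 (by decide)
    have h03 := two 0 3 (by decide)
    have h04 := two 0 4 (by decide)
    have h12 := two 1 2 (by decide)
    have h13 := two 1 3 (by decide)
    have h14 := two 1 4 (by decide)
    have h23 := two 2 3 (by decide)
    have h24 := two 2 4 (by decide)
    have h34 := two 3 4 (by decide)
    intro k
    fin_cases k <;> simp only [Fin.zero_eta, Fin.mk_one, Fin.reduceFinMk] <;> omega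
  exact Finset.card_le_one.1 (one (F.divCol e)) e
    (Finset.mem_filter.2 ⟨(hmem _).2 he, rfl⟩) e' (Finset.mem_filter.2 ⟨(hmem _).2 he', hcol.symm⟩)

/-- A `5`-edge-cut of the divorce, given by a set of vertices. -/
structure CutSet (F : Fragment) (X : Set F.DivorceV) : Prop where
  eq_of_mem : ∀ e ∈ edgeCut F.divorce X, ∀ e' ∈ edgeCut F.divorce X,
    F.divCol e = F.divCol e' → e = e'
  not_isolated : ∀ p, ∃ q, q ≠ p ∧ (q ∈ X ↔ p ∈ X)

/-- An edge of colour `k` in the copy `s` lies in the cut. -/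
def Crosses (X : Set F.DivorceV) (s : Bool) (k : Fin 5) : Prop :=
  ∃ u v, F.graph.Adj u v ∧ F.col s(u, v) = k ∧ (F.side s u ∈ X ↔ F.side s v ∉ X)

namespace CutSet

variable {X : Set F.DivorceV}

/-- A cut edge is determined by its colour. If all crossings of the path have the same colour there
is at most one, and ends on the same side exclude exactly one. -/
lemma uniform (hc : F.CutSet X) (hl : F.Local) {s : Bool} {i j : Fin 5} {x y : F.V} {S : Set F.V}
    (h : Spans (F.bi i j) x y S) (hxy : F.side s x ∈ X ↔ F.side s y ∈ X)
    (hcr : ∃ k, ∀ u ∈ S, ∀ v ∈ S, (F.bi i j).Adj u v → (F.side s u ∈ X ↔ F.side s v ∉ X) →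
      F.col s(u, v) = k) :
    ∀ u ∈ S, F.side s u ∈ X ↔ F.side s x ∈ X := by
  obtain ⟨k, hk⟩ := hcr
  refine h.uniform (F.side s ⁻¹' X) ?_ hxy
  intro u hu v hv u' hu' v' hv' huv huv' h1 h2 h3 h4
  refine Sym2.map.injective (side_injective s) (hc.eq_of_mem _ ?_ _ ?_ ?_)
  · exact mem_edgeCut.2 ⟨side_adj_of_adj huv.1, by simp only [Set.mem_preimage] at *; tauto⟩
  · exact mem_edgeCut.2 ⟨side_adj_of_adj huv'.1, by simp only [Set.mem_preimage] at *; tauto⟩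
  · rw [Sym2.map_mk, Sym2.map_mk, hl.divCol_side huv.1, hl.divCol_side huv'.1,
      hk u hu v hv huv (by simp only [Set.mem_preimage] at *; tauto),
      hk u' hu' v' hv' huv' (by simp only [Set.mem_preimage] at *; tauto)]

lemma uniform_of_not_crosses (hc : F.CutSet X) (hl : F.Local) {s : Bool} {i j : Fin 5} {x y : F.V}
    {S : Set F.V} (h : Spans (F.bi i j) x y S) (hxy : F.side s x ∈ X ↔ F.side s y ∈ X)
    (hcr : ¬ (Crosses X s i ∧ Crosses X s j)) :
    ∀ u ∈ S, F.side s u ∈ X ↔ F.side s x ∈ X := by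
  refine hc.uniform hl h hxy ?_
  by_cases hi : Crosses X s i
  · refine ⟨i, fun u _ v _ huv hX => huv.2.resolve_right fun hj => hcr ⟨hi, u, v, huv.1, hj, hX⟩⟩
  · exact ⟨j, fun u _ v _ huv hX => huv.2.resolve_left fun hj => hi ⟨u, v, huv.1, hj, hX⟩⟩

/-- Colour `k` in the copy `s` and `colPerm k` in the other copy are the same colour of the divorce,
whose only cut edge would lie in both copies and hence be `bc`; but `bc` is not cut. -/
lemma not_crosses_not (hc : F.CutSet X) (hl : F.Local) {s : Bool} {k : Fin 5}
    (hbc : F.side s F.b ∈ X ↔ F.side s F.c ∈ X) (hk : Crosses X s k) :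
    ¬ Crosses X (!s) (colPerm k) := by
  rintro ⟨u', v', h1, h2, h3⟩
  obtain ⟨u, v, h4, h5, h6⟩ := hk
  have key : ∀ u' v', F.graph.Adj u' v' → F.side s u = F.side (!s) u' →
      F.side s v = F.side (!s) v' → False := by
    intro u' v' h7 h8 h9
    obtain ⟨hu, rfl⟩ := side_eq_side_not_iff.1 h8
    obtain ⟨hv, rfl⟩ := side_eq_side_not_iff.1 h9
    have := hl.adj_ends u hu v hv h4
    rcases Sym2.eq_iff.1 this with ⟨rfl, rfl⟩ | ⟨rfl, rfl⟩ <;> tauto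
  have := hc.eq_of_mem _ (mem_edgeCut.2 ⟨side_adj_of_adj h4, h6⟩) _
    (mem_edgeCut.2 ⟨side_adj_of_adj h1, h3⟩) (by
      rw [hl.divCol_side h4, hl.divCol_side h1, h5, h2, colSide_not, colPerm_colPerm])
  rcases Sym2.eq_iff.1 this with ⟨h7, h8⟩ | ⟨h7, h8⟩
  · exact key _ _ h1 h7 h8
  · exact key _ _ h1.symm h7 h8

/-- Not all vertices but one are on the same side. -/
lemma false_of_forall (hc : F.CutSet X) (p : F.DivorceV)
    (h : ∀ q, q ≠ p → (q ∈ X ↔ p ∉ X)) : False := by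
  obtain ⟨q, hq, hq'⟩ := hc.not_isolated p
  have := h q hq
  tauto

lemma forall_of_sides (s : Bool) {P : F.DivorceV → Prop} (h1 : ∀ v, P (F.side s v))
    (h2 : ∀ v ∉ F.ends, P (F.side (!s) v)) (p : F.DivorceV) : P p := by
  rcases exists_side' s p with ⟨v, rfl⟩ | ⟨v, hv, rfl⟩
  exacts [h1 v, h2 v hv]

/-- Here `bc` is the only cut edge of colour 1, so the path c…d in colours 1, 3 can only be crossed
in colour 3 and is uncrossed. This puts `a` on the side of c, and since b' = c and d' = a, the path
b'…d' in colours 1, 2 is uncrossed too. Only b = c' remains, cut off alone. -/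
lemma false_of_bc_of_d (hc : F.CutSet X) (h : F.IsSuitable) {s : Bool}
    (hbc : ¬ (F.side s F.b ∈ X ↔ F.side s F.c ∈ X))
    (hd : F.side s F.d ∈ X ↔ F.side s F.c ∈ X) : False := by
  have hl := h.local
  have hne := F.distinct
  have hcb : F.col s(F.c, F.b) = 1 := by rw [Sym2.eq_swap]; exact hl.col_bc
  have one : ∀ t u v, F.graph.Adj u v → F.col s(u, v) = 1 →
      (F.side t u ∈ X ↔ F.side t v ∉ X) → u = F.b ∨ u = F.c := by
    intro t u v huv h1 hX
    have hbc' : ¬ (F.side t F.b ∈ X ↔ F.side t F.c ∈ X) := by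
      by_cases hts : t = s
      · rwa [hts]
      · have hts : t = !s := by cases s <;> cases t <;> simp_all
        rw [hts, side_b, side_c]
        tauto
    have := hc.eq_of_mem _ (mem_edgeCut.2 ⟨side_adj_of_adj (s := t) huv, hX⟩) _
      (mem_edgeCut.2 ⟨side_adj_of_adj (s := t) hl.adj_bc, by tauto⟩)
      (by rw [hl.divCol_side huv, hl.divCol_side hl.adj_bc, h1, hl.col_bc])
    rcases Sym2.eq_iff.1 this with ⟨h3, -⟩ | ⟨h3, -⟩
    · exact Or.inl (side_inj.1 h3)
    · exact Or.inr (side_inj.1 h3)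
  have h1 := hc.uniform hl h.paths.p13 (s := s) hd.symm ⟨3, fun u hu v hv huv hX =>
    huv.2.resolve_left fun h1 => by
      rcases one s u v huv.1 h1 hX with rfl | rfl
      · exact hu rfl
      · exact hv (hl.proper.eq_of_col_eq huv.1 hl.adj_bc.symm (h1.trans hcb.symm))⟩
  have ha := h1 F.a hne.1
  have h2 := hc.uniform hl h.paths.p12 (s := !s) (by rw [side_b, side_d]; exact ha.symm)
    ⟨2, fun u hu v hv huv hX => huv.2.resolve_left fun h1 => by
      rcases one (!s) u v huv.1 h1 hX with rfl | rfl
      · exact hv (hl.proper.eq_of_col_eq huv.1 hl.adj_bc (h1.trans hl.col_bc.symm))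
      · exact hu rfl⟩
  rw [side_b] at h2
  refine hc.false_of_forall (F.side s F.b) (forall_of_sides s (fun v hv => ?_) fun v hv _ => ?_)
  · have := h1 v fun h => hv (by rw [h])
    tauto
  · have := h2 v fun h => hv (by simp [h, ends])
    tauto

lemma bc_mem_iff (hc : F.CutSet X) (h : F.IsSuitable) (s : Bool) :
    F.side s F.b ∈ X ↔ F.side s F.c ∈ X := by
  by_contra hbc
  have hl := h.local
  by_cases hd : F.side s F.d ∈ X ↔ F.side s F.c ∈ X
  · exact hc.false_of_bc_of_d h hbc hd
  · refine hc.false_of_bc_of_d h (s := !s) (by rw [side_b, side_c]; tauto) ?_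
    rw [side_c, side_d]
    have hne := F.distinct
    have h1 := hc.uniform hl h.paths.p12 (s := s) (by tauto) ⟨2, fun u hu v hv huv hX =>
      huv.2.resolve_left fun h1 => by
        have := hc.eq_of_mem _ (mem_edgeCut.2 ⟨side_adj_of_adj (s := s) huv.1, hX⟩) _
          (mem_edgeCut.2 ⟨side_adj_of_adj (s := s) hl.adj_bc, by tauto⟩)
          (by rw [hl.divCol_side huv.1, hl.divCol_side hl.adj_bc, h1, hl.col_bc])
        rcases Sym2.eq_iff.1 this with ⟨-, h3⟩ | ⟨h3, -⟩
        · exact hv (side_inj.1 h3)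
        · exact hu (side_inj.1 h3)⟩
    exact h1 F.a hne.2.1

/-- If the copy `s` is separated by the cut, then the other copy, except for `a` and `d`, is not. -/
lemma uniform_not (hc : F.CutSet X) (h : F.IsSuitable) {s : Bool}
    (hs : ¬ ∀ u, F.side s u ∈ X ↔ F.side s F.b ∈ X) :
    Crosses X s 2 ∧ Crosses X s 3 ∧
      ∀ u, u ≠ F.a → u ≠ F.d → (F.side (!s) u ∈ X ↔ F.side s F.b ∈ X) := by
  have hl := h.local
  have hbc := hc.bc_mem_iff h
  have h1 : Crosses X s 2 ∧ Crosses X s 3 := by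
    by_contra h2
    exact hs fun u => hc.uniform_of_not_crosses hl h.paths.p23 (hbc s) h2 u trivial
  refine ⟨h1.1, h1.2, fun u hu hu' => ?_⟩
  -- Colour 2 crosses in the copy `s`, so its partner π 2 = 4 does not cross in the other copy.
  have := hc.uniform_of_not_crosses hl h.paths.p45 (hbc (!s))
    (fun h2 => hc.not_crosses_not hl (hbc s) h1.1 h2.1) u ⟨hu, hu'⟩
  rw [this, side_b, hbc s]

/-- If `a` is separated from b, then both copies are separated, as a = d'. By `uniform_not` all
vertices except perhaps a and d are on the side of b. Either `a` is cut off alone, or d is with a;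
then the path a…d in colours 2, 4, which passes through b, is uncrossed because colour 4 does not
cross in this copy. -/
lemma ends_mem_iff_aux (hc : F.CutSet X) (h : F.IsSuitable) (s : Bool)
    (ha : ¬ (F.side s F.a ∈ X ↔ F.side s F.b ∈ X)) : False := by
  have hl := h.local
  have hbc := hc.bc_mem_iff h
  have hne := F.distinct
  obtain ⟨h1, h2, h3⟩ := hc.uniform_not h (s := s) fun h => ha (h _)
  obtain ⟨h4, h5, h6⟩ := hc.uniform_not h (s := !s) fun h => ha (by
    have := h F.d
    rw [side_d, side_b] at this
    rw [this, hbc s])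
  rw [Bool.not_not, side_b, ← hbc s] at h6
  by_cases hd : F.side s F.d ∈ X ↔ F.side s F.b ∈ X
  · refine hc.false_of_forall (F.side s F.a) (forall_of_sides s (fun v hv => ?_) fun v hv _ => ?_)
    · by_cases hvd : v = F.d
      · subst hvd
        tauto
      · have := h6 v (fun h => hv (by rw [h])) hvd
        tauto
    · have := h3 v (fun h => hv (by simp [h, ends])) (fun h => hv (by simp [h, ends]))
      tauto
  · have := hc.uniform_of_not_crosses hl h.paths.p24 (s := s) (by tauto)
      (fun h7 => hc.not_crosses_not hl (hbc (!s)) h4 (by rw [Bool.not_not]; exact h7.2)) F.b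
      hne.2.2.2.1
    tauto

lemma ends_mem_iff (hc : F.CutSet X) (h : F.IsSuitable) (s : Bool) :
    ∀ v ∈ F.ends, (F.side s v ∈ X ↔ F.side s F.b ∈ X) := by
  rw [forall_ends]
  refine ⟨by_contra (hc.ends_mem_iff_aux h s), Iff.rfl, (hc.bc_mem_iff h s).symm, ?_⟩
  have := by_contra (hc.ends_mem_iff_aux h (!s))
  rwa [side_a, side_b, ← hc.bc_mem_iff h s] at this

/-- If one copy is separated, `uniform_not` handles the other copy apart from a' and d', and
`ends_mem_iff` handles those. -/
lemma exists_uniform (hc : F.CutSet X) (h : F.IsSuitable) :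
    ∃ s, ∀ u, F.side (!s) u ∈ X ↔ F.side s F.b ∈ X := by
  by_cases hs : ∀ u, F.side true u ∈ X ↔ F.side true F.b ∈ X
  · refine ⟨false, fun u => ?_⟩
    have := hs u
    rw [hc.bc_mem_iff h] at this
    rw [← side_c]
    exact this
  · refine ⟨true, fun u => ?_⟩
    by_cases hu : u ∈ F.ends
    · rw [← side_c, ← hc.bc_mem_iff h]
      exact hc.ends_mem_iff h _ u hu
    · exact (hc.uniform_not h hs).2.2 u (fun h => hu (by simp [h, ends]))
        (fun h => hu (by simp [h, ends]))

end CutSet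

/-- The distinguished vertices `a` and `d` have a neighbour on their side. -/
lemma CutSet.exists_adj_notMem {X : Set F.DivorceV} (hc : F.CutSet X) (h : F.IsSuitable) {s : Bool}
    (hb : F.side s F.b ∉ X) {v : F.V} (hvX : F.side s v ∉ X) (hvb : v ≠ F.b) (hvc : v ≠ F.c) :
    ∃ w, F.graph.Adj v w ∧ F.side s w ∉ X := by
  have hl := h.local
  by_contra! hall
  obtain ⟨u, w, S₁, S₂, h1, h2, h3, h4, h5, -, hd, -⟩ := h.paths.p23.split (v := v) trivial hvb hvc
  have huw : u ≠ w := fun e => Set.disjoint_left.1 hd h1.right_mem (e ▸ h4.left_mem)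
  -- If all neighbours of `v` were across the cut, both its edges of colours 2 and 3 would be cut
  -- edges. The part of the path from `b` to `v` before its last edge would be crossed once more,
  -- repeating one of these colours.
  obtain ⟨p, hp, q, hq, hpq, hX⟩ := h1.exists_cross (X := F.side s ⁻¹' X)
    (by have := hall u h2.symm.1; simp only [Set.mem_preimage]; tauto)
  have key : ∀ w, F.graph.Adj v w → F.col s(v, w) = F.col s(p, q) → False := by
    intro w hw hcol
    have := hc.eq_of_mem _ (mem_edgeCut.2 ⟨side_adj_of_adj (s := s) hw, by
      have := hall w hw; tauto⟩) _ (mem_edgeCut.2 ⟨side_adj_of_adj (s := s) hpq.1, hX⟩)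
      (by rw [hl.divCol_side hw, hl.divCol_side hpq.1, hcol])
    rcases Sym2.eq_iff.1 this with ⟨h6, -⟩ | ⟨h6, -⟩
    · exact h5 (side_inj.1 h6 ▸ hp)
    · exact h5 (side_inj.1 h6 ▸ hq)
  have h6 := hl.proper.col_of_adj h2.symm h3 huw
  have h7 := key u h2.symm.1
  have h8 := key w h3.1
  rcases hpq.2 with h9 | h9 <;> rw [h9] at h7 h8 <;> tauto

/-- With one copy entirely outside `X`, all cut edges lie in the other. Non-triviality passes to
that copy directly at undistinguished vertices, through `bc` at b and c, and through
`exists_adj_notMem` at a and d. -/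
lemma IsSuitable.exists_cut (h : F.IsSuitable) (M : Set (Sym2 F.DivorceV))
    (hM : IsNontrivialFiveEdgeCut F.divorce M) :
    ∃ Y : Set F.V, (∀ v ∈ Y, v ∉ F.ends) ∧
      IsNontrivialFiveEdgeCut F.graph (edgeCut F.graph Y) ∧
      ∃ s, M = Sym2.map (F.side s) '' edgeCut F.graph Y := by
  obtain ⟨⟨X, rfl⟩, hcard, hiso⟩ := hM
  have hl := h.local
  have hc : F.CutSet X := by
    refine ⟨fun e he e' he' => h.eq_of_mem_cut hcard he he', fun p => ?_⟩
    obtain ⟨q, hq⟩ := hiso p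
    rw [deleteEdges_adj, mem_edgeCut] at hq
    exact ⟨q, hq.1.ne', by tauto⟩
  obtain ⟨s, hs⟩ := hc.exists_uniform h
  -- A set and its complement have the same cut, so the unseparated copy may be assumed to lie
  -- outside the set.
  have hb : ∃ X', edgeCut F.divorce X' = edgeCut F.divorce X ∧ F.CutSet X' ∧ F.side s F.b ∉ X' ∧
      ∀ u, F.side (!s) u ∉ X' := by
    by_cases hb : F.side s F.b ∈ X
    · refine ⟨Xᶜ, edgeCut_compl _ _, ⟨?_, ?_⟩, by simpa using hb, fun u => ?_⟩
      · rw [edgeCut_compl]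
        exact hc.eq_of_mem
      · intro p
        obtain ⟨q, h1, h2⟩ := hc.not_isolated p
        exact ⟨q, h1, by simp only [Set.mem_compl_iff]; tauto⟩
      · simpa using (hs u).2 hb
    · exact ⟨X, rfl, hc, hb, fun u => by rwa [hs u]⟩
  obtain ⟨X', hXX', hc, hb, hs⟩ := hb
  rw [← hXX'] at hcard hiso ⊢
  clear hXX'
  have hends : ∀ v ∈ F.ends, F.side s v ∉ X' := fun v hv => by
    rwa [hc.ends_mem_iff h s v hv]
  have himg : edgeCut F.divorce X' =
      Sym2.map (F.side s) '' edgeCut F.graph (F.side s ⁻¹' X') := by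
    ext e
    constructor
    · induction e with | _ p q
      intro he
      obtain ⟨h1, h2⟩ := mem_edgeCut.1 he
      obtain ⟨t, u, v, huv, rfl, rfl⟩ := divorce_adj.1 h1
      by_cases hts : t = s
      · subst hts
        exact ⟨s(u, v), mem_edgeCut.2 ⟨huv, h2⟩, rfl⟩
      · have hts : t = !s := by cases s <;> cases t <;> simp_all
        subst hts
        have := hs u
        have := hs v
        tauto
    · rintro ⟨e, he, rfl⟩
      induction e with | _ u v
      obtain ⟨h1, h2⟩ := mem_edgeCut.1 he
      exact mem_edgeCut.2 ⟨side_adj_of_adj h1, h2⟩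
  refine ⟨F.side s ⁻¹' X', fun v hv hv' => hends v hv' hv, ⟨⟨_, rfl⟩, ?_, fun v => ?_⟩, s, himg⟩
  · rw [himg, Set.ncard_image_of_injective _ (Sym2.map.injective (side_injective s))] at hcard
    exact hcard
  · simp only [deleteEdges_adj, mem_edgeCut, Set.mem_preimage]
    have hbX := hends F.b (by simp [ends])
    have hcX := hends F.c (by simp [ends])
    by_cases hv : v ∈ F.ends
    · have hvX := hends v hv
      by_cases hvb : v = F.b
      · exact ⟨F.c, hvb ▸ hl.adj_bc, by tauto⟩
      by_cases hvc : v = F.c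
      · exact ⟨F.b, hvc ▸ hl.adj_bc.symm, by tauto⟩
      obtain ⟨w, hw, hw'⟩ := hc.exists_adj_notMem h hb hvX hvb hvc
      exact ⟨w, hw, by tauto⟩
    · obtain ⟨q, hq⟩ := hiso (F.side s v)
      rw [deleteEdges_adj, mem_edgeCut] at hq
      obtain ⟨t, u, w, huw, hu, rfl⟩ := divorce_adj.1 hq.1
      by_cases hts : t = s
      · subst hts
        obtain rfl := side_inj.1 hu
        exact ⟨w, huw, fun h => hq.2 ⟨hq.1, h.2⟩⟩
      · have hts : t = !s := by cases s <;> cases t <;> simp_all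
        subst hts
        exact absurd (side_eq_side_not_iff.1 hu.symm).1 hv

end Fragment

/-! ### First return to a subset -/

section FirstReturn

variable {T : Type*} [Finite T] (σ : Equiv.Perm T) (P : T → Prop)

lemma exists_iterate_succ_mem {t : T} (ht : P t) : ∃ k, P (σ^[k + 1] t) := by
  refine ⟨orderOf σ - 1, ?_⟩
  rw [Nat.sub_add_cancel (orderOf_pos σ), Equiv.Perm.iterate_eq_pow, pow_orderOf_eq_one]
  exact ht

open Classical in
/-- The permutation of a subset induced by a permutation. -/
noncomputable def firstReturn : Equiv.Perm {t // P t} :=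
  Equiv.ofBijective
    (fun t => ⟨σ^[Nat.find (exists_iterate_succ_mem σ P t.2) + 1] t.1,
      Nat.find_spec (exists_iterate_succ_mem σ P t.2)⟩) <| by
    rw [← Finite.injective_iff_bijective]
    -- If two returns coincide, cancelling the common iterates shows that the longer orbit has met
    -- the start of the shorter one, which lies in `P`, before its first return.
    have key : ∀ (t t' : {t // P t}) (k k' : ℕ), k ≤ k' → (∀ m < k', ¬ P (σ^[m + 1] t'.1)) →
        σ^[k + 1] t.1 = σ^[k' + 1] t'.1 → t = t' := by
      intro t t' k k' hk hk' h
      obtain ⟨n, rfl⟩ := Nat.exists_eq_add_of_le hk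
      rw [add_right_comm, Function.iterate_add_apply σ (k + 1)] at h
      have h := σ.injective.iterate _ h
      cases n with
      | zero => exact Subtype.ext h
      | succ n =>
        refine absurd t.2 ?_
        rw [h]
        exact hk' n (by omega)
    intro t t' h
    have h := congrArg Subtype.val h
    rcases le_total (Nat.find (exists_iterate_succ_mem σ P t.2))
      (Nat.find (exists_iterate_succ_mem σ P t'.2)) with h1 | h1
    · exact key t t' _ _ h1 (fun m hm => Nat.find_min _ hm) h
    · exact (key t' t _ _ h1 (fun m hm => Nat.find_min _ hm) h.symm).symm

lemma firstReturn_spec (t : {t // P t}) : ∃ k, (firstReturn σ P t).1 = σ^[k + 1] t.1 ∧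
    ∀ m < k, ¬ P (σ^[m + 1] t.1) := by
  classical
  exact ⟨_, rfl, fun m hm => Nat.find_min (exists_iterate_succ_mem σ P t.2) hm⟩

variable {σ P}

lemma firstReturn_eq {t : {t // P t}} {k : ℕ} (hk : P (σ^[k + 1] t.1))
    (hk' : ∀ m < k, ¬ P (σ^[m + 1] t.1)) : (firstReturn σ P t).1 = σ^[k + 1] t.1 := by
  classical
  have : Nat.find (exists_iterate_succ_mem σ P t.2) = k := by
    rw [Nat.find_eq_iff]
    exact ⟨hk, fun m hm => hk' m hm⟩
  change σ^[Nat.find (exists_iterate_succ_mem σ P t.2) + 1] t.1 = _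
  rw [this]

/-- Deleting darts from a rotation leaves the remaining darts at a vertex in a single cycle. -/
lemma sameCycle_firstReturn {t t' : {t // P t}} (h : σ.SameCycle t.1 t'.1) :
    (firstReturn σ P).SameCycle t t' := by
  obtain ⟨n, hn⟩ := h.exists_nat_pow_eq
  rw [← Equiv.Perm.iterate_eq_pow] at hn
  clear h
  induction n using Nat.strong_induction_on generalizing t with
  | _ n ih =>
    rcases n with _ | n
    · rw [show t = t' from Subtype.ext hn]
    · obtain ⟨k, hk, hk'⟩ := firstReturn_spec σ P t
      have hkn : k ≤ n := by
        by_contra hkn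
        exact hk' n (by omega) (hn ▸ t'.2)
      obtain ⟨l, rfl⟩ := Nat.exists_eq_add_of_le hkn
      refine Equiv.Perm.sameCycle_apply_left.1 (ih l (by omega) ?_)
      rw [hk, ← hn, ← Function.iterate_add_apply]
      congr 1
      omega

lemma firstReturn_commute {τ : T → T} (hτ : ∀ t, σ (τ t) = τ (σ t)) (hP : ∀ t, P (τ t) ↔ P t)
    (t : {t // P t}) :
    (firstReturn σ P ⟨τ t.1, (hP _).2 t.2⟩).1 = τ (firstReturn σ P t).1 := by
  have key : ∀ k t, σ^[k] (τ t) = τ (σ^[k] t) := fun k =>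
    (Function.Commute.iterate_left (f := σ) (g := τ) hτ k)
  obtain ⟨k, hk, hk'⟩ := firstReturn_spec σ P t
  rw [hk, ← key]
  refine firstReturn_eq ?_ fun m hm => ?_
  · rw [key, hP, ← hk]
    exact (firstReturn σ P t).2
  · rw [key, hP]
    exact hk' m hm

/-- The skipped elements do not change `N`. For faces this says that deleting an edge only requires
identifying the labels on its two sides. -/
lemma label_firstReturn {Λ : Type*} {N : T → Λ} (hN : ∀ t, ¬ P t → N (σ t) = N t)
    (t : {t // P t}) : N (firstReturn σ P t).1 = N (σ t.1) := by
  obtain ⟨k, hk, hk'⟩ := firstReturn_spec σ P t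
  rw [hk]
  clear hk
  induction k with
  | zero => rfl
  | succ k ih =>
    rw [Function.iterate_succ_apply', hN _ (hk' k (by omega)), ih fun m hm => hk' m (by omega)]

omit [Finite T] in
lemma label_iterate_of_forall_not {Λ : Type*} {N : T → Λ} (hN : ∀ t, ¬ P t → N (σ t) = N t)
    {t : T} {k : ℕ} (hk : ∀ m < k, ¬ P (σ^[m] t)) : N (σ^[k] t) = N t := by
  induction k with
  | zero => rfl
  | succ k ih =>
    rw [Function.iterate_succ_apply', hN _ (hk k (by omega)), ih fun m hm => hk m (by omega)]

lemma exists_first_iterate {t : T} (ht : ∃ t', P t' ∧ σ.SameCycle t t') :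
    ∃ k, P (σ^[k] t) ∧ ∀ m < k, ¬ P (σ^[m] t) := by
  classical
  have hex : ∃ k, P (σ^[k] t) := by
    obtain ⟨t', h1, h2⟩ := ht
    obtain ⟨n, rfl⟩ := h2.exists_nat_pow_eq
    exact ⟨n, by rwa [Equiv.Perm.iterate_eq_pow]⟩
  exact ⟨Nat.find hex, Nat.find_spec hex, fun m hm => Nat.find_min hex hm⟩

end FirstReturn

/-- Identifying one element with another one loses at most one element of the range. -/
lemma card_range_update_comp {ι Λ : Type*} [Finite Λ] [DecidableEq Λ] (f : ι → Λ) (a b : Λ) :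
    Nat.card (Set.range f) ≤ Nat.card (Set.range (Function.update id a b ∘ f)) + 1 := by
  rw [Nat.card_coe_set_eq, Nat.card_coe_set_eq]
  have h : Set.range f \ {a} ⊆ Set.range (Function.update id a b ∘ f) := by
    rintro _ ⟨⟨x, rfl⟩, hx⟩
    exact ⟨x, by simp [Function.update_of_ne (show f x ≠ a from hx)]⟩
  have h1 := Set.ncard_le_ncard h
  have h2 := Set.ncard_le_ncard_sdiff_add_ncard (Set.range f) {a}
  rw [Set.ncard_singleton] at h2
  omega

namespace Fragment

variable {F : Fragment}

/-! ### The embedding of the divorce -/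

/-- Four darts of one facial walk that leave `a`, `b`, `c`, `d`, in this order. -/
structure Facial (F : Fragment) where
  x : F.graph.Dart
  i : ℕ
  j : ℕ
  k : ℕ
  hi : 0 < i
  hij : i < j
  hjk : j < k
  hk : k < Function.minimalPeriod F.rot.facePerm x
  fst_x : x.fst = F.a
  fst_i : (F.rot.facePerm^[i] x).fst = F.b
  fst_j : (F.rot.facePerm^[j] x).fst = F.c
  fst_k : (F.rot.facePerm^[k] x).fst = F.d

lemma IsSuitable.nonempty_facial (h : F.IsSuitable) : Nonempty F.Facial := by
  obtain ⟨x, i, j, k, h1, h2, h3, h4, h5, h6, h7, h8⟩ := h.facial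
  refine ⟨⟨x, i, j, k, h1, h2, h3, h4, h5, ?_, ?_, ?_⟩⟩ <;>
    rwa [Equiv.Perm.iterate_eq_pow]

namespace Facial

variable (C : F.Facial)

def xi : F.graph.Dart := F.rot.facePerm^[C.i] C.x
def xj : F.graph.Dart := F.rot.facePerm^[C.j] C.x
def xk : F.graph.Dart := F.rot.facePerm^[C.k] C.x

lemma xi_fst : C.xi.fst = F.b := C.fst_i
lemma xj_fst : C.xj.fst = F.c := C.fst_j
lemma xk_fst : C.xk.fst = F.d := C.fst_k

/-- The darts of the two copies, together with the two darts of an additional edge `bc`. -/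
abbrev Darts (F : Fragment) : Type := (Bool × F.graph.Dart) ⊕ Bool

/-- The permutation that glues the corners of the two copies. -/
def glueFun : Darts F → Darts F
  -- The transpositions of `(s, x)` and `(!s, xk)` merge the rotations at a and d'. The 3-cycles
  -- `(s, xi)`, `(!s, xj)`, `inr s` merge those at b and c' and insert the dart of the new edge.
  | .inl (s, y) => if y = C.x then .inl (!s, C.xk) else if y = C.xk then .inl (!s, C.x)
      else if y = C.xi then .inl (!s, C.xj) else if y = C.xj then .inr (!s) else .inl (s, y)
  | .inr s => .inl (s, C.xi)

def glueInv : Darts F → Darts F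
  | .inl (s, y) => if y = C.x then .inl (!s, C.xk) else if y = C.xk then .inl (!s, C.x)
      else if y = C.xi then .inr s else if y = C.xj then .inl (!s, C.xi) else .inl (s, y)
  | .inr s => .inl (!s, C.xj)

lemma ne_of_fst {y z : F.graph.Dart} {u v : F.V} (hy : y.fst = u) (hz : z.fst = v) (h : u ≠ v) :
    y ≠ z := by
  rintro rfl
  exact h (hy.symm.trans hz)

lemma distinct : C.x ≠ C.xi ∧ C.x ≠ C.xj ∧ C.x ≠ C.xk ∧ C.xi ≠ C.xj ∧ C.xi ≠ C.xk ∧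
    C.xj ≠ C.xk := by
  have h := F.distinct
  exact ⟨ne_of_fst C.fst_x C.xi_fst h.1, ne_of_fst C.fst_x C.xj_fst h.2.1,
    ne_of_fst C.fst_x C.xk_fst h.2.2.1, ne_of_fst C.xi_fst C.xj_fst h.2.2.2.1,
    ne_of_fst C.xi_fst C.xk_fst h.2.2.2.2.1, ne_of_fst C.xj_fst C.xk_fst h.2.2.2.2.2⟩

def glue : Equiv.Perm (Darts F) where
  toFun := C.glueFun
  invFun := C.glueInv
  left_inv := by
    have h := C.distinct
    rintro (⟨s, y⟩ | s)
    · by_cases h0 : y = C.x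
      · simp [glueFun, glueInv, h0, Ne.symm h.2.2.1]
      by_cases h1 : y = C.xk
      · simp [glueFun, glueInv, h1, Ne.symm h.2.2.1]
      by_cases h2 : y = C.xi
      · simp [glueFun, glueInv, h2, h, Ne.symm h.1, Ne.symm h.2.1, Ne.symm h.2.2.2.1]
      by_cases h3 : y = C.xj
      · simp [glueFun, glueInv, h3, h, Ne.symm h.2.1, Ne.symm h.2.2.2.1]
      · simp [glueFun, glueInv, h0, h1, h2, h3]
    · simp [glueFun, glueInv, h, Ne.symm h.1]
  right_inv := by
    have h := C.distinct
    rintro (⟨s, y⟩ | s)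
    · by_cases h0 : y = C.x
      · simp [glueFun, glueInv, h0, Ne.symm h.2.2.1]
      by_cases h1 : y = C.xk
      · simp [glueFun, glueInv, h1, Ne.symm h.2.2.1]
      by_cases h2 : y = C.xi
      · simp [glueFun, glueInv, h2, h, Ne.symm h.1]
      by_cases h3 : y = C.xj
      · simp [glueFun, glueInv, h3, h, Ne.symm h.1, Ne.symm h.2.1, Ne.symm h.2.2.2.1]
      · simp [glueFun, glueInv, h0, h1, h2, h3]
    · simp [glueFun, glueInv, h, Ne.symm h.2.1, Ne.symm h.2.2.2.1]

lemma glue_inl_x (s : Bool) : C.glue (.inl (s, C.x)) = .inl (!s, C.xk) := by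
  simp [glue, glueFun]

lemma glue_inl_xk (s : Bool) : C.glue (.inl (s, C.xk)) = .inl (!s, C.x) := by
  simp [glue, glueFun, C.distinct.2.2.1.symm]

lemma glue_inl_xi (s : Bool) : C.glue (.inl (s, C.xi)) = .inl (!s, C.xj) := by
  simp [glue, glueFun, C.distinct, C.distinct.1.symm]

lemma glue_inl_xj (s : Bool) : C.glue (.inl (s, C.xj)) = .inr (!s) := by
  simp [glue, glueFun, C.distinct, C.distinct.2.1.symm, C.distinct.2.2.2.1.symm]

lemma glue_inr (s : Bool) : C.glue (.inr s) = .inl (s, C.xi) := rfl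

lemma glue_inl_of_ne {s : Bool} {y : F.graph.Dart} (h0 : y ≠ C.x) (h1 : y ≠ C.xi) (h2 : y ≠ C.xj)
    (h3 : y ≠ C.xk) : C.glue (.inl (s, y)) = .inl (s, y) := by
  simp [glue, glueFun, h0, h1, h2, h3]

/-- The rotation at the vertices of the two glued copies with an additional edge `bc`. -/
def next : Equiv.Perm (Darts F) :=
  C.glue * Equiv.sumCongr ((Equiv.refl Bool).prodCongr F.rot.next) (Equiv.refl Bool)

lemma next_inl (s : Bool) (y : F.graph.Dart) :
    C.next (.inl (s, y)) = C.glue (.inl (s, F.rot.next y)) := rfl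

lemma next_inr (s : Bool) : C.next (.inr s) = .inl (s, C.xi) := rfl

/-- The vertex that a dart leaves. -/
def vert : Darts F → F.DivorceV
  | .inl (s, y) => F.side s y.fst
  | .inr s => F.side s F.b

/-- Reversal of darts. -/
def rev : Darts F → Darts F
  | .inl (s, y) => .inl (s, y.symm)
  | .inr s => .inr (!s)

/-- Exchange of the two copies. -/
def exch : Darts F → Darts F
  | .inl (s, y) => .inl (!s, y)
  | .inr s => .inr (!s)

/-- The dart does not belong to the edge `bc` of one of the two copies. -/
def Kept : Darts F → Prop
  | .inl (_, y) => y.edge ≠ s(F.b, F.c)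
  | .inr _ => True

lemma rev_rev (t : Darts F) : rev (rev t) = t := by
  rcases t with ⟨s, y⟩ | s <;> simp [rev]

lemma kept_rev (t : Darts F) : Kept (rev t) ↔ Kept t := by
  rcases t with ⟨s, y⟩ | s <;> simp [rev, Kept]

lemma kept_exch (t : Darts F) : Kept (exch t) ↔ Kept t := by
  rcases t with ⟨s, y⟩ | s <;> simp [exch, Kept]

lemma vert_exch (t : Darts F) : vert (exch t) = F.exchIso (vert t) := by
  rcases t with ⟨s, y⟩ | s <;> simp [exch, vert]

lemma rev_exch (t : Darts F) : rev (exch t) = exch (rev t) := by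
  rcases t with ⟨s, y⟩ | s <;> rfl

lemma glue_exch (t : Darts F) : C.glue (exch t) = exch (C.glue t) := by
  rcases t with ⟨s, y⟩ | s
  · by_cases h0 : y = C.x
    · simp [exch, h0, glue_inl_x]
    by_cases h1 : y = C.xk
    · simp [exch, h1, glue_inl_xk]
    by_cases h2 : y = C.xi
    · simp [exch, h2, glue_inl_xi]
    by_cases h3 : y = C.xj
    · simp [exch, h3, glue_inl_xj]
    · simp [exch, glue_inl_of_ne, *]
  · simp [exch, glue_inr]

lemma next_exch (t : Darts F) : C.next (exch t) = exch (C.next t) := by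
  rcases t with ⟨s, y⟩ | s
  · rw [next_inl, ← glue_exch]
    rfl
  · rfl

lemma vert_glue (t : Darts F) : vert (C.glue t) = vert t := by
  rcases t with ⟨s, y⟩ | s
  · by_cases h0 : y = C.x
    · simp [vert, h0, glue_inl_x, C.xk_fst, C.fst_x, side_d]
    by_cases h1 : y = C.xk
    · simp [vert, h1, glue_inl_xk, C.xk_fst, C.fst_x, side_a]
    by_cases h2 : y = C.xi
    · simp [vert, h2, glue_inl_xi, C.xi_fst, C.xj_fst, side_c]
    by_cases h3 : y = C.xj
    · simp [vert, h3, glue_inl_xj, C.xj_fst, side_b]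
    · rw [glue_inl_of_ne C h0 h2 h3 h1]
  · simp [vert, glue_inr, C.xi_fst]

lemma vert_next (t : Darts F) : vert (C.next t) = vert t := by
  rcases t with ⟨s, y⟩ | s
  · rw [next_inl, vert_glue]
    exact congrArg (F.side s) (F.rot.next_fst y)
  · rw [next_inr]
    exact congrArg (F.side s) C.xi_fst

/-- At the vertex of `z` the gluing affects at most the dart `z` itself, so turning from `z` follows
the old rotation until `z` is reached again. -/
lemma sameCycle_next {z : F.graph.Dart} (hz : ∀ y, y.fst = z.fst → y ≠ z →
    y ≠ C.x ∧ y ≠ C.xi ∧ y ≠ C.xj ∧ y ≠ C.xk) (s : Bool) {y : F.graph.Dart}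
    (hy : y.fst = z.fst) : C.next.SameCycle (.inl (s, z)) (.inl (s, y)) := by
  obtain ⟨n, rfl⟩ := (F.rot.sameCycle_next z y hy.symm).exists_nat_pow_eq
  induction n with
  | zero => exact .refl _ _
  | succ n ih =>
    rw [pow_succ', Equiv.Perm.mul_apply] at hy ⊢
    rw [F.rot.next_fst] at hy
    by_cases h : F.rot.next ((F.rot.next ^ n) z) = z
    · rw [h]
    · obtain ⟨h0, h1, h2, h3⟩ := hz _ ((F.rot.next_fst _).trans hy) h
      have h4 := C.next_inl s ((F.rot.next ^ n) z)
      rw [glue_inl_of_ne C h0 h1 h2 h3] at h4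
      rw [← h4]
      exact Equiv.Perm.sameCycle_apply_right.2 (ih hy)

/-- The predecessor of `z` in the old rotation is now followed by the image of `z` under gluing;
this links the two merged rotations. -/
lemma sameCycle_glue (s : Bool) (z : F.graph.Dart) (hz : ∀ y, y.fst = z.fst → y ≠ z →
    y ≠ C.x ∧ y ≠ C.xi ∧ y ≠ C.xj ∧ y ≠ C.xk) :
    C.next.SameCycle (.inl (s, z)) (C.glue (.inl (s, z))) := by
  have h := C.next_inl s (F.rot.next.symm z)
  rw [Equiv.apply_symm_apply] at h
  rw [← h]
  refine Equiv.Perm.sameCycle_apply_right.2 (C.sameCycle_next hz s ?_)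
  rw [← F.rot.next_fst, Equiv.apply_symm_apply]

lemma special (z : F.graph.Dart) (hz : z = C.x ∨ z = C.xi ∨ z = C.xj ∨ z = C.xk ∨
    z.fst ∉ F.ends) : ∀ y, y.fst = z.fst → y ≠ z →
    y ≠ C.x ∧ y ≠ C.xi ∧ y ≠ C.xj ∧ y ≠ C.xk := by
  intro y hy hyz
  have h := F.distinct
  have h0 := C.fst_x
  have h1 := C.xi_fst
  have h2 := C.xj_fst
  have h3 := C.xk_fst
  simp only [mem_ends, not_or] at hz
  refine ⟨?_, ?_, ?_, ?_⟩ <;> rintro rfl <;> rcases hz with rfl | rfl | rfl | rfl | hz <;> grind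

lemma eq_of_side_eq {s t : Bool} {u v : F.V} (h : F.side s u = F.side t v) :
    (s = t ∧ u = v) ∨ (s = !t ∧ v ∈ F.ends ∧ u = F.sw v) := by
  by_cases hst : s = t
  · subst hst
    exact Or.inl ⟨rfl, side_inj.1 h⟩
  · have hst : s = !t := by cases s <;> cases t <;> simp_all
    subst hst
    exact Or.inr ⟨rfl, side_eq_side_not_iff.1 h.symm⟩

lemma sameCycle_of_vert_eq_a (s : Bool) (t : Darts F) (ht : vert t = F.side s F.a) :
    C.next.SameCycle (.inl (s, C.x)) t := by
  have h := F.distinct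
  rcases t with ⟨s', y⟩ | s'
  · rcases eq_of_side_eq ht with ⟨rfl, hy⟩ | ⟨rfl, -, hy⟩
    · exact C.sameCycle_next (C.special _ (by simp)) _ (hy.trans C.fst_x.symm)
    · have h1 := C.sameCycle_glue s C.x (C.special _ (by simp))
      rw [glue_inl_x] at h1
      exact h1.trans (C.sameCycle_next (C.special _ (by simp)) _
        (hy.trans (by rw [C.xk_fst, sw_a])))
  · rcases eq_of_side_eq ht with ⟨rfl, hy⟩ | ⟨rfl, -, hy⟩
    · exact absurd hy.symm h.1
    · rw [sw_a] at hy
      exact absurd hy h.2.2.2.2.1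

lemma sameCycle_of_vert_eq_b (s : Bool) (t : Darts F) (ht : vert t = F.side s F.b) :
    C.next.SameCycle (.inl (s, C.xi)) t := by
  have h := F.distinct
  rcases t with ⟨s', y⟩ | s'
  · rcases eq_of_side_eq ht with ⟨rfl, hy⟩ | ⟨rfl, -, hy⟩
    · exact C.sameCycle_next (C.special _ (by simp)) _ (hy.trans C.xi_fst.symm)
    · have h1 := C.sameCycle_glue s C.xi (C.special _ (by simp))
      rw [glue_inl_xi] at h1
      exact h1.trans (C.sameCycle_next (C.special _ (by simp)) _
        (hy.trans (by rw [C.xj_fst, sw_b])))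
  · rcases eq_of_side_eq ht with ⟨rfl, hy⟩ | ⟨rfl, -, hy⟩
    · rw [← C.next_inr]
      exact Equiv.Perm.sameCycle_apply_left.2 (.refl _ _)
    · rw [sw_b] at hy
      exact absurd hy h.2.2.2.1

lemma sameCycle_of_vert_eq (t t' : Darts F) (h : vert t = vert t') :
    C.next.SameCycle t t' := by
  obtain ⟨s, v, hv⟩ := exists_side (vert t)
  by_cases hve : v ∈ F.ends
  · have key : (∃ s, vert t = F.side s F.a) ∨ ∃ s, vert t = F.side s F.b := by
      rcases mem_ends.1 hve with rfl | rfl | rfl | rfl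
      · exact Or.inl ⟨s, hv⟩
      · exact Or.inr ⟨s, hv⟩
      · exact Or.inr ⟨!s, by rw [hv, side_b]⟩
      · exact Or.inl ⟨!s, by rw [hv, side_a]⟩
    rcases key with ⟨s, hs⟩ | ⟨s, hs⟩
    · exact (C.sameCycle_of_vert_eq_a s t hs).symm.trans
        (C.sameCycle_of_vert_eq_a s t' (h ▸ hs))
    · exact (C.sameCycle_of_vert_eq_b s t hs).symm.trans
        (C.sameCycle_of_vert_eq_b s t' (h ▸ hs))
  · have key : ∀ t : Darts F, vert t = F.side s v → ∃ y, t = .inl (s, y) ∧ y.fst = v := by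
      rintro (⟨s', y⟩ | s') ht
      · rcases eq_of_side_eq ht with ⟨rfl, hy⟩ | ⟨rfl, hv, -⟩
        · exact ⟨y, rfl, hy⟩
        · exact absurd hv hve
      · rcases eq_of_side_eq ht with ⟨rfl, rfl⟩ | ⟨rfl, hv, -⟩
        · exact absurd (by simp [ends]) hve
        · exact absurd hv hve
    obtain ⟨y, rfl, hy⟩ := key t hv
    obtain ⟨y', rfl, hy'⟩ := key t' (h ▸ hv)
    exact C.sameCycle_next (C.special _ (by simp [hy, hve])) s (hy'.trans hy.symm)

/-- The rotation system of the divorce. -/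
noncomputable def combMap (hl : F.Local) : CombMap F.divorce {t : Darts F // Kept t} where
  vert t := vert t.1
  σ := firstReturn C.next Kept
  α t := ⟨rev t.1, (kept_rev _).2 t.2⟩
  α_α t := Subtype.ext (rev_rev _)
  adj := by
    rintro ⟨⟨s, y⟩ | s, ht⟩
    · exact side_adj_of_adj y.adj
    · change F.divorce.Adj (F.side s F.b) (F.side (!s) F.b)
      rw [side_b]
      exact side_adj_of_adj hl.adj_bc
  inj := by
    have hne := F.distinct
    have key : ∀ (y : F.graph.Dart) (s s' : Bool), y.edge ≠ s(F.b, F.c) →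
        F.side s y.fst = F.side s' F.b → F.side s y.snd = F.side (!s') F.b → False := by
      intro y s s' hy h1 h2
      rw [side_b] at h2
      rcases eq_of_side_eq h1 with ⟨rfl, h3⟩ | ⟨rfl, -, h3⟩
      · rw [side_inj] at h2
        exact hy (by rw [Dart.edge, ← h3, ← h2])
      · rw [← side_b, side_inj] at h2
        rw [sw_b] at h3
        exact hy (by rw [Sym2.eq_swap, Dart.edge, ← h3, ← h2])
    rintro ⟨⟨s, y⟩ | s, ht⟩ ⟨⟨s', y'⟩ | s', ht'⟩ h1 h2
    · change F.side s y.fst = F.side s' y'.fst at h1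
      change F.side s y.snd = F.side s' y'.snd at h2
      rcases eq_of_side_eq h1 with ⟨rfl, h3⟩ | ⟨rfl, h3, -⟩
      · rw [side_inj] at h2
        have : y = y' := Dart.ext _ _ (Prod.ext h3 h2)
        subst this
        rfl
      · have h4 := (side_eq_side_not_iff.1 h2.symm).1
        exact absurd (hl.adj_ends _ h3 _ h4 y'.adj) ht'
    · exact (key y s s' ht h1 h2).elim
    · exact (key y' s' s ht' h1.symm h2.symm).elim
    · rcases eq_of_side_eq h1 with ⟨rfl, -⟩ | ⟨rfl, -, h3⟩
      · rfl
      · rw [sw_b] at h3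
        exact absurd h3 hne.2.2.2.1
  surj := by
    intro p q hpq
    obtain ⟨s, u, v, huv, rfl, rfl⟩ := divorce_adj.1 hpq
    by_cases h : s(u, v) = s(F.b, F.c)
    · rcases Sym2.eq_iff.1 h with ⟨rfl, rfl⟩ | ⟨rfl, rfl⟩
      · exact ⟨⟨.inr s, trivial⟩, rfl, side_b s⟩
      · exact ⟨⟨.inr (!s), trivial⟩, side_b s, by
          change F.side (!(!s)) F.b = _
          rw [Bool.not_not]⟩
    · exact ⟨⟨.inl (s, ⟨(u, v), huv⟩), h⟩, rfl, rfl⟩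
  vert_σ t := by
    obtain ⟨k, hk, -⟩ := firstReturn_spec C.next Kept t
    rw [hk]
    have : ∀ n, vert (C.next^[n] t.1) = vert t.1 := by
      intro n
      induction n with
      | zero => rfl
      | succ n ih => rw [Function.iterate_succ_apply', vert_next, ih]
    exact this _
  sameCycle_σ t t' h := sameCycle_firstReturn (C.sameCycle_of_vert_eq _ _ h)

end Facial

end Fragment

/-! ### Faces of the glued map and its planarity. -/

namespace Fragment

variable {F : Fragment}

lemma IsSuitable.connected (h : F.IsSuitable) : F.graph.Connected := by
  obtain ⟨p, h1, h2⟩ := h.path23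
  have : Nonempty F.V := ⟨F.a⟩
  have hb : ∀ v, F.graph.Reachable F.b v := fun v => ⟨p.takeUntil v (h2 v)⟩
  exact ⟨fun u v => (hb u).symm.trans (hb v)⟩

instance : Nontrivial F.V := ⟨F.a, F.b, F.distinct.1⟩

instance : Nontrivial F.DivorceV := ⟨F.side false F.a, F.side false F.b,
  fun h => F.distinct.1 (side_inj.1 h)⟩

namespace Facial

variable (C : F.Facial)

/-- The face that contains `a`, `b`, `c`, `d`. -/
def outer : F.rot.Face := Quotient.mk _ C.x

/-- The face on one side of a dart. -/
def face (y : F.graph.Dart) : F.rot.Face := Quotient.mk _ y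

lemma face_facePerm (y : F.graph.Dart) : face (F.rot.facePerm y) = face y :=
  Quotient.sound (Equiv.Perm.sameCycle_apply_left.2 (.refl _ _))

lemma face_iterate (n : ℕ) (y : F.graph.Dart) : face (F.rot.facePerm^[n] y) = face y := by
  induction n with
  | zero => rfl
  | succ n ih => rw [Function.iterate_succ_apply', face_facePerm, ih]

lemma period_pos : 0 < Function.minimalPeriod F.rot.facePerm C.x :=
  (Nat.zero_le _).trans_lt C.hk

lemma exists_index {y : F.graph.Dart} (hy : face y = C.outer) :
    ∃ m < Function.minimalPeriod F.rot.facePerm C.x, F.rot.facePerm^[m] C.x = y := by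
  have h : F.rot.facePerm.SameCycle C.x y := (Quotient.exact hy).symm
  obtain ⟨n, hn⟩ := h.exists_nat_pow_eq
  rw [← Equiv.Perm.iterate_eq_pow] at hn
  exact ⟨n % _, Nat.mod_lt _ C.period_pos, by rwa [Function.iterate_mod_minimalPeriod_eq]⟩

open Classical in
/-- The position of a dart in the facial walk. -/
noncomputable def index (y : F.graph.Dart) : ℕ :=
  if hy : face y = C.outer then (C.exists_index hy).choose else 0

lemma index_iterate {m : ℕ} (hm : m < Function.minimalPeriod F.rot.facePerm C.x) :
    C.index (F.rot.facePerm^[m] C.x) = m := by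
  have hy : face (F.rot.facePerm^[m] C.x) = C.outer := face_iterate m C.x
  rw [index, dif_pos hy]
  obtain ⟨h1, h2⟩ := (C.exists_index hy).choose_spec
  exact Function.iterate_injOn_Iio_minimalPeriod h1 hm h2

/-- The labels of facial walks: a face of a copy other than the outer one, or one of the pieces
into which gluing the copies divides the outer face. -/
abbrev Label : Type := (Bool × {q : F.rot.Face // q ≠ C.outer}) ⊕ Option (Bool × Bool)

/-- The piece of the outer face that contains a dart of the outer facial walk. -/
def segment (s : Bool) (m : ℕ) : Option (Bool × Bool) :=
  -- Gluing joins the stretch a…b of the copy `s` to the stretch c'…d' of the other copy, hence the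
  -- negation in the third case. The stretch b…c bounds a region with the new edge, and the two
  -- stretches d…a bound the common region `none`.
  if m < C.i then some (false, s) else if m < C.j then some (true, s)
  else if m < C.k then some (false, !s) else none

open Classical in
/-- The label of a dart. -/
noncomputable def label : Darts F → C.Label
  | .inl (s, y) => if h : face y = C.outer then .inr (C.segment s (C.index y))
      else .inl (s, ⟨face y, h⟩)
  | .inr s => .inr (some (true, !s))

lemma label_iterate (s : Bool) {m : ℕ} (hm : m < Function.minimalPeriod F.rot.facePerm C.x) :
    C.label (.inl (s, F.rot.facePerm^[m] C.x)) = .inr (C.segment s m) := by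
  have h : face (F.rot.facePerm^[m] C.x) = C.outer := face_iterate m C.x
  rw [label, dif_pos h, C.index_iterate hm]

lemma label_x (s : Bool) : C.label (.inl (s, C.x)) = .inr (some (false, s)) := by
  have h := C.label_iterate s C.period_pos
  rwa [segment, if_pos C.hi] at h

lemma label_xi (s : Bool) : C.label (.inl (s, C.xi)) = .inr (some (true, s)) := by
  have h := C.label_iterate s (C.hij.trans (C.hjk.trans C.hk))
  rwa [segment, if_neg (lt_irrefl _), if_pos C.hij] at h

lemma label_xj (s : Bool) : C.label (.inl (s, C.xj)) = .inr (some (false, !s)) := by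
  have h := C.label_iterate s (C.hjk.trans C.hk)
  rwa [segment, if_neg C.hij.not_gt, if_neg (lt_irrefl _), if_pos C.hjk] at h

lemma label_xk (s : Bool) : C.label (.inl (s, C.xk)) = .inr none := by
  have h := C.label_iterate s C.hk
  rwa [segment, if_neg (C.hij.trans C.hjk).not_gt, if_neg C.hjk.not_gt, if_neg (lt_irrefl _)] at h

lemma label_of_facePerm_eq (s : Bool) {y : F.graph.Dart} {m : ℕ}
    (hm : m < Function.minimalPeriod F.rot.facePerm C.x)
    (h : F.rot.facePerm y = F.rot.facePerm^[m + 1] C.x) :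
    C.label (.inl (s, y)) = .inr (C.segment s m) := by
  rw [Function.iterate_succ_apply'] at h
  rw [F.rot.facePerm.injective h, C.label_iterate s hm]

/-- Away from the four corners the old facial walk continues within its piece. At a corner the walk
passes to the other copy or to the new edge, and the pieces are named so that the label before and
after agree. -/
lemma label_next_rev (t : Darts F) : C.label (C.next (rev t)) = C.label t := by
  have hi := C.hi
  have hij := C.hij
  have hjk := C.hjk
  have hk := C.hk
  rcases t with ⟨s, y⟩ | s
  · have h : C.next (rev (.inl (s, y))) = C.glue (.inl (s, F.rot.facePerm y)) := rfl
    rw [h]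
    by_cases h0 : F.rot.facePerm y = C.x
    · rw [h0, glue_inl_x, label_xk,
        C.label_of_facePerm_eq s (m := Function.minimalPeriod F.rot.facePerm C.x - 1) (by omega)
        (by rw [Nat.sub_add_cancel C.period_pos, Function.iterate_minimalPeriod, h0]), segment,
        if_neg (by omega), if_neg (by omega), if_neg (by omega)]
    by_cases h1 : F.rot.facePerm y = C.xk
    · rw [h1, glue_inl_xk, label_x,
        C.label_of_facePerm_eq s (m := C.k - 1) (by omega)
        (by rw [Nat.sub_add_cancel (by omega), h1]; rfl), segment,
        if_neg (by omega), if_neg (by omega), if_pos (by omega)]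
    by_cases h2 : F.rot.facePerm y = C.xi
    · rw [h2, glue_inl_xi, label_xj, Bool.not_not,
        C.label_of_facePerm_eq s (m := C.i - 1) (by omega)
        (by rw [Nat.sub_add_cancel (by omega), h2]; rfl), segment, if_pos (by omega)]
    by_cases h3 : F.rot.facePerm y = C.xj
    · rw [h3, glue_inl_xj,
        C.label_of_facePerm_eq s (m := C.j - 1) (by omega)
        (by rw [Nat.sub_add_cancel (by omega), h3]; rfl), segment, if_neg (by omega),
        if_pos (by omega), label, Bool.not_not]
    rw [glue_inl_of_ne C h0 h2 h3 h1]
    by_cases hy : face y = C.outer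
    · obtain ⟨m, hm, rfl⟩ := C.exists_index hy
      rw [← Function.iterate_succ_apply' F.rot.facePerm] at *
      have hm' : m + 1 ≠ Function.minimalPeriod F.rot.facePerm C.x := fun h => h0 (by
        rw [Nat.succ_eq_add_one, h, Function.iterate_minimalPeriod])
      have h4 : m + 1 ≠ C.i := fun h => h2 (by rw [Nat.succ_eq_add_one, h]; rfl)
      have h5 : m + 1 ≠ C.j := fun h => h3 (by rw [Nat.succ_eq_add_one, h]; rfl)
      have h6 : m + 1 ≠ C.k := fun h => h1 (by rw [Nat.succ_eq_add_one, h]; rfl)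
      rw [C.label_iterate s hm, C.label_iterate s (by omega), segment, segment]
      split_ifs <;> first | rfl | omega
    · have hy' : face (F.rot.facePerm y) ≠ C.outer := by rwa [face_facePerm]
      rw [label, label, dif_neg hy, dif_neg hy']
      simp only [face_facePerm]
  · change C.label (.inl (!s, C.xi)) = _
    rw [label_xi, label]

lemma label_surjective : Function.Surjective C.label := by
  rintro (⟨s, q, hq⟩ | _ | ⟨_ | _, s⟩)
  · obtain ⟨y, rfl⟩ := Quotient.mk_surjective q
    exact ⟨.inl (s, y), dif_neg hq⟩
  · exact ⟨_, C.label_xk false⟩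
  · exact ⟨_, C.label_x s⟩
  · exact ⟨_, C.label_xi s⟩

/-- The dart from `b` to `c`. -/
def bcDart (hl : F.Local) : F.graph.Dart := ⟨(F.b, F.c), hl.adj_bc⟩

lemma not_kept_iff (hl : F.Local) {t : Darts F} : ¬ Kept t ↔
    ∃ s, t = .inl (s, bcDart hl) ∨ t = .inl (s, (bcDart hl).symm) := by
  rcases t with ⟨s, y⟩ | s
  · have : ¬ Kept (.inl (s, y)) ↔ y.edge = (bcDart hl).edge := not_not
    rw [this, dart_edge_eq_iff]
    simp [← and_or_left]
  · simp [Kept]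

open Classical in
/-- The identification of labels caused by the removal of the two edges. -/
noncomputable def merge (hl : F.Local) : C.Label → C.Label :=
  let m := Function.update id (C.label (.inl (false, bcDart hl)))
    (C.label (.inl (false, (bcDart hl).symm)))
  -- The second identification acts on labels that the first one may already have changed.
  Function.update id (m (C.label (.inl (true, bcDart hl))))
    (m (C.label (.inl (true, (bcDart hl).symm)))) ∘ m

lemma merge_label_rev (hl : F.Local) {t : Darts F} (ht : ¬ Kept t) :
    C.merge hl (C.label (rev t)) = C.merge hl (C.label t) := by
  classical
  have key : ∀ s, C.merge hl (C.label (.inl (s, bcDart hl))) =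
      C.merge hl (C.label (.inl (s, (bcDart hl).symm))) := by
    have upd : ∀ a b : C.Label, Function.update id a b a = Function.update id a b b := by
      intro a b
      by_cases h : b = a
      · rw [h]
      · simp [Function.update_of_ne h]
    rintro (_ | _)
    · simp only [merge, Function.comp_apply]
      rw [upd (C.label (.inl (false, bcDart hl)))]
    · simp only [merge, Function.comp_apply]
      rw [upd (Function.update id _ _ (C.label (.inl (true, bcDart hl))))]
  obtain ⟨s, rfl | rfl⟩ := (not_kept_iff hl).1 ht
  · exact (key s).symm
  · rw [rev, Dart.symm_symm]
    exact key s

lemma card_range_merge (hl : F.Local) :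
    Nat.card C.Label ≤ Nat.card (Set.range (C.merge hl)) + 2 := by
  classical
  have h1 := card_range_update_comp (id : C.Label → C.Label)
    (C.label (.inl (false, bcDart hl))) (C.label (.inl (false, (bcDart hl).symm)))
  rw [Function.comp_id, Set.range_id, Nat.card_coe_set_eq, Set.ncard_univ] at h1
  have h2 := card_range_update_comp (Function.update id (C.label (.inl (false, bcDart hl)))
    (C.label (.inl (false, (bcDart hl).symm))))
    (Function.update id (C.label (.inl (false, bcDart hl)))
      (C.label (.inl (false, (bcDart hl).symm))) (C.label (.inl (true, bcDart hl))))
    (Function.update id (C.label (.inl (false, bcDart hl)))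
      (C.label (.inl (false, (bcDart hl).symm))) (C.label (.inl (true, (bcDart hl).symm))))
  rw [merge]
  omega

/-- Turning past a removed dart enters the face on the other side of its edge, and `merge` has
identified the two sides. -/
lemma merge_label_next (hl : F.Local) {t : Darts F} (ht : ¬ Kept t) :
    C.merge hl (C.label (C.next t)) = C.merge hl (C.label t) := by
  rw [← rev_rev t, label_next_rev, rev_rev, C.merge_label_rev hl ht]

/-- Both ends of a removed edge retain darts, since b has an edge of colour 2 and c one of colour 3.
-/
lemma exists_kept (h : F.IsSuitable) (t : Darts F) :
    ∃ k, Kept (C.next^[k] t) ∧ ∀ m < k, ¬ Kept (C.next^[m] t) := by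
  have hl := h.local
  refine exists_first_iterate ?_
  by_cases ht : Kept t
  · exact ⟨t, ht, .refl _ _⟩
  have key : ∀ s v k, v = F.b ∨ v = F.c → k ≠ 1 → HasCol F.graph F.col v k → ∀ t : Darts F,
      vert t = F.side s v → ∃ t', Kept t' ∧ C.next.SameCycle t t' := by
    rintro s v k hv hk ⟨w, hw, rfl⟩ t ht
    refine ⟨.inl (s, ⟨(v, w), hw⟩), fun he => hk ?_, C.sameCycle_of_vert_eq _ _ ht⟩
    have he : s(v, w) = s(F.b, F.c) := he
    rw [he, hl.col_bc]
  obtain ⟨s, rfl | rfl⟩ := (not_kept_iff hl).1 ht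
  · exact key s F.b 2 (by simp) (by decide) ((h.hasCol.2.1 2).2 (by simp)) _ rfl
  · exact key s F.c 3 (by simp) (by decide) ((h.hasCol.2.2.1 3).2 (by simp)) _ rfl

lemma card_kept (hl : F.Local) :
    Nat.card {t : Darts F // Kept t} + 4 ≤ 4 * Nat.card F.graph.edgeSet + 2 := by
  classical
  have h1 : Nat.card (Darts F) = 2 * (2 * Nat.card F.graph.edgeSet) + 2 := by
    rw [Nat.card_sum, Nat.card_prod, RotationSystem.card_dart]
    simp
  have h2 : Nat.card {t : Darts F // Kept t} + Nat.card {t : Darts F // ¬ Kept t} =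
      Nat.card (Darts F) := by
    rw [← Nat.card_sum]
    exact Nat.card_congr (Equiv.sumCompl _)
  have h3 : Nat.card (Bool × Bool) ≤ Nat.card {t : Darts F // ¬ Kept t} := by
    refine Nat.card_le_card_of_injective (fun x => ⟨.inl (x.1, if x.2 then bcDart hl
      else (bcDart hl).symm), (not_kept_iff hl).2 ⟨x.1, ?_⟩⟩) ?_
    · cases x.2 <;> simp
    · rintro ⟨s, u⟩ ⟨s', u'⟩ h
      have h4 := (bcDart hl).symm_ne
      simp only [Subtype.mk.injEq, Sum.inl.injEq, Prod.mk.injEq] at h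
      obtain ⟨rfl, h⟩ := h
      cases u <;> cases u' <;> simp_all [eq_comm]
  rw [Nat.card_prod, Nat.card_eq_fintype_card, Fintype.card_bool] at h3
  omega

lemma card_divorceV : 2 * Nat.card F.V = Nat.card F.DivorceV + 4 := by
  have h2 : Nat.card {v : F.V // v ∈ F.ends} + Nat.card {v : F.V // v ∉ F.ends} =
      Nat.card F.V := by
    rw [← Nat.card_sum]
    exact Nat.card_congr (Equiv.sumCompl _)
  have h3 : Nat.card {v : F.V // v ∈ F.ends} = 4 := by
    have hne := F.distinct
    rw [Nat.card_eq_fintype_card, Fintype.card_coe]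
    simp [ends, hne]
  rw [DivorceV, Nat.card_sum]
  omega

/-- Before the deletion there are 2|V| - 4 vertices, 2|E| + 1 edges and 2(|F| - 1) + 5 labels, which
satisfies Euler's formula. Deleting two edges loses at most two labels, so enough remain to force
genus 0. -/
lemma isPlane_combMap (h : F.IsSuitable) :
    (C.combMap h.local).rot.IsPlane ∧ ∃ t : {t : Darts F // Kept t},
      (C.combMap h.local).rot.facePerm.SameCycle ((C.combMap h.local).dart t)
        ((C.combMap h.local).dart ⟨exch t.1, (kept_exch _).2 t.2⟩) := by
  have hl := h.local
  let L : {t : Darts F // Kept t} → Set.range (C.merge hl) :=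
    fun t => ⟨C.merge hl (C.label t.1), _, rfl⟩
  have hcard : Nat.card {t : Darts F // Kept t} + 4 ≤
      2 * Nat.card F.DivorceV + 2 * Nat.card (Set.range (C.merge hl)) := by
    have h1 := card_kept hl
    have h2 := card_divorceV (F := F)
    have h3 := C.card_range_merge hl
    have h4 := (RotationSystem.isPlane_iff_of_connected h.connected F.rot).1 F.isPlane
    have h5 : Nat.card C.Label = 2 * (Nat.card F.rot.Face - 1) + 5 := by
      classical
      rw [Nat.card_sum, Nat.card_prod]
      have : Nat.card {q : F.rot.Face // q ≠ C.outer} = Nat.card F.rot.Face - 1 := by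
        have h : Nat.card {q : F.rot.Face // q = C.outer} +
            Nat.card {q : F.rot.Face // q ≠ C.outer} = Nat.card F.rot.Face := by
          rw [← Nat.card_sum]
          exact Nat.card_congr (Equiv.sumCompl _)
        rw [Nat.card_unique] at h
        omega
      rw [this]
      simp
    have h6 : 0 < Nat.card F.rot.Face := Nat.card_pos_iff.2 ⟨⟨C.outer⟩, inferInstance⟩
    omega
  obtain ⟨h1, h2⟩ := (C.combMap hl).isPlane_of_label h.connected_divorce L (fun t => by
      refine Subtype.ext ((label_firstReturn (N := fun t => C.merge hl (C.label t))
        (fun t => C.merge_label_next hl) _).trans ?_)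
      change C.merge hl (C.label (C.next (rev t.1))) = C.merge hl (C.label t.1)
      rw [label_next_rev])
    (by
      rintro ⟨_, l, rfl⟩
      obtain ⟨t, rfl⟩ := C.label_surjective l
      obtain ⟨k, h1, h2⟩ := C.exists_kept h t
      exact ⟨⟨_, h1⟩, Subtype.ext (label_iterate_of_forall_not
        (N := fun t => C.merge hl (C.label t)) (fun t => C.merge_label_next hl) h2)⟩)
    hcard
  refine ⟨h1, ?_⟩
  -- The label `none` is common to both copies, so the first kept dart from `xk` and its image under
  -- the exchange have the same merged label and therefore lie on the same facial walk.
  obtain ⟨k, h3, h4⟩ := C.exists_kept h (.inl (false, C.xk))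
  refine ⟨⟨_, h3⟩, h2 _ _ (Subtype.ext ?_)⟩
  have h5 : ∀ n t, C.next^[n] (exch t) = exch (C.next^[n] t) := fun n =>
    Function.Commute.iterate_left (f := C.next) (g := exch) C.next_exch n
  have h6 : ∀ t, ¬ Kept t → C.merge hl (C.label (C.next t)) = C.merge hl (C.label t) :=
    fun t => C.merge_label_next hl
  have h7 := label_iterate_of_forall_not (N := fun t => C.merge hl (C.label t)) h6 h4
  have h8 := label_iterate_of_forall_not (N := fun t => C.merge hl (C.label t)) (k := k)
    (t := exch (.inl (false, C.xk))) h6 fun m hm => by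
      rw [h5, kept_exch]
      exact h4 m hm
  simp only [h5] at h8
  refine h7.trans (Eq.trans ?_ h8.symm)
  simp only [exch, label_xk]

end Facial

lemma IsSuitable.isRotationalSymmetry (h : F.IsSuitable) :
    IsRotationalSymmetry F.divorce F.exchIso := by
  obtain ⟨C⟩ := h.nonempty_facial
  obtain ⟨h1, t, ht⟩ := C.isPlane_combMap h
  have key : ∀ t, F.exchIso.toHom.mapDart ((C.combMap h.local).dart t) =
      (C.combMap h.local).dart ⟨Facial.exch t.1, (Facial.kept_exch _).2 t.2⟩ := by
    intro t
    refine Dart.ext _ _ (Prod.ext ?_ ?_)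
    · exact (Facial.vert_exch t.1).symm
    · change F.exchIso (Facial.vert (Facial.rev t.1)) = Facial.vert (Facial.rev (Facial.exch t.1))
      rw [Facial.rev_exch, Facial.vert_exch]
  refine ⟨h.connected_divorce, ⟨F.side false F.a, ?_⟩, (C.combMap h.local).rot, h1, fun x => ?_,
    (C.combMap h.local).dart t, ?_⟩
  · rw [exchIso_side, side_a, Ne, side_inj]
    exact F.distinct.2.2.1.symm
  · obtain ⟨t, rfl⟩ := (C.combMap h.local).dart.surjective x
    rw [key, CombMap.rot_next, CombMap.rot_next, key]
    congr 1
    exact Subtype.ext (firstReturn_commute C.next_exch Facial.kept_exch t)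
  · rw [key]
    exact ht

end Fragment

/-- The path described by a list of vertices. -/
lemma Spans.of_list {V : Type*} {H : SimpleGraph V} {x : V} {l : List V}
    (hc : List.IsChain H.Adj (x :: l)) (hn : (x :: l).Nodup) :
    Spans H x ((x :: l).getLast (List.cons_ne_nil _ _)) {v | v ∈ x :: l} := by
  induction l generalizing x with
  | nil => exact (Spans.single x).cast (by ext; simp)
  | cons y l ih =>
    rw [List.isChain_cons_cons] at hc
    rw [List.nodup_cons] at hn
    rw [List.getLast_cons (List.cons_ne_nil _ _)]
    exact (Spans.cons hc.1 hn.1 (ih hc.2 hn.2)).cast (by ext; simp)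

/-! ### Coloured plane graphs from lists of darts -/

/-- The darts `T` of an edge-coloured graph with vertices `V`, with rotation `σ` and
reversal `α`. -/
structure CMap (V T : Type) where
  vert : T → V
  σ : T → T
  α : T → T
  col : T → Fin 5
  α_α : ∀ t, α (α t) = t
  col_α : ∀ t, col (α t) = col t
  vert_α_ne : ∀ t, vert (α t) ≠ vert t
  inj : ∀ t t', vert t = vert t' → vert (α t) = vert (α t') → t = t'
  proper : ∀ t t', vert t = vert t' → col t = col t' → t = t'
  vert_σ : ∀ t, vert (σ t) = vert t
  orbit : ∀ t t', vert t = vert t' → ∃ n, σ^[n] t = t'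

namespace CMap

variable {V T : Type} (C : CMap V T)

/-- The underlying graph. -/
def graph : SimpleGraph V where
  Adj p q := ∃ t, C.vert t = p ∧ C.vert (C.α t) = q
  symm := ⟨by
    rintro p q ⟨t, rfl, rfl⟩
    exact ⟨C.α t, rfl, by rw [C.α_α]⟩⟩
  loopless := ⟨by
    rintro p ⟨t, rfl, h⟩
    exact C.vert_α_ne t h⟩

lemma adj_vert (t : T) : C.graph.Adj (C.vert t) (C.vert (C.α t)) := ⟨t, rfl, rfl⟩

/-- The orbit condition leads from `σ t` back to `t`, so `t` is a value of `σ`. -/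
lemma σ_bijective [Finite T] : Function.Bijective C.σ := by
  rw [← Finite.surjective_iff_bijective]
  intro t
  obtain ⟨n, hn⟩ := C.orbit (C.σ t) t (C.vert_σ t)
  exact ⟨_, by rwa [← Function.iterate_succ_apply, Function.iterate_succ_apply'] at hn⟩

/-- The description of the darts of the graph. -/
noncomputable def combMap [Finite T] : CombMap C.graph T where
  vert := C.vert
  σ := Equiv.ofBijective C.σ C.σ_bijective
  α := C.α
  α_α := C.α_α
  adj := C.adj_vert
  inj := C.inj
  surj _ _ h := h
  vert_σ := C.vert_σ
  sameCycle_σ t t' h := by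
    obtain ⟨n, hn⟩ := C.orbit t t' h
    refine ⟨n, ?_⟩
    rw [zpow_natCast, ← Equiv.Perm.iterate_eq_pow]
    exact hn

open Classical in
/-- The colouring of the edges. -/
noncomputable def edgeCol (e : Sym2 V) : Fin 5 :=
  if h : ∃ t, s(C.vert t, C.vert (C.α t)) = e then C.col h.choose else 0

lemma edgeCol_vert (t : T) : C.edgeCol s(C.vert t, C.vert (C.α t)) = C.col t := by
  have h : ∃ t', s(C.vert t', C.vert (C.α t')) = s(C.vert t, C.vert (C.α t)) := ⟨t, rfl⟩
  rw [edgeCol, dif_pos h]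
  rcases Sym2.eq_iff.1 h.choose_spec with ⟨h1, h2⟩ | ⟨h1, h2⟩
  · rw [C.inj _ _ h1 h2]
  · rw [C.inj _ (C.α t) h1 (by rw [h2, C.α_α]), C.col_α]

lemma isProper : IsProperEdgeColouring C.graph C.edgeCol := by
  rintro u v w ⟨t, rfl, rfl⟩ ⟨t', h, rfl⟩ hvw hcol
  have h1 := C.edgeCol_vert t'
  rw [h] at h1
  rw [C.edgeCol_vert, h1] at hcol
  exact hvw (by rw [C.proper t t' h.symm hcol])

lemma biGraph_adj_vert {i j : Fin 5} {t : T} (h : C.col t = i ∨ C.col t = j) :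
    (biGraph C.graph C.edgeCol i j).Adj (C.vert t) (C.vert (C.α t)) :=
  ⟨C.adj_vert t, by rwa [edgeCol_vert]⟩

lemma card_neighborSet (v : V) :
    Nat.card (C.graph.neighborSet v) = Nat.card {t // C.vert t = v} := by
  refine (Nat.card_congr (Equiv.ofBijective (fun t : {t // C.vert t = v} =>
    (⟨C.vert (C.α t.1), t.1, t.2, rfl⟩ : C.graph.neighborSet v)) ⟨?_, ?_⟩)).symm
  · intro t t' h
    exact Subtype.ext (C.inj _ _ (t.2.trans t'.2.symm) (congrArg Subtype.val h))
  · rintro ⟨w, t, rfl, rfl⟩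
    exact ⟨⟨t, rfl⟩, rfl⟩

lemma facePerm_iterate [Finite T] (n : ℕ) (t : T) :
    C.combMap.rot.facePerm^[n] (C.combMap.dart t) =
      C.combMap.dart ((fun t => C.σ (C.α t))^[n] t) := by
  rw [Equiv.Perm.iterate_eq_pow]
  exact C.combMap.rot_facePerm_pow n t

lemma minimalPeriod_facePerm [Finite T] (t : T) :
    Function.minimalPeriod C.combMap.rot.facePerm (C.combMap.dart t) =
      Function.minimalPeriod (fun t => C.σ (C.α t)) t := by
  rw [Function.minimalPeriod_eq_minimalPeriod_iff]
  intro n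
  rw [Function.IsPeriodicPt, Function.IsFixedPt, facePerm_iterate, EmbeddingLike.apply_eq_iff_eq]
  rfl

/-- A plane coloured graph with four distinguished vertices as a fragment. -/
noncomputable abbrev fragment [Fintype V] [DecidableEq V] [Finite T] (hp : C.combMap.rot.IsPlane)
    (a b c d : V) (h : [a, b, c, d].Nodup) : Fragment where
  V := V
  graph := C.graph
  rot := C.combMap.rot
  isPlane := hp
  a := a
  b := b
  c := c
  d := d
  nodup := h
  col := C.edgeCol

end CMap

/-! ### A perfectly hamiltonian planar quintic graph with one vertex removed -/

namespace Gadget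

/-- The end of the edge of colour `c` at the vertex `k`, where `19` is the removed vertex. -/
def tgtTable : List (List ℕ) :=
  [[19, 17, 4, 6, 1],
  [2, 19, 6, 14, 0],
  [1, 5, 19, 11, 14],
  [4, 11, 16, 19, 8],
  [3, 16, 0, 17, 19],
  [14, 2, 10, 13, 11],
  [13, 14, 1, 0, 17],
  [9, 15, 18, 10, 12],
  [16, 9, 11, 18, 3],
  [7, 8, 15, 16, 18],
  [12, 18, 5, 7, 13],
  [18, 3, 8, 2, 5],
  [10, 13, 17, 15, 7],
  [6, 12, 14, 5, 10],
  [5, 6, 13, 1, 2],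
  [17, 7, 9, 12, 16],
  [8, 4, 3, 9, 15],
  [15, 0, 12, 4, 6],
  [11, 10, 7, 8, 9]]

/-- The colour that follows the colour `c` in the rotation at the vertex `k`. -/
def nxTable : List (List ℕ) :=
  [[4, 2, 0, 1, 3],
  [3, 0, 4, 2, 1],
  [2, 4, 3, 1, 0],
  [2, 3, 4, 0, 1],
  [4, 0, 3, 1, 2],
  [1, 4, 3, 0, 2],
  [4, 0, 1, 2, 3],
  [1, 4, 0, 2, 3],
  [1, 3, 4, 2, 0],
  [4, 3, 0, 2, 1],
  [4, 3, 1, 0, 2],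
  [4, 2, 0, 1, 3],
  [4, 0, 1, 2, 3],
  [2, 0, 3, 4, 1],
  [2, 3, 1, 4, 0],
  [3, 2, 4, 1, 0],
  [2, 4, 1, 0, 3],
  [3, 4, 0, 1, 2],
  [3, 0, 1, 4, 2]]

/-- The faces; those with a number less than `5` contain the removed vertex. -/
def faceTable : List (List ℕ) :=
  [[0, 5, 6, 7, 1],
  [2, 1, 8, 9, 7],
  [9, 10, 2, 3, 11],
  [4, 12, 13, 3, 14],
  [13, 15, 0, 6, 4],
  [16, 11, 17, 18, 10],
  [19, 8, 7, 5, 20],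
  [21, 22, 23, 24, 25],
  [14, 26, 27, 28, 12],
  [22, 28, 29, 26, 21],
  [24, 17, 18, 23, 30],
  [27, 3, 12, 10, 17],
  [30, 20, 31, 25, 24],
  [20, 30, 19, 16, 18],
  [11, 19, 16, 8, 9],
  [15, 25, 22, 31, 29],
  [26, 13, 14, 29, 15],
  [31, 6, 20, 15, 5],
  [17, 23, 21, 27, 28]]

/-- An entry of a table. -/
def entry (t : List (List ℕ)) (k : Fin 19) (c : Fin 5) : ℕ := (t.getD k []).getD c 0

def tgt (k : Fin 19) (c : Fin 5) : Option (Fin 19) :=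
  if h : entry tgtTable k c < 19 then some ⟨_, h⟩ else none

def nx (k : Fin 19) (c : Fin 5) : Fin 5 := Fin.ofNat 5 (entry nxTable k c)

def face (k : Fin 19) (c : Fin 5) : Fin 5 ⊕ Fin 27 :=
  if entry faceTable k c < 5 then .inl (Fin.ofNat 5 (entry faceTable k c))
  else .inr (Fin.ofNat 27 (entry faceTable k c - 5))

/-- The neighbours of the removed vertex. -/
def ext (i : Fin 5) : Fin 19 := Fin.castLE (by decide) i

lemma ext_injective : Function.Injective ext := Fin.castLE_injective (by decide)

lemma tgt_ext (i : Fin 5) : tgt (ext i) i = none := by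
  revert i
  decide +kernel

lemma tgt_symm {k k' : Fin 19} {c : Fin 5} (h : tgt k c = some k') : tgt k' c = some k := by
  revert k k' c
  decide +kernel

lemma eq_ext {k : Fin 19} {c : Fin 5} (h : tgt k c = none) : k = ext c := by
  revert k c
  decide +kernel

lemma tgt_ne {k : Fin 19} {c : Fin 5} : tgt k c ≠ some k := by
  revert k c
  decide +kernel

lemma eq_of_tgt_eq {k k' : Fin 19} {c c' : Fin 5} (h : tgt k c = some k')
    (h' : tgt k c' = some k') : c = c' := by
  have : ∀ k c c', tgt k c = tgt k c' → c = c' := by decide +kernel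
  exact this k c c' (h.trans h'.symm)

lemma nx_orbit (k : Fin 19) (c c' : Fin 5) : ∃ n : Fin 5, (nx k)^[n] c = c' := by
  revert k c c'
  decide +kernel

lemma face_nx {k k' : Fin 19} {c : Fin 5} (h : tgt k c = some k') :
    face k' (nx k' c) = face k c := by
  have : ∀ k c, ∀ k' ∈ tgt k c, face k' (nx k' c) = face k c := by decide +kernel
  exact this k c k' h

/-- With `face_nx_ext`, this says that the faces `i` and `i + 1` lie on the two sides of the edge
from the removed vertex to `ext i`. They will be identified with the old faces around the replaced
vertex. -/
lemma face_ext (i : Fin 5) : face (ext i) i = .inl i := by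
  revert i
  decide +kernel

lemma face_nx_ext (i : Fin 5) : face (ext i) (nx (ext i) i) = .inl (i + 1) := by
  revert i
  decide +kernel

lemma exists_face (q : Fin 27) : ∃ k c, face k c = .inr q := by
  revert q
  decide +kernel

/-- The subgraph formed by two colours. -/
def biGraph (i j : Fin 5) : SimpleGraph (Fin 19) where
  Adj k k' := tgt k i = some k' ∨ tgt k j = some k'
  symm := ⟨fun _ _ h => h.imp tgt_symm tgt_symm⟩
  loopless := ⟨fun _ h => h.elim tgt_ne tgt_ne⟩

instance (i j : Fin 5) : DecidableRel (biGraph i j).Adj := fun k k' =>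
  inferInstanceAs (Decidable (tgt k i = some k' ∨ tgt k j = some k'))

/-- The path from `k` with edges coloured alternately `c`, `c'`. -/
def follow : ℕ → Fin 19 → Fin 5 → Fin 5 → List (Fin 19)
  | 0, _, _, _ => []
  | n + 1, k, c, c' => match tgt k c with
    | none => []
    | some k' => k' :: follow n k' c' c

/-- These are the hamiltonian cycles in two colours with the removed vertex cut out; the tables are
checked by computation. -/
lemma spans (i j : Fin 5) (hij : i ≠ j) : Spans (biGraph i j) (ext i) (ext j) Set.univ := by
  -- The path starts with colour `j`, as the edge of colour `i` at `ext i` led to the removed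
  -- vertex; 18 further vertices complete the 19.
  have h : ∀ i j : Fin 5, i ≠ j → List.IsChain (biGraph i j).Adj (ext i :: follow 18 (ext i) j i) ∧
      (ext i :: follow 18 (ext i) j i).Nodup ∧
      (ext i :: follow 18 (ext i) j i).getLast (List.cons_ne_nil _ _) = ext j ∧
      ∀ k, k ∈ ext i :: follow 18 (ext i) j i := by decide +kernel
  obtain ⟨h1, h2, h3, h4⟩ := h i j hij
  exact h3 ▸ (Spans.of_list h1 h2).cast (Set.eq_univ_of_forall h4)

end Gadget

lemma Spans.connected {V : Type*} {H G : SimpleGraph V} {x y : V}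
    (h : Spans H x y Set.univ) (hG : H ≤ G) : G.Connected := by
  obtain ⟨p, -, h2, -⟩ := h.exists_walk hG
  have : Nonempty V := ⟨x⟩
  classical
  have hx : ∀ v, G.Reachable x v := fun v => ⟨p.takeUntil v ((h2 v).2 trivial)⟩
  exact ⟨fun u v => (hx u).symm.trans (hx v)⟩

namespace Fragment

variable {F : Fragment}

/-! ### Replacing a vertex by the gadget -/

/-- A vertex of degree `5` together with the cyclic order of the darts leaving it. -/
structure Site (F : Fragment) where
  v : F.V
  notMem_ends : v ∉ F.ends
  dart : Fin 5 → F.graph.Dart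
  dart_fst : ∀ i, (dart i).fst = v
  dart_injective : Function.Injective dart
  exists_dart : ∀ y : F.graph.Dart, y.fst = v → ∃ i, dart i = y
  next_dart : ∀ i, F.rot.next (dart i) = dart (i + 1)

lemma card_dart_fst (v : F.V) :
    Nat.card (F.graph.neighborSet v) = Nat.card {y : F.graph.Dart // y.fst = v} :=
  Nat.card_congr ⟨fun w => ⟨⟨(v, w.1), w.2⟩, rfl⟩,
    fun y => ⟨y.1.snd, by obtain ⟨y, rfl⟩ := y; exact y.adj⟩,
    fun _ => rfl, by rintro ⟨y, rfl⟩; rfl⟩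

lemma IsSuitable.card_neighborSet (h : F.IsSuitable) (v : F.V) :
    Nat.card (F.graph.neighborSet v) = if v = F.d then 2 else if v ∈ F.ends then 3 else 5 := by
  classical
  rw [Nat.card_eq_fintype_card, card_neighborSet_eq_degree]
  split_ifs with h1 h2
  · rw [h1, h.degree_d]
  · rcases mem_ends.1 h2 with rfl | rfl | rfl | rfl
    exacts [h.degree_a, h.degree_b, h.degree_c, absurd rfl h1]
  · exact h.degree_of_notMem v h2

/-- The rotation at `v` is a single cycle through its five darts, so iterating it from one dart
numbers them modulo 5. -/
lemma IsSuitable.exists_site (h : F.IsSuitable) {v : F.V} (hv : v ∉ F.ends) :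
    ∃ S : F.Site, S.v = v := by
  have hcard : Nat.card {y : F.graph.Dart // y.fst = v} = 5 := by
    rw [← card_dart_fst, h.card_neighborSet, if_neg (fun h => hv (by simp [h, ends])), if_neg hv]
  obtain ⟨y, hy⟩ : Nonempty {y : F.graph.Dart // y.fst = v} :=
    (Nat.card_pos_iff.1 (by omega)).1
  have hfst : ∀ n, (F.rot.next^[n] y).fst = v := by
    intro n
    induction n with
    | zero => exact hy
    | succ n ih => rw [Function.iterate_succ_apply', F.rot.next_fst, ih]
  have hpos : 0 < Function.minimalPeriod F.rot.next y :=
    Function.minimalPeriod_pos_of_mem_periodicPts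
      (Function.mem_periodicPts.2 ⟨orderOf F.rot.next, orderOf_pos _, by
        rw [Function.IsPeriodicPt, Equiv.Perm.iterate_eq_pow, pow_orderOf_eq_one]
        rfl⟩)
  have hsurj : ∀ z : F.graph.Dart, z.fst = v →
      ∃ n < Function.minimalPeriod F.rot.next y, F.rot.next^[n] y = z := by
    intro z hz
    obtain ⟨n, hn⟩ := (F.rot.sameCycle_next y z (hy.trans hz.symm)).exists_nat_pow_eq
    rw [← Equiv.Perm.iterate_eq_pow] at hn
    exact ⟨n % _, Nat.mod_lt _ hpos, by rwa [Function.iterate_mod_minimalPeriod_eq]⟩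
  have h5 : Function.minimalPeriod F.rot.next y = 5 := by
    rw [← hcard, ← Nat.card_fin (Function.minimalPeriod F.rot.next y)]
    refine Nat.card_congr (Equiv.ofBijective (fun n => ⟨F.rot.next^[n.1] y, hfst n⟩) ⟨?_, ?_⟩)
    · intro m n hmn
      exact Fin.ext (Function.iterate_injOn_Iio_minimalPeriod m.2 n.2 (congrArg Subtype.val hmn))
    · rintro ⟨z, hz⟩
      obtain ⟨n, hn, rfl⟩ := hsurj z hz
      exact ⟨⟨n, hn⟩, rfl⟩
  rw [h5] at hsurj
  refine ⟨⟨v, hv, fun i => F.rot.next^[i.1] y, fun i => hfst i, fun m n hmn => ?_, fun z hz => ?_,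
    fun i => ?_⟩, rfl⟩
  · exact Fin.ext (Function.iterate_injOn_Iio_minimalPeriod (h5.symm ▸ m.2) (h5.symm ▸ n.2) hmn)
  · obtain ⟨n, hn, rfl⟩ := hsurj z hz
    exact ⟨⟨n, hn⟩, rfl⟩
  · rw [← Function.iterate_succ_apply' F.rot.next, Fin.val_add]
    have h6 := Function.iterate_mod_minimalPeriod_eq (f := F.rot.next) (x := y) (n := i.1 + 1)
    rw [h5] at h6
    exact h6.symm

namespace Site

variable (S : F.Site)

/-- The vertices after the replacement. -/
abbrev Vert : Type := {u : F.V // u ≠ S.v} ⊕ Fin 19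

/-- The darts after the replacement. -/
abbrev Darts : Type := {y : F.graph.Dart // y.fst ≠ S.v} ⊕ (Fin 19 × Fin 5)

lemma dart_snd_ne (i : Fin 5) : (S.dart i).snd ≠ S.v := fun h =>
  (S.dart i).fst_ne_snd ((S.dart_fst i).trans h.symm)

/-- The dart of the old graph that points towards the removed vertex. -/
def inward (i : Fin 5) : {y : F.graph.Dart // y.fst ≠ S.v} := ⟨(S.dart i).symm, S.dart_snd_ne i⟩

lemma inward_injective : Function.Injective S.inward := fun _ _ h =>
  S.dart_injective (Dart.symm_involutive.injective (congrArg Subtype.val h))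

lemma exists_inward (y : {y : F.graph.Dart // y.fst ≠ S.v}) (hy : y.1.snd = S.v) :
    ∃ i, S.inward i = y := by
  obtain ⟨i, hi⟩ := S.exists_dart y.1.symm hy
  exact ⟨i, Subtype.ext ((congrArg Dart.symm hi).trans (Dart.symm_symm _))⟩

/-- The colour of an edge at the removed vertex. -/
def colour (i : Fin 5) : Fin 5 := F.col (S.dart i).edge

/-- The start of a dart. -/
def vert : S.Darts → S.Vert
  | .inl y => .inl ⟨y.1.fst, y.2⟩
  | .inr (k, _) => .inr k

/-- The rotation. -/
def next : S.Darts → S.Darts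
  | .inl y => .inl ⟨F.rot.next y.1, by rw [F.rot.next_fst]; exact y.2⟩
  | .inr (k, c) => .inr (k, Gadget.nx k c)

open Classical in
/-- Reversal. -/
noncomputable def rev : S.Darts → S.Darts
  | .inl y => if h : y.1.snd = S.v then
      .inr (Gadget.ext (S.exists_inward y h).choose, (S.exists_inward y h).choose)
    else .inl ⟨y.1.symm, h⟩
  | .inr (k, c) => match Gadget.tgt k c with
    | none => .inl (S.inward c)
    | some k' => .inr (k', c)

/-- The colour of a dart. -/
def dartCol : S.Darts → Fin 5
  | .inl y => F.col y.1.edge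
  | .inr (_, c) => S.colour c

lemma rev_inl {y : F.graph.Dart} (h : y.fst ≠ S.v) (h' : y.snd ≠ S.v) :
    S.rev (.inl ⟨y, h⟩) = .inl ⟨y.symm, h'⟩ := dif_neg h'

lemma rev_inward (i : Fin 5) : S.rev (.inl (S.inward i)) = .inr (Gadget.ext i, i) := by
  have h : (S.inward i).1.snd = S.v := S.dart_fst i
  have h1 := S.inward_injective (S.exists_inward _ h).choose_spec
  rw [rev, dif_pos h, h1]

lemma rev_ext (i : Fin 5) : S.rev (.inr (Gadget.ext i, i)) = .inl (S.inward i) := by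
  rw [rev, Gadget.tgt_ext]

lemma rev_inr {k k' : Fin 19} {c : Fin 5} (h : Gadget.tgt k c = some k') :
    S.rev (.inr (k, c)) = .inr (k', c) := by
  rw [rev, h]

lemma darts_cases {P : S.Darts → Prop}
    (h1 : ∀ (y : F.graph.Dart) (h : y.fst ≠ S.v), y.snd ≠ S.v → P (.inl ⟨y, h⟩))
    (h2 : ∀ i, P (.inl (S.inward i))) (h3 : ∀ i, P (.inr (Gadget.ext i, i)))
    (h4 : ∀ k k' c, Gadget.tgt k c = some k' → P (.inr (k, c))) (t : S.Darts) : P t := by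
  rcases t with y | ⟨k, c⟩
  · by_cases h : y.1.snd = S.v
    · obtain ⟨i, rfl⟩ := S.exists_inward y h
      exact h2 i
    · exact h1 _ _ h
  · rcases h : Gadget.tgt k c with _ | k'
    · rw [Gadget.eq_ext h]
      exact h3 c
    · exact h4 k k' c h

lemma colour_injective (hF : IsProperEdgeColouring F.graph F.col) :
    Function.Injective S.colour := by
  intro i j h
  have h1 : ∀ i, (S.dart i).edge = s(S.v, (S.dart i).snd) := fun i => by rw [← S.dart_fst i]; rfl
  rw [colour, colour, h1, h1] at h
  have h2 : ∀ i, F.graph.Adj S.v (S.dart i).snd := fun i => by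
    rw [← S.dart_fst i]
    exact (S.dart i).adj
  refine S.dart_injective (Dart.ext _ _ (Prod.ext ?_ (hF.eq_of_col_eq (h2 i) (h2 j) h)))
  exact (S.dart_fst i).trans (S.dart_fst j).symm

variable (hF : IsProperEdgeColouring F.graph F.col)

/-- The coloured plane graph after the replacement. -/
noncomputable def cmap : CMap S.Vert S.Darts where
  vert := S.vert
  σ := S.next
  α := S.rev
  col := S.dartCol
  α_α := S.darts_cases (fun y h h' => by rw [rev_inl S h h', rev_inl S h' h]; rfl)
    (fun i => by rw [rev_inward, rev_ext]) (fun i => by rw [rev_ext, rev_inward])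
    (fun k k' c h => by rw [rev_inr S h, rev_inr S (Gadget.tgt_symm h)])
  col_α := S.darts_cases (fun y h h' => by
      rw [rev_inl S h h']; exact congrArg F.col (Dart.edge_symm y))
    (fun i => by rw [rev_inward]; exact congrArg F.col (Dart.edge_symm _).symm)
    (fun i => by rw [rev_ext]; exact congrArg F.col (Dart.edge_symm _))
    (fun k k' c h => by rw [rev_inr S h]; rfl)
  vert_α_ne := S.darts_cases (fun y h h' e => by
      rw [rev_inl S h h'] at e
      exact y.fst_ne_snd (congrArg Subtype.val (Sum.inl_injective e)).symm)
    (fun i => by rw [rev_inward]; exact Sum.inr_ne_inl)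
    (fun i => by rw [rev_ext]; exact Sum.inl_ne_inr)
    (fun k k' c h e => by
      rw [rev_inr S h] at e
      have e : k' = k := Sum.inr_injective e
      exact Gadget.tgt_ne (e ▸ h))
  inj := by
    refine S.darts_cases (fun y h h' => ?_) (fun i => ?_) (fun i => ?_) (fun k k' c h => ?_) <;>
    refine S.darts_cases (fun z h1 h1' => ?_) (fun j => ?_) (fun j => ?_)
      (fun l l' c' h1 => ?_) <;>
    intro e e'
    all_goals first | exact absurd e Sum.inl_ne_inr | exact absurd e Sum.inr_ne_inl | skip
    · rw [rev_inl S h h', rev_inl S h1 h1'] at e'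
      have e := congrArg Subtype.val (Sum.inl_injective e)
      have e' := congrArg Subtype.val (Sum.inl_injective e')
      exact congrArg Sum.inl (Subtype.ext (Dart.ext _ _ (Prod.ext e e')))
    · rw [rev_inl S h h', rev_inward] at e'
      exact absurd e' Sum.inl_ne_inr
    · rw [rev_inl S h1 h1', rev_inward] at e'
      exact absurd e' Sum.inr_ne_inl
    · rw [rev_inward, rev_inward] at e'
      rw [Gadget.ext_injective (Sum.inr_injective e')]
    · rw [Gadget.ext_injective (Sum.inr_injective e)]
    · rw [rev_ext, rev_inr S h1] at e'
      exact absurd e' Sum.inl_ne_inr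
    · rw [rev_ext, rev_inr S h] at e'
      exact absurd e' Sum.inr_ne_inl
    · rw [rev_inr S h, rev_inr S h1] at e'
      have e : k = l := Sum.inr_injective e
      have e' : k' = l' := Sum.inr_injective e'
      subst e e'
      rw [Gadget.eq_of_tgt_eq h h1]
  proper := by
    rintro (y | ⟨k, c⟩) (z | ⟨l, c'⟩) e e'
    · have e : y.1.fst = z.1.fst := congrArg Subtype.val (Sum.inl_injective e)
      have e' : F.col s(y.1.fst, y.1.snd) = F.col s(z.1.fst, z.1.snd) := e'
      rw [← e] at e'
      refine congrArg Sum.inl (Subtype.ext (Dart.ext _ _ (Prod.ext e ?_)))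
      exact hF.eq_of_col_eq y.1.adj (e ▸ z.1.adj) e'
    · exact absurd e Sum.inl_ne_inr
    · exact absurd e Sum.inr_ne_inl
    · have e : k = l := Sum.inr_injective e
      have e' : c = c' := S.colour_injective hF e'
      rw [e, e']
  vert_σ := by
    rintro (y | ⟨k, c⟩)
    · exact congrArg Sum.inl (Subtype.ext (F.rot.next_fst y.1))
    · rfl
  orbit := by
    rintro (y | ⟨k, c⟩) (z | ⟨l, c'⟩) e
    · have e : y.1.fst = z.1.fst := congrArg Subtype.val (Sum.inl_injective e)
      obtain ⟨n, hn⟩ := (F.rot.sameCycle_next _ _ e).exists_nat_pow_eq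
      rw [← Equiv.Perm.iterate_eq_pow] at hn
      refine ⟨n, ?_⟩
      clear e ‹S.vert _ = _›
      induction n generalizing y with
      | zero => exact congrArg Sum.inl (Subtype.ext hn)
      | succ n ih => exact ih ⟨F.rot.next y.1, by rw [F.rot.next_fst]; exact y.2⟩ hn
    · exact absurd e Sum.inl_ne_inr
    · exact absurd e Sum.inr_ne_inl
    · have e : k = l := Sum.inr_injective e
      subst e
      obtain ⟨n, rfl⟩ := Gadget.nx_orbit k c c'
      refine ⟨n, ?_⟩
      clear e
      generalize n.1 = n
      induction n generalizing c with
      | zero => rfl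
      | succ n ih => exact ih (Gadget.nx k c)

/-- The face on one side of a dart; faces that avoid the old graph have new labels. -/
def faceLabel : S.Darts → F.rot.Face ⊕ Fin 27
  | .inl y => .inl (Facial.face y.1)
  | .inr (k, c) => (Gadget.face k c).map (fun m => Facial.face (S.dart m)) id

/-- The only new transitions are at the five connecting edges. There the gadget faces `i` and `i +
1` continue the old faces of the darts `i` and `i + 1` at the replaced vertex. -/
lemma faceLabel_next_rev (t : S.Darts) : S.faceLabel (S.next (S.rev t)) = S.faceLabel t := by
  revert t
  refine S.darts_cases (fun y h h' => ?_) (fun i => ?_) (fun i => ?_) (fun k k' c h => ?_)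
  · rw [rev_inl S h h']
    exact congrArg Sum.inl (Facial.face_facePerm y)
  · rw [rev_inward]
    change (Gadget.face _ (Gadget.nx _ i)).map _ id = _
    rw [Gadget.face_nx_ext]
    refine congrArg Sum.inl ?_
    change Facial.face (S.dart (i + 1)) = Facial.face (S.dart i).symm
    rw [← S.next_dart]
    exact Facial.face_facePerm (S.dart i).symm
  · rw [rev_ext, faceLabel, Gadget.face_ext]
    exact congrArg Sum.inl (Facial.face_facePerm (S.dart i))
  · rw [rev_inr S h, next, faceLabel, Gadget.face_nx h, faceLabel]

lemma faceLabel_surjective : Function.Surjective S.faceLabel := by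
  rintro (q | q)
  · obtain ⟨y, rfl⟩ := Quotient.mk_surjective q
    by_cases hy : y.fst = S.v
    · obtain ⟨i, rfl⟩ := S.exists_dart y hy
      refine ⟨.inr (Gadget.ext i, i), ?_⟩
      rw [faceLabel, Gadget.face_ext]
      rfl
    · exact ⟨.inl ⟨y, hy⟩, rfl⟩
  · obtain ⟨k, c, h⟩ := Gadget.exists_face q
    refine ⟨.inr (k, c), ?_⟩
    rw [faceLabel, h]
    rfl

lemma card_vert : Nat.card S.Vert = Nat.card F.V + 18 := by
  have h : Nat.card {u // u = S.v} + Nat.card {u // u ≠ S.v} = Nat.card F.V := by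
    rw [← Nat.card_sum]
    exact Nat.card_congr (Equiv.sumCompl _)
  rw [Nat.card_unique] at h
  rw [Nat.card_sum, Nat.card_fin]
  omega

/-- Five darts leaving the replaced vertex disappear and 19 · 5 darts are added. -/
lemma card_darts : Nat.card S.Darts = 2 * Nat.card F.graph.edgeSet + 90 := by
  have h : Nat.card {y : F.graph.Dart // y.fst = S.v} +
      Nat.card {y : F.graph.Dart // y.fst ≠ S.v} = Nat.card F.graph.Dart := by
    rw [← Nat.card_sum]
    exact Nat.card_congr (Equiv.sumCompl _)
  have h1 : Nat.card {y : F.graph.Dart // y.fst = S.v} = 5 := by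
    rw [← Nat.card_fin 5]
    refine (Nat.card_congr (Equiv.ofBijective (fun i => ⟨S.dart i, S.dart_fst i⟩) ⟨?_, ?_⟩)).symm
    · exact fun i j h => S.dart_injective (congrArg Subtype.val h)
    · rintro ⟨y, hy⟩
      obtain ⟨i, rfl⟩ := S.exists_dart y hy
      exact ⟨i, rfl⟩
  rw [RotationSystem.card_dart] at h
  rw [Nat.card_sum, Nat.card_prod, Nat.card_fin, Nat.card_fin]
  omega

/-! ### Paths after the replacement -/

open Classical in
/-- The inclusion of the remaining old vertices. -/
noncomputable def incl (u : F.V) : S.Vert := if h : u = S.v then .inr 0 else .inl ⟨u, h⟩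

lemma incl_of_ne {u : F.V} (h : u ≠ S.v) : S.incl u = .inl ⟨u, h⟩ := dif_neg h

/-- The old vertex in the place of a new one. -/
def proj : S.Vert → F.V
  | .inl u => u
  | .inr _ => S.v

lemma proj_incl {u : F.V} : S.proj (S.incl u) = u := by
  by_cases h : u = S.v
  · rw [incl, dif_pos h, h]
    rfl
  · rw [incl, dif_neg h]
    rfl

lemma image_incl {X : Set F.V} (hX : S.v ∉ X) : S.incl '' X = {w | S.proj w ∈ X} := by
  ext w
  constructor
  · rintro ⟨u, hu, rfl⟩
    rwa [Set.mem_ofPred_eq, proj_incl]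
  · rcases w with ⟨u, hu⟩ | k
    · exact fun h => ⟨u, h, S.incl_of_ne hu⟩
    · exact fun h => absurd h hX

variable {S hF}

lemma adj_incl {i j : Fin 5} {u w : F.V} (hu : u ≠ S.v) (hw : w ≠ S.v) (h : (F.bi i j).Adj u w) :
    (biGraph (S.cmap hF).graph (S.cmap hF).edgeCol i j).Adj (S.incl u) (S.incl w) := by
  have h1 := (S.cmap hF).biGraph_adj_vert (t := .inl ⟨⟨(u, w), h.1⟩, hu⟩) h.2
  rw [S.incl_of_ne hu, S.incl_of_ne hw]
  rwa [show (S.cmap hF).α (.inl ⟨⟨(u, w), h.1⟩, hu⟩) = .inl ⟨⟨(w, u), h.1.symm⟩, hw⟩ from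
    S.rev_inl hu hw] at h1

lemma spans_incl {i j : Fin 5} {x y : F.V} {X : Set F.V} (h : Spans (F.bi i j) x y X)
    (hX : S.v ∉ X) :
    Spans (biGraph (S.cmap hF).graph (S.cmap hF).edgeCol i j) (S.incl x) (S.incl y)
      (S.incl '' X) :=
  h.map _ (fun u hu w hw => adj_incl (fun e => hX (e ▸ hu)) (fun e => hX (e ▸ hw)))
    (fun u _ w _ e => by rw [← S.proj_incl (u := u), e, proj_incl])

lemma exists_colour {i j : Fin 5} {u : F.V} (h : (F.bi i j).Adj u S.v) :
    ∃ p, (S.colour p = i ∨ S.colour p = j) ∧ (S.dart p).snd = u ∧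
      (biGraph (S.cmap hF).graph (S.cmap hF).edgeCol i j).Adj (S.incl u)
        (.inr (Gadget.ext p)) := by
  obtain ⟨p, hp⟩ := S.exists_dart ⟨(S.v, u), h.1.symm⟩ rfl
  have h1 : S.colour p = i ∨ S.colour p = j := by
    rw [colour, hp]
    exact h.symm.2
  have h2 := ((S.cmap hF).biGraph_adj_vert (t := .inr (Gadget.ext p, p)) h1).symm
  refine ⟨p, h1, by rw [hp], ?_⟩
  rw [S.incl_of_ne h.ne]
  have h3 : S.vert (S.rev (.inr (Gadget.ext p, p))) = .inl ⟨u, h.ne⟩ := by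
    rw [rev_ext, inward]
    exact congrArg Sum.inl (Subtype.ext (congrArg (fun y : F.graph.Dart => y.snd) hp))
  exact h3 ▸ h2

/-- The gadget's colour `c` is renamed `S.colour c`, so its hamiltonian path in colours p, q becomes
one in the colours with which the outer path enters and leaves. -/
lemma spans_gadget {p q : Fin 5} (hpq : p ≠ q) {i j : Fin 5}
    (hp : S.colour p = i ∨ S.colour p = j) (hq : S.colour q = i ∨ S.colour q = j) :
    Spans (biGraph (S.cmap hF).graph (S.cmap hF).edgeCol i j) (.inr (Gadget.ext p))
      (.inr (Gadget.ext q)) (Set.range Sum.inr) := by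
  rw [← Set.image_univ]
  refine (Gadget.spans p q hpq).map (L := biGraph (S.cmap hF).graph (S.cmap hF).edgeCol i j)
    (fun k => (Sum.inr k : S.Vert)) (fun k _ k' _ h => ?_) Sum.inr_injective.injOn
  have key : ∀ c, S.colour c = i ∨ S.colour c = j → Gadget.tgt k c = some k' →
      (biGraph (S.cmap hF).graph (S.cmap hF).edgeCol i j).Adj (.inr k) (.inr k') := by
    intro c hc h
    have h1 := (S.cmap hF).biGraph_adj_vert (t := .inr (k, c)) hc
    rwa [show (S.cmap hF).α (.inr (k, c)) = .inr (k', c) from S.rev_inr h] at h1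
  exact h.elim (key p hp) (key q hq)

/-- Two-coloured paths survive the replacement. -/
lemma spans {i j : Fin 5} {x y : F.V} {X : Set F.V} (h : Spans (F.bi i j) x y X)
    (hx : x ≠ S.v) (hy : y ≠ S.v) :
    Spans (biGraph (S.cmap hF).graph (S.cmap hF).edgeCol i j) (.inl ⟨x, hx⟩) (.inl ⟨y, hy⟩)
      {w | S.proj w ∈ X} := by
  rw [← S.incl_of_ne hx, ← S.incl_of_ne hy]
  by_cases hv : S.v ∈ X
  -- The path enters the replaced vertex through the dart `p` and leaves through `q`; the gadget's
  -- path from `ext p` to `ext q` is spliced in between.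
  · obtain ⟨u, w, X₁, X₂, h1, h2, h3, h4, h5, h6, h7, rfl⟩ := h.split hv hx.symm hy.symm
    obtain ⟨p, hp, hp', hpa⟩ := exists_colour (hF := hF) h2
    obtain ⟨q, hq, hq', hqa⟩ := exists_colour (hF := hF) h3.symm
    have hpq : p ≠ q := fun e =>
      Set.disjoint_left.1 h7 h1.right_mem (by rw [← hp', e, hq']; exact h4.left_mem)
    have hd : ∀ {X : Set F.V}, S.v ∉ X →
        Disjoint (Set.range (Sum.inr : Fin 19 → S.Vert)) (S.incl '' X) := by
      intro X hX
      rw [S.image_incl hX, Set.disjoint_left]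
      rintro _ ⟨k, rfl⟩ hk
      exact hX hk
    have h8 := (spans_gadget (hF := hF) hpq hp hq).append hqa.symm (spans_incl h4 h6) (hd h6)
    refine ((spans_incl h1 h5).append hpa h8 ?_).cast ?_
    · refine Set.disjoint_union_right.2 ⟨(hd h5).symm, ?_⟩
      rw [S.image_incl h5, S.image_incl h6, Set.disjoint_left]
      exact fun w hw hw' => Set.disjoint_left.1 h7 hw hw'
    · rw [S.image_incl h5, S.image_incl h6]
      ext (w | w)
      · simp [proj, w.2]
      · simp [proj]
  · exact (spans_incl h hv).cast (S.image_incl hv)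

end Site

end Fragment

/-! ### Suitability of the fragment after the replacement. -/

namespace Fragment

variable {F : Fragment}

namespace Site

variable {S : F.Site} {hF : IsProperEdgeColouring F.graph F.col}

lemma ne_of_mem_ends {u : F.V} (hu : u ∈ F.ends) : u ≠ S.v := fun h => S.notMem_ends (h ▸ hu)

lemma a_ne : F.a ≠ S.v := ne_of_mem_ends (by simp [ends])
lemma b_ne : F.b ≠ S.v := ne_of_mem_ends (by simp [ends])
lemma c_ne : F.c ≠ S.v := ne_of_mem_ends (by simp [ends])
lemma d_ne : F.d ≠ S.v := ne_of_mem_ends (by simp [ends])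

lemma connected (h : F.IsSuitable) : (S.cmap h.proper).graph.Connected :=
  ((spans (hF := h.proper) h.paths.p23 S.b_ne S.c_ne).cast (by ext; simp)).connected biGraph_le

/-- The replacement adds 18 vertices, 45 edges and 27 labels, which leaves Euler's formula balanced.
-/
lemma isPlane (h : F.IsSuitable) : (S.cmap h.proper).combMap.rot.IsPlane := by
  have : Nontrivial S.Vert := ⟨.inr 0, .inr 1, by simp⟩
  refine ((S.cmap h.proper).combMap.isPlane_of_label (connected h) S.faceLabel
    S.faceLabel_next_rev S.faceLabel_surjective ?_).1
  have h1 := (RotationSystem.isPlane_iff_of_connected h.connected F.rot).1 F.isPlane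
  have h2 := S.card_vert
  have h3 := S.card_darts
  have h4 : Nat.card (F.rot.Face ⊕ Fin 27) = Nat.card F.rot.Face + 27 := by
    rw [Nat.card_sum, Nat.card_fin]
  omega

/-- The fragment after the replacement. -/
noncomputable abbrev replace (S : F.Site) (h : F.IsSuitable) : Fragment :=
  (S.cmap h.proper).fragment (isPlane h) (.inl ⟨F.a, S.a_ne⟩) (.inl ⟨F.b, S.b_ne⟩)
    (.inl ⟨F.c, S.c_ne⟩) (.inl ⟨F.d, S.d_ne⟩) (by simpa using F.nodup)

variable (h : F.IsSuitable)

lemma inl_mem_ends_replace {u : {u : F.V // u ≠ S.v}} :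
    (Sum.inl u : S.Vert) ∈ (S.replace h).ends ↔ u.1 ∈ F.ends := by
  rw [mem_ends, mem_ends]
  simp [replace, Subtype.ext_iff]

lemma inr_notMem_ends_replace {k : Fin 19} : (Sum.inr k : S.Vert) ∉ (S.replace h).ends := by
  rw [mem_ends]
  simp [replace]

lemma paths_replace : (S.replace h).Paths := by
  have hp := h.paths
  have hpa := S.a_ne
  have hpb := S.b_ne
  have hpc := S.c_ne
  have hpd := S.d_ne
  have key : ∀ {x y : F.V} {i j : Fin 5} {X : Set F.V} {Y : Set S.Vert}
      (_ : Spans (F.bi i j) x y X) (hx : x ≠ S.v) (hy : y ≠ S.v) (_ : ∀ w, w ∈ Y ↔ S.proj w ∈ X),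
      Spans ((S.replace h).bi i j) (.inl ⟨x, hx⟩ : S.Vert) (.inl ⟨y, hy⟩ : S.Vert) Y :=
    fun hs hx hy hXY => (spans hs hx hy).cast (Set.ext fun w => (hXY w).symm)
  have ne : ∀ {x : F.V} (hx : x ≠ S.v) (w : S.Vert), w ≠ .inl ⟨x, hx⟩ ↔ S.proj w ≠ x := by
    rintro x hx (⟨u, hu⟩ | k)
    · simp [proj]
    · simpa [proj] using hx.symm
  refine ⟨key hp.p12 _ _ fun w => ne _ w, key hp.p13 _ _ fun w => ne _ w,
    key hp.p14 _ _ fun w => and_congr (ne _ w) (ne _ w),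
    key hp.p15 _ _ fun w => and_congr (ne _ w) (ne _ w), key hp.p23 _ _ fun w => Iff.rfl,
    key hp.p24 _ _ fun w => ne _ w, ?_, ?_, key hp.p35 _ _ fun w => ne _ w,
    key hp.p45 _ _ fun w => and_congr (ne _ w) (ne _ w)⟩
  · obtain ⟨X, h1, h2⟩ := hp.p25
    exact ⟨{w | S.proj w ∈ X}, key h1 _ _ fun w => Iff.rfl, key h2 _ _ fun w => Iff.rfl⟩
  · obtain ⟨X, h1, h2⟩ := hp.p34
    exact ⟨{w | S.proj w ∈ X}, key h1 _ _ fun w => Iff.rfl, key h2 _ _ fun w => Iff.rfl⟩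

lemma adj_of_adj_cmap {u w : {u : F.V // u ≠ S.v}}
    (h : (S.cmap hF).graph.Adj (.inl u) (.inl w)) : F.graph.Adj u.1 w.1 := by
  obtain ⟨t, h1, h2⟩ := h
  revert t
  refine S.darts_cases (fun y hy hy' h1 h2 => ?_) (fun i h1 h2 => ?_) (fun i h1 h2 => ?_)
    (fun k k' c h h1 h2 => ?_)
  · have h2 : S.vert (S.rev (.inl ⟨y, hy⟩)) = .inl w := h2
    rw [rev_inl S hy hy'] at h2
    have h1 : y.fst = u.1 := congrArg Subtype.val (Sum.inl_injective h1)
    have h2 : y.snd = w.1 := congrArg Subtype.val (Sum.inl_injective h2)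
    rw [← h1, ← h2]
    exact y.adj
  · have h2 : S.vert (S.rev (.inl (S.inward i))) = .inl w := h2
    rw [rev_inward] at h2
    exact absurd h2 Sum.inr_ne_inl
  · exact absurd h1 Sum.inr_ne_inl
  · exact absurd h1 Sum.inr_ne_inl

lemma local_replace : (S.replace h).Local := by
  have hl := h.local
  have hbc := (S.cmap h.proper).biGraph_adj_vert (i := F.col s(F.b, F.c))
    (j := F.col s(F.b, F.c)) (t := .inl ⟨⟨(F.b, F.c), hl.adj_bc⟩, S.b_ne⟩) (Or.inl rfl)
  rw [show (S.cmap h.proper).α (.inl ⟨⟨(F.b, F.c), hl.adj_bc⟩, S.b_ne⟩) =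
    .inl ⟨⟨(F.c, F.b), hl.adj_bc.symm⟩, S.c_ne⟩ from S.rev_inl S.b_ne S.c_ne] at hbc
  refine ⟨CMap.isProper _, hbc.1, ?_, (or_self_iff.1 hbc.2).trans hl.col_bc⟩
  rintro (u | k) hu (w | k') hw huw
  · have h1 := hl.adj_ends u.1 ((inl_mem_ends_replace h).1 hu) w.1 ((inl_mem_ends_replace h).1 hw)
      (adj_of_adj_cmap huw)
    refine Sym2.eq_iff.2 ?_
    simpa [replace, Subtype.ext_iff] using Sym2.eq_iff.1 h1
  · exact absurd hw (inr_notMem_ends_replace h)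
  · exact absurd hu (inr_notMem_ends_replace h)
  · exact absurd hu (inr_notMem_ends_replace h)

lemma card_neighborSet_replace (w : (S.replace h).V) :
    Nat.card ((S.replace h).graph.neighborSet w) =
      if w = (S.replace h).d then 2 else if w ∈ (S.replace h).ends then 3 else 5 := by
  refine ((S.cmap h.proper).card_neighborSet w).trans ?_
  rcases w with u | k
  · have h1 : Nat.card {t : S.Darts // S.vert t = .inl u} =
        Nat.card {y : F.graph.Dart // y.fst = u.1} := by
      refine (Nat.card_congr (Equiv.ofBijective (fun y => ⟨.inl ⟨y.1, y.2.trans_ne u.2⟩,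
        congrArg Sum.inl (Subtype.ext y.2)⟩) ⟨?_, ?_⟩)).symm
      · intro y z e
        have e := Sum.inl_injective (congrArg Subtype.val e)
        have e := congrArg Subtype.val e
        exact Subtype.ext e
      · rintro ⟨y | ⟨k, c⟩, e⟩
        · exact ⟨⟨y.1, congrArg Subtype.val (Sum.inl_injective e)⟩, rfl⟩
        · exact absurd e Sum.inr_ne_inl
    refine h1.trans ?_
    rw [← card_dart_fst, h.card_neighborSet]
    have h2 : (Sum.inl u : S.Vert) = (S.replace h).d ↔ u.1 = F.d := by
      simp [Subtype.ext_iff]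
    exact if_congr h2.symm rfl (if_congr (inl_mem_ends_replace h).symm rfl rfl)
  · have h1 : Nat.card {t : S.Darts // S.vert t = .inr k} = Nat.card (Fin 5) := by
      refine (Nat.card_congr (Equiv.ofBijective (fun c => ⟨.inr (k, c), rfl⟩) ⟨?_, ?_⟩)).symm
      · intro c c' e
        exact congrArg Prod.snd (Sum.inr_injective (congrArg Subtype.val e))
      · rintro ⟨y | ⟨k', c⟩, e⟩
        · exact absurd e Sum.inl_ne_inr
        · have e : k' = k := Sum.inr_injective e
          exact ⟨c, Subtype.ext (congrArg (fun k => Sum.inr (k, c)) e.symm)⟩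
    refine h1.trans ?_
    rw [if_neg, if_neg (inr_notMem_ends_replace h), Nat.card_fin]
    simp [replace]

/-- A dart of the old graph after the replacement. -/
noncomputable def oldDart (y : F.graph.Dart) (hy : y.fst ≠ S.v) : (S.replace h).graph.Dart :=
  (S.cmap h.proper).combMap.dart (.inl ⟨y, hy⟩)

variable {h} {x : F.graph.Dart} (hx : ∀ n, (F.rot.facePerm^[n] x).fst ≠ S.v)

/-- A facial walk that avoids the replaced vertex uses no changed reversal and persists step by
step. -/
lemma facePerm_oldDart (n : ℕ) :
    (S.replace h).rot.facePerm^[n] (oldDart h x (hx 0)) =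
      oldDart h (F.rot.facePerm^[n] x) (hx n) := by
  refine ((S.cmap h.proper).facePerm_iterate n (.inl ⟨x, hx 0⟩)).trans (congrArg _ ?_)
  induction n with
  | zero => rfl
  | succ n ih =>
    rw [Function.iterate_succ_apply', ih]
    have h1 := hx (n + 1)
    have h2 : (F.rot.facePerm^[n] x).snd ≠ S.v := by
      rw [Function.iterate_succ_apply'] at h1
      exact fun e => h1 ((F.rot.next_fst _).trans e)
    refine (congrArg S.next (S.rev_inl (hx n) h2)).trans ?_
    exact congrArg Sum.inl (Subtype.ext (Function.iterate_succ_apply' F.rot.facePerm n x).symm)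

lemma oldDart_injective {y z : F.graph.Dart} {hy : y.fst ≠ S.v} {hz : z.fst ≠ S.v}
    (e : oldDart h y hy = oldDart h z hz) : y = z :=
  congrArg Subtype.val (Sum.inl_injective ((S.cmap h.proper).combMap.dart.injective e))

lemma minimalPeriod_oldDart :
    Function.minimalPeriod (S.replace h).rot.facePerm (oldDart h x (hx 0)) =
      Function.minimalPeriod F.rot.facePerm x := by
  rw [Function.minimalPeriod_eq_minimalPeriod_iff]
  intro n
  rw [Function.IsPeriodicPt, Function.IsFixedPt, facePerm_oldDart hx]
  refine ⟨oldDart_injective, fun e => ?_⟩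
  have e : F.rot.facePerm^[n] x = x := e
  simp only [e]

/-- The outer face after the replacement. -/
noncomputable def facialReplace (C : F.Facial) (hC : ∀ n, (F.rot.facePerm^[n] C.x).fst ≠ S.v) :
    (S.replace h).Facial where
  x := oldDart h C.x (hC 0)
  i := C.i
  j := C.j
  k := C.k
  hi := C.hi
  hij := C.hij
  hjk := C.hjk
  hk := by rw [minimalPeriod_oldDart hC]; exact C.hk
  fst_x := congrArg Sum.inl (Subtype.ext C.fst_x)
  fst_i := by rw [facePerm_oldDart hC]; exact congrArg Sum.inl (Subtype.ext C.fst_i)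
  fst_j := by rw [facePerm_oldDart hC]; exact congrArg Sum.inl (Subtype.ext C.fst_j)
  fst_k := by rw [facePerm_oldDart hC]; exact congrArg Sum.inl (Subtype.ext C.fst_k)

end Site

lemma IsSuitable.of_facial (C : F.Facial) (hp : F.Paths) (hl : F.Local)
    (hdeg : ∀ v, Nat.card (F.graph.neighborSet v) =
      if v = F.d then 2 else if v ∈ F.ends then 3 else 5) : F.IsSuitable :=
  .of_paths hp hl ⟨C.x, C.i, C.j, C.k, C.hi, C.hij, C.hjk, C.hk, C.fst_x,
    by rw [← Equiv.Perm.iterate_eq_pow]; exact C.fst_i,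
    by rw [← Equiv.Perm.iterate_eq_pow]; exact C.fst_j,
    by rw [← Equiv.Perm.iterate_eq_pow]; exact C.fst_k⟩ hdeg

/-- A suitable fragment with a vertex that is not on the outer face. -/
def IsExtendable (F : Fragment) : Prop :=
  F.IsSuitable ∧ ∃ C : F.Facial, ∃ v ∉ F.ends, ∀ n, (F.rot.facePerm^[n] C.x).fst ≠ v

/-- The outer walk consists of old vertices only, so any gadget vertex can serve for the next
replacement. -/
lemma IsExtendable.exists_card_lt (h : F.IsExtendable) :
    ∃ F' : Fragment, F'.IsExtendable ∧ Nat.card F.V < Nat.card F'.V := by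
  obtain ⟨h, C, v, hv, hC⟩ := h
  obtain ⟨S, rfl⟩ := h.exists_site hv
  refine ⟨S.replace h, ⟨.of_facial (Site.facialReplace C hC) (Site.paths_replace h)
    (Site.local_replace h) (Site.card_neighborSet_replace h), Site.facialReplace C hC,
    (.inr 0 : S.Vert), Site.inr_notMem_ends_replace h, fun n => ?_⟩, ?_⟩
  · refine (congrArg (fun y : (S.replace h).graph.Dart => y.fst)
      (Site.facePerm_oldDart hC n)).trans_ne ?_
    exact Sum.inl_ne_inr
  · exact (by omega : Nat.card F.V < Nat.card F.V + 18).trans_eq S.card_vert.symm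

end Fragment

/-! ### A suitable fragment with 15 vertices -/

namespace Seed

/-- The starts of the darts. -/
def vertTable : List ℕ :=
  [0, 0, 0, 1, 1, 1, 2, 2, 2, 3, 3, 4, 4, 4, 4, 4, 5, 5, 5, 5, 5, 6, 6, 6, 6, 6, 7, 7, 7, 7,
  7, 8, 8, 8, 8, 8, 9, 9, 9, 9, 9, 10, 10, 10, 10, 10, 11, 11, 11, 11, 11, 12, 12, 12, 12,
  12, 13, 13, 13, 13, 13, 14, 14, 14, 14, 14]

/-- The reversal of the darts. -/
def revTable : List ℕ :=
  [15, 54, 21, 8, 48, 11, 20, 49, 3, 25, 16, 5, 34, 42, 55, 0, 10, 57, 65, 50, 6, 2, 53, 27,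
  58, 9, 59, 23, 52, 45, 38, 63, 40, 43, 12, 47, 62, 60, 30, 44, 32, 51, 13, 33, 39, 29, 64,
  35, 4, 7, 19, 41, 28, 22, 1, 14, 61, 17, 24, 26, 37, 56, 36, 31, 46, 18]

/-- The rotation. -/
def nextTable : List ℕ :=
  [1, 2, 0, 4, 5, 3, 7, 8, 6, 10, 9, 12, 13, 14, 15, 11, 17, 18, 19, 20, 16, 22, 23, 24, 25,
  21, 27, 28, 29, 30, 26, 32, 33, 34, 35, 31, 37, 38, 39, 40, 36, 42, 43, 44, 45, 41, 47,
  48, 49, 50, 46, 52, 53, 54, 55, 51, 57, 58, 59, 60, 56, 62, 63, 64, 65, 61]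

/-- The colours of the darts. -/
def colTable : List ℕ :=
  [3, 2, 1, 1, 2, 4, 3, 0, 1, 3, 2, 4, 2, 0, 1, 3, 2, 1, 0, 4, 3, 1, 0, 4, 2, 3, 0, 4, 3, 2,
  1, 4, 0, 1, 2, 3, 2, 4, 1, 3, 0, 4, 0, 1, 3, 2, 1, 3, 2, 0, 4, 4, 3, 0, 2, 1, 3, 1, 2, 0,
  4, 3, 2, 4, 1, 0]

/-- The faces to the side of the darts. -/
def faceTable : List ℕ :=
  [0, 1, 2, 0, 3, 4, 0, 5, 3, 0, 6, 0, 4, 7, 8, 1, 0, 6, 9, 10, 5, 0, 2, 11, 12, 6, 13, 12,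
  11, 14, 15, 16, 17, 18, 7, 4, 17, 19, 13, 15, 18, 14, 8, 7, 18, 15, 10, 16, 4, 3, 5, 8,
  14, 11, 2, 1, 19, 9, 6, 12, 13, 9, 19, 17, 16, 10]

def vert (t : Fin 66) : Fin 15 := Fin.ofNat 15 (vertTable.getD t 0)

def rev (t : Fin 66) : Fin 66 := Fin.ofNat 66 (revTable.getD t 0)

def next (t : Fin 66) : Fin 66 := Fin.ofNat 66 (nextTable.getD t 0)

def col (t : Fin 66) : Fin 5 := Fin.ofNat 5 (colTable.getD t 0)

def face (t : Fin 66) : Fin 20 := Fin.ofNat 20 (faceTable.getD t 0)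

/-- The coloured plane graph of the fragment. -/
def cmap : CMap (Fin 15) (Fin 66) where
  vert := vert
  σ := next
  α := rev
  col := col
  α_α := by decide +kernel
  col_α := by decide +kernel
  vert_α_ne := by decide +kernel
  inj := by decide +kernel
  proper := by decide +kernel
  vert_σ := by decide +kernel
  orbit t t' h := by
    have key : ∀ t t', vert t = vert t' → ∃ n : Fin 5, next^[n] t = t' := by decide +kernel
    obtain ⟨n, hn⟩ := key t t' h
    exact ⟨n, hn⟩

/-- Adjacency by an edge of one of two colours. -/
def BiAdj (i j : Fin 5) (u v : Fin 15) : Prop :=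
  ∃ t, vert t = u ∧ vert (rev t) = v ∧ (col t = i ∨ col t = j)

instance (i j : Fin 5) : DecidableRel (BiAdj i j) := fun u v =>
  inferInstanceAs (Decidable (∃ t, vert t = u ∧ vert (rev t) = v ∧ (col t = i ∨ col t = j)))

lemma spans {i j : Fin 5} {x y : Fin 15} {p : Fin 15 → Prop} (l : List (Fin 15))
    (h : List.IsChain (BiAdj i j) (x :: l) ∧ (x :: l).Nodup ∧
      (x :: l).getLast (List.cons_ne_nil _ _) = y ∧ ∀ v, v ∈ x :: l ↔ p v) :
    Spans (biGraph cmap.graph cmap.edgeCol i j) x y {v | p v} := by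
  obtain ⟨h1, h2, rfl, h4⟩ := h
  refine (Spans.of_list (h1.imp ?_) h2).cast (Set.ext h4)
  rintro _ _ ⟨t, rfl, rfl, h⟩
  exact cmap.biGraph_adj_vert h

lemma spans_univ : Spans (biGraph cmap.graph cmap.edgeCol 2 3) 1 2 Set.univ :=
  (spans (p := fun _ => True)
    [11, 8, 4, 0, 12, 7, 10, 9, 14, 13, 6, 3, 5, 2] (by decide +kernel)).cast (by simp)

lemma isPlane : cmap.combMap.rot.IsPlane := by
  refine (cmap.combMap.isPlane_of_label (spans_univ.connected biGraph_le) face ?_ ?_ ?_).1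
  · exact (by decide +kernel : ∀ t, face (next (rev t)) = face t)
  · exact (by decide +kernel : ∀ q, ∃ t, face t = q)
  · simp only [Nat.card_fin]
    norm_num

/-- The fragment. -/
noncomputable abbrev fragment : Fragment := cmap.fragment isPlane 0 1 2 3 (by decide)

lemma paths : fragment.Paths where
  p12 := spans [11, 14, 9, 7, 10, 8, 4, 12, 0, 6, 13, 5, 3] (by decide +kernel)
  p13 := spans [5, 13, 14, 11, 8, 10, 9, 7, 12, 4, 0, 6, 3] (by decide +kernel)
  p14 := spans [6, 7, 9, 13, 5, 11, 14, 8, 10, 12, 4, 1] (by decide +kernel)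
  p15 := spans [6, 12, 4, 10, 8, 9, 7, 13, 5, 14, 11, 2] (by decide +kernel)
  p23 := spans_univ
  p24 := spans [12, 10, 7, 6, 13, 9, 14, 8, 4, 1, 11, 5, 3] (by decide +kernel)
  p25 := ⟨{v | v ≠ 1 ∧ v ≠ 2 ∧ v ≠ 11},
    spans [12, 6, 13, 7, 10, 4, 8, 9, 14, 5, 3] (by decide +kernel),
    (spans (p := fun v => ¬ (v ≠ 1 ∧ v ≠ 2 ∧ v ≠ 11)) [11, 2] (by decide +kernel))⟩
  p34 := ⟨{v | v = 0 ∨ v = 1 ∨ v = 4}, spans [4, 1] (by decide +kernel),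
    (spans (p := fun v => ¬ (v = 0 ∨ v = 1 ∨ v = 4)) [5, 11, 8, 14, 13, 9, 10, 12, 7, 6, 3]
      (by decide +kernel))⟩
  p35 := spans [4, 10, 9, 8, 11, 2, 5, 14, 13, 7, 12, 6, 3] (by decide +kernel)
  p45 := spans [4, 10, 12, 6, 7, 13, 9, 8, 14, 5, 11, 2] (by decide +kernel)

lemma isLocal : fragment.Local := by
  refine ⟨cmap.isProper, ⟨3, rfl, rfl⟩, ?_, ?_⟩
  · rintro u hu v hv ⟨t, rfl, rfl⟩
    have key : ∀ t, vert t ∈ ({0, 1, 2, 3} : Finset (Fin 15)) →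
        vert (rev t) ∈ ({0, 1, 2, 3} : Finset (Fin 15)) →
        s(vert t, vert (rev t)) = s((1 : Fin 15), 2) := by decide +kernel
    exact key t hu hv
  · exact cmap.edgeCol_vert 3

lemma card_neighborSet (v : Fin 15) : Nat.card (fragment.graph.neighborSet v) =
    if v = fragment.d then 2 else if v ∈ fragment.ends then 3 else 5 := by
  have key : ∀ v, Fintype.card {t // vert t = v} =
      if v = 3 then 2 else if v ∈ ({0, 1, 2, 3} : Finset (Fin 15)) then 3 else 5 := by
    decide +kernel
  refine (cmap.card_neighborSet v).trans (Eq.trans ?_ (key v))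
  exact Nat.card_eq_fintype_card

/-- The outer face. -/
noncomputable def facial : fragment.Facial where
  x := cmap.combMap.dart 0
  i := 2
  j := 3
  k := 5
  hi := by decide
  hij := by decide
  hjk := by decide
  hk := by
    -- The outer walk has length 7. As 7 is prime, returning after 7 steps without being fixed
    -- determines the minimal period.
    have : Fact (Nat.Prime 7) := ⟨by decide⟩
    rw [cmap.minimalPeriod_facePerm, Function.minimalPeriod_eq_prime (p := 7)]
    · decide
    · exact (by decide +kernel : (fun t => next (rev t))^[7] 0 = 0)
    · exact (by decide +kernel : next (rev 0) ≠ 0)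
  fst_x := by exact (by decide +kernel : vert 0 = 0)
  fst_i := by
    rw [cmap.facePerm_iterate]
    exact (by decide +kernel : vert ((fun t => next (rev t))^[2] 0) = 1)
  fst_j := by
    rw [cmap.facePerm_iterate]
    exact (by decide +kernel : vert ((fun t => next (rev t))^[3] 0) = 2)
  fst_k := by
    rw [cmap.facePerm_iterate]
    exact (by decide +kernel : vert ((fun t => next (rev t))^[5] 0) = 3)

/-- The outer face has label 0, and no dart with this label leaves the vertex 7. -/
lemma isExtendable : fragment.IsExtendable := by
  refine ⟨.of_facial facial paths isLocal card_neighborSet, facial, (7 : Fin 15), ?_, fun n => ?_⟩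
  · exact (by decide : (7 : Fin 15) ∉ ({0, 1, 2, 3} : Finset (Fin 15)))
  · have h1 : ∀ n, face ((fun t => next (rev t))^[n] 0) = 0 := by
      intro n
      induction n with
      | zero => decide +kernel
      | succ n ih =>
        rw [Function.iterate_succ_apply', ← ih]
        exact (by decide +kernel : ∀ t, face (next (rev t)) = face t) _
    have h2 : ∀ t, face t = 0 → vert t ≠ 7 := by decide +kernel
    refine (congrArg (fun y : fragment.graph.Dart => y.fst)
      (cmap.facePerm_iterate n 0)).trans_ne ?_
    exact h2 _ (h1 n)

end Seed

/-! ### The theorem -/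

/-- Iterated replacement makes |V| strictly increase, and the divorce has 2|V| - 4 vertices, so no
two of the divorces are isomorphic. -/
lemma exists_infinite_family : ∃ F : ℕ → Fragment, (∀ n, (F n).IsSuitable) ∧
    ∀ m n, m ≠ n → IsEmpty ((F m).divorce ≃g (F n).divorce) := by
  choose! f hf hf' using fun F : Fragment => Fragment.IsExtendable.exists_card_lt (F := F)
  have h : ∀ n, (f^[n] Seed.fragment).IsExtendable := by
    intro n
    induction n with
    | zero => exact Seed.isExtendable
    | succ n ih =>
      rw [Function.iterate_succ_apply']
      exact hf _ ih
  have hmono : StrictMono fun n => Nat.card (f^[n] Seed.fragment).V := by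
    refine strictMono_nat_of_lt_succ fun n => ?_
    rw [Function.iterate_succ_apply']
    exact hf' _ (h n)
  refine ⟨fun n => f^[n] Seed.fragment, fun n => (h n).1, fun m n hmn => ⟨fun e => hmn ?_⟩⟩
  refine hmono.injective ?_
  have h1 : Nat.card (f^[m] Seed.fragment).DivorceV = Nat.card (f^[n] Seed.fragment).DivorceV :=
    Nat.card_congr e.toEquiv
  have h2 := Fragment.Facial.card_divorceV (F := f^[m] Seed.fragment)
  have h3 := Fragment.Facial.card_divorceV (F := f^[n] Seed.fragment)
  change Nat.card (f^[m] Seed.fragment).V = Nat.card (f^[n] Seed.fragment).V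
  omega

end PerfHam

theorem mainTheorem6 :
    -- the divorce of a suitable fragment, and its properties
    (∀ F : PerfHam.Fragment, F.IsSuitable →
      PerfHam.IsPlanar F.divorce ∧
      PerfHam.IsQuintic F.divorce ∧
      PerfHam.IsPerfectlyHamiltonian F.divorce ∧
      -- a perfect 1-factorisation: the colouring of the fragment, permuted in the second copy
      (∃ col : Sym2 F.DivorceV → Fin 5,
        (∀ e ∈ F.graph.edgeSet, col (e.map F.left) = F.col e ∧
          col (e.map F.right) = PerfHam.Fragment.colPerm (F.col e)) ∧
        PerfHam.IsPerfectOneFactorisation F.divorce (PerfHam.colourClass F.divorce col)) ∧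
      -- exchanging the two copies is a rotational symmetry
      (∃ ρ : F.divorce ≃g F.divorce,
        (∀ v, ρ (F.left v) = F.right v ∧ ρ (F.right v) = F.left v) ∧
        PerfHam.IsRotationalSymmetry F.divorce ρ) ∧
      -- every non-trivial 5-edge-cut is one of a copy of the fragment that does not separate
      -- `a`, `b`, `c`, `d`
      (∀ M : Set (Sym2 F.DivorceV), PerfHam.IsNontrivialFiveEdgeCut F.divorce M →
        ∃ Y : Set F.V, (∀ v ∈ Y, v ∉ F.ends) ∧
          PerfHam.IsNontrivialFiveEdgeCut F.graph (PerfHam.edgeCut F.graph Y) ∧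
          (M = Sym2.map F.left '' PerfHam.edgeCut F.graph Y ∨
            M = Sym2.map F.right '' PerfHam.edgeCut F.graph Y))) ∧
    -- infinitely many pairwise non-isomorphic graphs arise in this way
    (∃ F : ℕ → PerfHam.Fragment, (∀ n, (F n).IsSuitable) ∧
      ∀ m n, m ≠ n → IsEmpty ((F m).divorce ≃g (F n).divorce)) := by
  refine ⟨fun F h => ⟨?_, h.isQuintic, ⟨5, _, h.isPerfectOneFactorisation⟩,
    ⟨F.divCol, ?_, h.isPerfectOneFactorisation⟩, ⟨F.exchIso, ?_, h.isRotationalSymmetry⟩, ?_⟩,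
    PerfHam.exists_infinite_family⟩
  · obtain ⟨-, -, R, hR, -⟩ := h.isRotationalSymmetry
    exact ⟨R, hR⟩
  · intro e he
    induction e with | _ u v
    exact ⟨h.local.divCol_side (s := false) he, h.local.divCol_side (s := true) he⟩
  · exact fun v => ⟨F.exchIso_side false v, F.exchIso_side true v⟩
  · intro M hM
    obtain ⟨Y, h1, h2, _ | _, h3⟩ := h.exists_cut M hM
    exacts [⟨Y, h1, h2, Or.inl h3⟩, ⟨Y, h1, h2, Or.inr h3⟩]
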